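/- For every $n\ge 1$ let $\mathbf d=\mathbf d^{(n)}=(d_1,\dots,d_n)$ be a sequence of non-negative integers with $\sum_i d_i$ even, and suppose that, as $n\to\infty$, $$\sum_{i=1}^n d_i=\Theta(n),\qquad \sum_{i=1}^n d_i^2=O(n),\qquad \max_i d_i=o(n^{1/2}).$$ Give each vertex $i\in\{1,\dots,n\}$ a set of $d_i$ half-edges. A configuration is a perfect matching of all the half-edges; its pairs are called edges, and it projects to a multigraph on $\{1,\dots,n\}$. An edge is bad if it is a loop or is parallel to another edge; a configuration is simple if it has no bad edge. Let the random simple graph $\hat G(n,\mathbf d)$ be constructed as follows. Start with a uniformly random configuration. As long as the current configuration is not simple, choose a bad edge $\{i_\alpha,j_\beta\}$ in it by some given rule, choose another edge $\{k_\gamma,\ell_\delta\}$ uniformly at random among all other edges, order its two half-edges $k_\gamma,\ell_\delta$ uniformly at random, and replace the two edges by $\{i_\alpha,\ell_\delta\}$ and $\{k_\gamma,j_\beta\}$. When the configuration is simple, stop, and let $\hat G(n,\mathbf d)$ be the simple graph to which it projects; if the process never terminates, restart it with a new independent uniformly random configuration. The rule for choosing the bad edge is arbitrary: it may be deterministic or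 random, may depend on $n$ and on the history of the process so far, and only has to choose a bad edge of the current configuration. Let $G(n,\mathbf d)$ be a uniformly random simple graph on $\{1,\dots,n\}$ with degree sequence $\mathbf d$. Then, for every choice of the rules, $\hat G(n,\mathbf d)$ and $G(n,\mathbf d)$ are well defined for all large $n$, and, as $n\to\infty$, $$d_{TV}\bigl(\hat G(n,\mathbf d),G(n,\mathbf d)\bigr)\to 0,$$ where $d_{TV}(X,Y)=\sup_A|\mathbb P(X\in A)-\mathbb P(Y\in A)|$. In other words, there exists a coupling of $\hat G(n,\mathbf d)$ and $G(n,\mathbf d)$ such that $$\mathbb P\bigl(\hat G(n,\mathbf d)\neq G(n,\mathbf d)\bigr)\to 0.$$ -/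

import Mathlib

open Filter Topology Asymptotics MeasureTheory ProbabilityTheory
open scoped ENNReal

noncomputable section

/-! ### Configurations -/

/-- The half-edges of the degree sequence `d`: vertex `i` carries `d i` of them. -/
abbrev HalfEdge {n : ℕ} (d : Fin n → ℕ) : Type := Σ i : Fin n, Fin (d i)

/-- A configuration, i.e. a perfect matching of the half-edges, given as the fixed-point-free
involution that sends each half-edge to its partner. The edges are the pairs `{h, Γ h}`; naming
an edge by one of its half-edges `h` amounts to naming it with the order `(h, Γ h)`. -/
abbrev Configuration {n : ℕ} (d : Fin n → ℕ) : Type :=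
  {σ : Equiv.Perm (HalfEdge d) // ∀ h, σ (σ h) = h ∧ σ h ≠ h}

namespace Configuration

variable {n : ℕ} {d : Fin n → ℕ}

theorem nonempty_of_even (hd : Even (∑ i, d i)) : Nonempty (Configuration d) := by
  obtain ⟨m, hm⟩ := hd
  have hc : Fintype.card (HalfEdge d) = Fintype.card (Fin m ⊕ Fin m) := by
    simp [HalfEdge, Fintype.card_sigma, hm]
  let e : HalfEdge d ≃ Fin m ⊕ Fin m := Fintype.equivOfCardEq hc
  refine ⟨⟨(e.trans (Equiv.sumComm _ _)).trans e.symm, fun h => ⟨?_, ?_⟩⟩⟩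
  · simp
  · intro h0
    have h1 : (e h).swap = e h := by
      have := congrArg e h0
      simpa using this
    rcases h2 : e h with a | a <;> simp [h2] at h1

/-- The unordered pair of endpoints of the edge `{h, Γ h}`. -/
def endpoints (Γ : Configuration d) (h : HalfEdge d) : Sym2 (Fin n) := s(h.1, (Γ.1 h).1)

/-- The edge `{h, Γ h}` is a loop. -/
def IsLoop (Γ : Configuration d) (h : HalfEdge d) : Prop := (Γ.1 h).1 = h.1

/-- The edge `{h, Γ h}` is parallel to another edge. -/
def IsParallel (Γ : Configuration d) (h : HalfEdge d) : Prop :=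
  ∃ h' : HalfEdge d, h' ≠ h ∧ h' ≠ Γ.1 h ∧ Γ.endpoints h' = Γ.endpoints h

/-- The edge `{h, Γ h}` is bad. -/
def IsBad (Γ : Configuration d) (h : HalfEdge d) : Prop := Γ.IsLoop h ∨ Γ.IsParallel h

/-- There is no bad edge. -/
def IsSimple (Γ : Configuration d) : Prop := ∀ h, ¬ Γ.IsBad h

/-- The simple graph whose edges are the non-loop vertex pairs joined by an edge of `Γ`; for a
simple configuration this is the (multi)graph to which it projects. -/
def toGraph (Γ : Configuration d) : SimpleGraph (Fin n) where
  Adj i j := i ≠ j ∧ ∃ h : HalfEdge d, h.1 = i ∧ (Γ.1 h).1 = j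
  symm := ⟨by
    rintro i j ⟨hij, h, rfl, rfl⟩
    exact ⟨hij.symm, Γ.1 h, rfl, by rw [(Γ.2 h).1]⟩⟩
  loopless := ⟨fun _ h => h.1 rfl⟩

/-- The switching of the edge `(b, Γ b)` with another edge `(e, Γ e)`: these are replaced by
`{b, Γ e}` and `{e, Γ b}`. As an involution, this is `Γ` conjugated by the transposition of
`Γ b` and `Γ e`. -/
def switch (Γ : Configuration d) (b e : HalfEdge d) : Configuration d :=
  ⟨Equiv.swap (Γ.1 b) (Γ.1 e) * Γ.1 * Equiv.swap (Γ.1 b) (Γ.1 e), fun h => by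
    refine ⟨by simp [Equiv.Perm.mul_apply, (Γ.2 _).1], fun h0 => ?_⟩
    refine (Γ.2 (Equiv.swap (Γ.1 b) (Γ.1 e) h)).2 ?_
    have := congrArg (Equiv.swap (Γ.1 b) (Γ.1 e)) h0
    simpa [Equiv.Perm.mul_apply] using this⟩

end Configuration

/-! ### The switching process -/

/-- A finite history of the construction: the initial configuration, followed by the list of
switchings made so far. In `H.step b e`, the bad edge `(b, Γ b)` of the configuration `Γ` reached
by `H` is switched with the other edge `(e, Γ e)`. -/
inductive History {n : ℕ} (d : Fin n → ℕ) : Type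
  | start (Γ : Configuration d) : History d
  | step (H : History d) (b e : HalfEdge d) : History d

/-- The configuration reached by a history. -/
def History.current {n : ℕ} {d : Fin n → ℕ} : History d → Configuration d
  | .start Γ => Γ
  | .step H b e => H.current.switch b e

/-- A rule for choosing the bad edge to be switched next. It may be deterministic or random, and
may depend on the whole history; the only requirement is that it chooses a bad edge of the current
configuration, whenever there is one. -/
def BadEdgeRule {n : ℕ} (d : Fin n → ℕ) : Type :=
  ∀ H : History d, ¬ H.current.IsSimple → PMF {b : HalfEdge d // H.current.IsBad b}

open scoped Classical in
/-- The half-edges outside the edge `{b, Γ b}`. -/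
def otherHalfEdges {n : ℕ} {d : Fin n → ℕ} (Γ : Configuration d) (b : HalfEdge d) :
    Finset (HalfEdge d) := {e | e ≠ b ∧ e ≠ Γ.1 b}

open scoped Classical in
/-- One step of the construction. If the current configuration is simple, we stop. Otherwise a bad
edge `b` is chosen by the rule, and `b` is switched with a uniformly random other edge with a
uniformly random order of its two half-edges, i.e. with `(e, Γ e)` for a uniformly random half-edge
`e` outside the edge `b`. (If `b` is the only edge, the process is stuck forever.) -/
def stepLaw {n : ℕ} {d : Fin n → ℕ} (R : BadEdgeRule d) (H : History d) : PMF (History d) :=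
  if hH : H.current.IsSimple then PMF.pure H
  else (R H hH).bind fun b =>
    if hb : (otherHalfEdges H.current b.1).Nonempty then
      (PMF.uniformOfFinset (otherHalfEdges H.current b.1) hb).map fun e => H.step b.1 e
    else PMF.pure H

open scoped Classical in
/-- The law of the history after (at most) `k` switchings, starting with a uniformly random
configuration. -/
def processLaw {n : ℕ} {d : Fin n → ℕ} (hd : Even (∑ i, d i)) (R : BadEdgeRule d) :
    ℕ → PMF (History d)
  | 0 =>
    haveI := Configuration.nonempty_of_even hd
    (PMF.uniformOfFintype (Configuration d)).map History.start
  | k + 1 => (processLaw hd R k).bind (stepLaw R)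

/-- The probability that the process terminates with the simple graph `G`: the limit (supremum) as
`k → ∞` of the probability that it has done so after at most `k` switchings. -/
def terminalProb {n : ℕ} {d : Fin n → ℕ} (hd : Even (∑ i, d i)) (R : BadEdgeRule d)
    (G : SimpleGraph (Fin n)) : ℝ≥0∞ :=
  ⨆ k : ℕ, (processLaw hd R k).toOuterMeasure {H | H.current.IsSimple ∧ H.current.toGraph = G}

open scoped Classical in
/-- The probability that the process does not terminate. -/
def failureProb {n : ℕ} {d : Fin n → ℕ} (hd : Even (∑ i, d i)) (R : BadEdgeRule d) : ℝ≥0∞ :=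
  1 - ∑ G : SimpleGraph (Fin n), terminalProb hd R G

/-- The law of the switched random graph. If the process does not terminate, it is restarted
with a new random configuration, so the graph is `G` with probability
`∑ j, P(the first j attempts fail) * P(an attempt terminates with G)`. -/
def switchedLaw {n : ℕ} {d : Fin n → ℕ} (hd : Even (∑ i, d i)) (R : BadEdgeRule d) :
    Measure (SimpleGraph (Fin n)) :=
  Measure.sum fun G : SimpleGraph (Fin n) =>
    (∑' j : ℕ, failureProb hd R ^ j * terminalProb hd R G) • Measure.dirac G

open scoped Classical in
/-- The law of the uniformly random simple graph with degree sequence `d`. -/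
def uniformLaw {n : ℕ} (d : Fin n → ℕ) : Measure (SimpleGraph (Fin n)) :=
  uniformOn {G : SimpleGraph (Fin n) | ∀ i, G.degree i = d i}

/-! ### Total variation distance -/

/-- The total variation distance `sup |μ(A) - ν(A)|` over measurable `A`, for probability
measures. -/
def tvDist {α : Type*} [MeasurableSpace α] (μ ν : Measure α) : ℝ :=
  ⨆ A : {A : Set α // MeasurableSet A}, |μ.real A.1 - ν.real A.1|

end

/-! Let N be the number of half-edges, D the maximal degree, and let the excess of a configuration
be the number of edges whose deletion makes it simple. Switching a bad edge with a generic one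
(good, and with no conflict at the new endpoints) lowers the excess by exactly one
(`Generic.excess_switch`). When the excess is at most K, all but O(K + D²) half-edges are generic
(`card_not_generic_le`). The mean excess is bounded (`sum_excess_le`) and D² = o(N), so typically
the process makes boundedly many switchings, all of them generic.

The rule hardly matters. Let `value ψ k Γ` be the expectation of ψ of the graph reached when bad
edges are picked uniformly. Generic switchings of two bad edges commute (`switch_comm`), and bad
edges not parallel to the switched one stay bad; parallel bad edges are exchanged by a symmetry. By
induction on the excess, the mean value after one switching depends on the bad edge only up to O(2^k
(K + D²) / N) (`abs_avgSwitch_value_sub_le`).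

The outcome is nearly uniform. Let S_k be the sum of the values over the configurations of excess k.
Counting the pairs of a configuration and a switching of one of its bad edges from both ends gives
4(k+1) S_{k+1} ≈ λ S_k, with one λ for all ψ and k (`abs_stratumSum_succ_sub_le`). Downwards, the
number of weighted bad half-edges is four times the excess unless three edges are parallel. Upwards,
the ways to create a loop or a double edge number 2P + T(Γ) up to O(K D²), where P is `pairCount`, a
constant, and T, which is `doublingCount`, is concentrated (`sum_doublingCount_deviation_sq_le`).
Each simple graph comes from ∏ dᵢ! configurations (`card_fibre`), so S_0 = 0 when ψ has mean zero
over the graphs with the given degrees. Then every S_k is negligible against the number of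
configurations.

Take ψ = 1_A − a, where a is the uniform probability of A. The initial mean of the value of 1_A is
then at least a − o(1), with Markov's inequality for the tail of the excess. Comparing with the
actual process step by step (`cappedValue_le_step`) gives a ≤ ℙ(the first attempt ends in A) + o(1),
uniformly in A and in the rule. This one-sided bound suffices: complements turn it into total
variation, a maximal coupling (`exists_coupling`) into a coupling, and its proof also shows that
simple configurations exist. -/

/-! ### Algebra of switchings and of relabellings of half-edges -/

section Switching

open scoped Classical

namespace Configuration

variable {n : ℕ} {d : Fin n → ℕ}

@[simp] theorem partner_partner (Γ : Configuration d) (h : HalfEdge d) : Γ.1 (Γ.1 h) = h :=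
  (Γ.2 h).1

theorem partner_ne (Γ : Configuration d) (h : HalfEdge d) : Γ.1 h ≠ h := (Γ.2 h).2

theorem partner_eq_comm (Γ : Configuration d) {a b : HalfEdge d} : Γ.1 a = b ↔ Γ.1 b = a :=
  ⟨fun h => by rw [← h]; simp, fun h => by rw [← h]; simp⟩

theorem partner_inj (Γ : Configuration d) {a b : HalfEdge d} : Γ.1 a = Γ.1 b ↔ a = b :=
  Γ.1.injective.eq_iff

@[ext] theorem config_ext {Γ Δ : Configuration d} (h : ∀ x, Γ.1 x = Δ.1 x) : Γ = Δ :=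
  Subtype.ext (Equiv.ext h)

/-- The ordered pair of endpoints of an oriented edge. -/
def ends (Γ : Configuration d) (h : HalfEdge d) : Fin n × Fin n := (h.1, (Γ.1 h).1)

theorem ends_partner (Γ : Configuration d) (h : HalfEdge d) :
    Γ.ends (Γ.1 h) = (Γ.ends h).swap := by simp [ends]

/-- Orienting edges replaces unordered endpoints by ordered ones. The condition `h' ≠ Γ.1 h` can be
dropped, since an edge and its reversal have the same ordered endpoints only for a loop. -/
theorem isBad_iff (Γ : Configuration d) (h : HalfEdge d) :
    Γ.IsBad h ↔ Γ.IsLoop h ∨ ∃ h', h' ≠ h ∧ Γ.ends h' = Γ.ends h := by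
  constructor
  · rintro (hl | ⟨h', h1, h2, h3⟩)
    · exact Or.inl hl
    · right
      simp only [endpoints, Sym2.eq_iff] at h3
      rcases h3 with h3 | h3
      · exact ⟨h', h1, Prod.ext h3.1 h3.2⟩
      · refine ⟨Γ.1 h', fun h4 => h2 ((Γ.partner_eq_comm.1 h4).symm), ?_⟩
        rw [ends_partner]
        exact Prod.ext h3.2 h3.1
  · rintro (hl | ⟨h', h1, h2⟩)
    · exact Or.inl hl
    · by_cases hl : Γ.IsLoop h
      · exact Or.inl hl
      refine Or.inr ⟨h', h1, ?_, ?_⟩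
      · rintro rfl
        rw [ends_partner] at h2
        exact hl (congrArg Prod.fst h2)
      · have ha := congrArg Prod.fst h2
        have hb := congrArg Prod.snd h2
        simp only [ends] at ha hb
        simp [endpoints, ha, hb]

theorem isLoop_partner (Γ : Configuration d) (h : HalfEdge d) :
    Γ.IsLoop (Γ.1 h) ↔ Γ.IsLoop h := by
  simp [IsLoop, eq_comm]

theorem isBad_partner (Γ : Configuration d) (h : HalfEdge d) :
    Γ.IsBad (Γ.1 h) ↔ Γ.IsBad h := by
  have key : ∀ h, Γ.IsBad h → Γ.IsBad (Γ.1 h) := by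
    intro h hb
    rw [isBad_iff] at hb ⊢
    rcases hb with hl | ⟨h', h1, h2⟩
    · exact Or.inl ((Γ.isLoop_partner h).2 hl)
    · exact Or.inr ⟨Γ.1 h', fun h3 => h1 (Γ.partner_inj.1 h3), by simp only [ends_partner, h2]⟩
  exact ⟨fun h1 => by simpa using key _ h1, key h⟩

/-! ### The effect of a switching on half-edges -/

theorem switch_apply (Γ : Configuration d) (b e h : HalfEdge d) :
    (Γ.switch b e).1 h =
      Equiv.swap (Γ.1 b) (Γ.1 e) (Γ.1 (Equiv.swap (Γ.1 b) (Γ.1 e) h)) := rfl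

theorem switch_apply_left (Γ : Configuration d) {b e : HalfEdge d} (he : e ≠ Γ.1 b) :
    (Γ.switch b e).1 b = Γ.1 e := by
  have h1 : b ≠ Γ.1 e := fun h => he (Γ.partner_eq_comm.1 h.symm).symm
  rw [switch_apply, Equiv.swap_apply_of_ne_of_ne (Γ.partner_ne b).symm h1, Equiv.swap_apply_left]

theorem switch_apply_right (Γ : Configuration d) {b e : HalfEdge d} (he : e ≠ Γ.1 b) :
    (Γ.switch b e).1 e = Γ.1 b := by
  rw [switch_apply, Equiv.swap_apply_of_ne_of_ne he (Γ.partner_ne e).symm, Equiv.swap_apply_right]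

theorem switch_apply_left_partner (Γ : Configuration d) {b e : HalfEdge d} (he : e ≠ Γ.1 b) :
    (Γ.switch b e).1 (Γ.1 b) = e := by
  rw [partner_eq_comm, switch_apply_right Γ he]

theorem switch_apply_right_partner (Γ : Configuration d) {b e : HalfEdge d} (he : e ≠ Γ.1 b) :
    (Γ.switch b e).1 (Γ.1 e) = b := by
  rw [partner_eq_comm, switch_apply_left Γ he]

theorem switch_apply_of_ne (Γ : Configuration d) {b e h : HalfEdge d} (h1 : h ≠ b)
    (h2 : h ≠ Γ.1 b) (h3 : h ≠ e) (h4 : h ≠ Γ.1 e) : (Γ.switch b e).1 h = Γ.1 h := by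
  rw [switch_apply, Equiv.swap_apply_of_ne_of_ne h2 h4, Equiv.swap_apply_of_ne_of_ne]
  · exact fun h5 => h1 (Γ.partner_inj.1 h5)
  · exact fun h5 => h3 (Γ.partner_inj.1 h5)

theorem switch_self (Γ : Configuration d) (b : HalfEdge d) : Γ.switch b b = Γ := by
  apply config_ext; intro h; simp [switch_apply]

theorem switch_partner_self (Γ : Configuration d) (b : HalfEdge d) :
    Γ.switch b (Γ.1 b) = Γ := by
  apply config_ext
  intro h
  rw [switch_apply, partner_partner]
  by_cases h1 : h = b
  · subst h1; simp
  by_cases h2 : h = Γ.1 b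
  · subst h2; simp
  rw [Equiv.swap_apply_of_ne_of_ne h2 h1, Equiv.swap_apply_of_ne_of_ne]
  · exact fun h3 => h1 (Γ.partner_inj.1 h3)
  · exact fun h3 => h2 (Γ.partner_eq_comm.1 h3).symm

/-- The first switching exchanges the partners of `b` and `e`, so the second conjugates by the same
transposition. For fixed `b` and `e` a switching is thus a measure-preserving change of variables;
all the double counting rests on this. -/
theorem switch_switch (Γ : Configuration d) (b e : HalfEdge d) :
    (Γ.switch b e).switch b e = Γ := by
  by_cases he : e = Γ.1 b
  · subst he; rw [switch_partner_self, switch_partner_self]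
  · apply config_ext
    intro h
    rw [switch_apply, switch_apply_left Γ he, switch_apply_right Γ he, switch_apply,
      Equiv.swap_comm (Γ.1 e)]
    simp

/-- Switching along fixed half-edges is an involution of the configurations. -/
def switchEquiv (b e : HalfEdge d) : Configuration d ≃ Configuration d where
  toFun Γ := Γ.switch b e
  invFun Γ := Γ.switch b e
  left_inv Γ := Γ.switch_switch b e
  right_inv Γ := Γ.switch_switch b e

/-- Reversing `b` has the effect of reversing `e`, so a mean over all `e` does not see the
orientation of `b`. -/
theorem switch_partner (Γ : Configuration d) (b e : HalfEdge d) :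
    Γ.switch (Γ.1 b) e = Γ.switch b (Γ.1 e) := by
  by_cases he : e = Γ.1 b
  · subst he; rw [switch_self, partner_partner, switch_self]
  by_cases he' : e = b
  · subst he'
    rw [switch_partner_self]
    conv_lhs => rw [show e = Γ.1 (Γ.1 e) by simp]
    simp only [partner_partner]
    conv_lhs => arg 3; rw [show e = Γ.1 (Γ.1 e) by simp]
    rw [switch_partner_self]
  have h1 : e ≠ Γ.1 (Γ.1 b) := by simpa using he'
  have h2 : Γ.1 e ≠ Γ.1 b := fun h => he' (Γ.partner_inj.1 h)
  apply config_ext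
  intro h
  by_cases c1 : h = b
  · subst c1
    rw [switch_apply_left Γ h2]
    have := switch_apply_left_partner Γ h1
    simpa using this
  by_cases c2 : h = Γ.1 b
  · subst c2
    rw [switch_apply_left Γ h1, switch_apply_left_partner Γ h2]
  by_cases c3 : h = e
  · subst c3
    rw [switch_apply_right Γ h1]
    have := switch_apply_right_partner Γ h2
    simpa using this.symm
  by_cases c4 : h = Γ.1 e
  · subst c4
    rw [switch_apply_right_partner Γ h1, switch_apply_right Γ h2]
  rw [switch_apply_of_ne Γ c2 (by simpa using c1) c3 c4,
    switch_apply_of_ne Γ c1 c2 c4 (by simpa using c3)]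

/-- On disjoint edges neither switching moves the partners that the other one uses, and the two
transpositions commute. This is the source of the independence of the rule. -/
theorem switch_comm (Γ : Configuration d) {b e b' e' : HalfEdge d}
    (h1 : b' ≠ b) (h2 : b' ≠ Γ.1 b) (h3 : e ≠ b') (h4 : e ≠ Γ.1 b') (h5 : e' ≠ b)
    (h6 : e' ≠ Γ.1 b) (h7 : e' ≠ e) (h8 : e' ≠ Γ.1 e) :
    (Γ.switch b e).switch b' e' = (Γ.switch b' e').switch b e := by
  have h2' : Γ.1 b' ≠ b := fun h => h2 (Γ.partner_eq_comm.1 h).symm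
  have h4' : b' ≠ Γ.1 e := fun h => h4 (Γ.partner_eq_comm.1 h.symm).symm
  have h8' : e ≠ Γ.1 e' := fun h => h8 (Γ.partner_eq_comm.1 h.symm).symm
  have h6' : b ≠ Γ.1 e' := fun h => h6 (Γ.partner_eq_comm.1 h.symm).symm
  have a1 : (Γ.switch b e).1 b' = Γ.1 b' := switch_apply_of_ne Γ h1 h2 h3.symm h4'
  have a2 : (Γ.switch b e).1 e' = Γ.1 e' := switch_apply_of_ne Γ h5 h6 h7 h8
  have a3 : (Γ.switch b' e').1 b = Γ.1 b := switch_apply_of_ne Γ h1.symm h2'.symm h5.symm h6'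
  have a4 : (Γ.switch b' e').1 e = Γ.1 e := switch_apply_of_ne Γ h3 h4 h7.symm h8'
  have hc : Equiv.swap (Γ.1 b) (Γ.1 e) * Equiv.swap (Γ.1 b') (Γ.1 e') =
      Equiv.swap (Γ.1 b') (Γ.1 e') * Equiv.swap (Γ.1 b) (Γ.1 e) := by
    apply Equiv.Perm.Disjoint.commute
    intro x
    by_cases x1 : x = Γ.1 b'
    · left; subst x1
      exact Equiv.swap_apply_of_ne_of_ne (fun h => h1 (Γ.partner_inj.1 h))
        (fun h => h3 (Γ.partner_inj.1 h).symm)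
    by_cases x2 : x = Γ.1 e'
    · left; subst x2
      exact Equiv.swap_apply_of_ne_of_ne (fun h => h5 (Γ.partner_inj.1 h))
        (fun h => h7 (Γ.partner_inj.1 h))
    right
    exact Equiv.swap_apply_of_ne_of_ne x1 x2
  apply Subtype.ext
  change Equiv.swap ((Γ.switch b e).1 b') ((Γ.switch b e).1 e') *
      (Equiv.swap (Γ.1 b) (Γ.1 e) * Γ.1 * Equiv.swap (Γ.1 b) (Γ.1 e)) *
      Equiv.swap ((Γ.switch b e).1 b') ((Γ.switch b e).1 e') =
    Equiv.swap ((Γ.switch b' e').1 b) ((Γ.switch b' e').1 e) *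
      (Equiv.swap (Γ.1 b') (Γ.1 e') * Γ.1 * Equiv.swap (Γ.1 b') (Γ.1 e')) *
      Equiv.swap ((Γ.switch b' e').1 b) ((Γ.switch b' e').1 e)
  rw [a1, a2, a3, a4]
  simp only [mul_assoc]
  rw [hc]
  simp only [← mul_assoc]
  rw [hc]

/-! ### Relabelling half-edges -/

/-- The configuration obtained by renaming the half-edges. -/
def relabel (π : Equiv.Perm (HalfEdge d)) (Γ : Configuration d) : Configuration d :=
  ⟨π * Γ.1 * π⁻¹, fun h => by
    refine ⟨by simp [Equiv.Perm.mul_apply], fun h0 => ?_⟩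
    refine Γ.partner_ne (π⁻¹ h) ?_
    have := congrArg (fun x => π⁻¹ x) h0
    simpa [Equiv.Perm.mul_apply] using this⟩

theorem relabel_apply (π : Equiv.Perm (HalfEdge d)) (Γ : Configuration d) (h : HalfEdge d) :
    (Γ.relabel π).1 (π h) = π (Γ.1 h) := by
  simp [relabel, Equiv.Perm.mul_apply]

theorem relabel_switch (π : Equiv.Perm (HalfEdge d)) (Γ : Configuration d) (b e : HalfEdge d) :
    (Γ.relabel π).switch (π b) (π e) = (Γ.switch b e).relabel π := by
  apply config_ext
  intro h
  obtain ⟨h, rfl⟩ := π.surjective h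
  have hs : ∀ x y z, Equiv.swap (π x) (π y) (π z) = π (Equiv.swap x y z) := by
    intro x y z
    rw [Equiv.swap_apply_def, Equiv.swap_apply_def]
    simp only [π.injective.eq_iff]
    split_ifs <;> rfl
  simp only [switch_apply, relabel_apply, hs]

theorem ends_relabel {π : Equiv.Perm (HalfEdge d)} (hπ : ∀ h, (π h).1 = h.1)
    (Γ : Configuration d) (h : HalfEdge d) : (Γ.relabel π).ends (π h) = Γ.ends h := by
  simp [ends, relabel_apply, hπ]

theorem isBad_relabel {π : Equiv.Perm (HalfEdge d)} (hπ : ∀ h, (π h).1 = h.1)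
    (Γ : Configuration d) (h : HalfEdge d) : (Γ.relabel π).IsBad (π h) ↔ Γ.IsBad h := by
  have hl : ∀ h, (Γ.relabel π).IsLoop (π h) ↔ Γ.IsLoop h := by
    intro h; simp [IsLoop, relabel_apply, hπ]
  rw [isBad_iff, isBad_iff, hl, ends_relabel hπ]
  refine or_congr Iff.rfl ⟨?_, ?_⟩
  · rintro ⟨h', h1, h2⟩
    obtain ⟨h', rfl⟩ := π.surjective h'
    exact ⟨h', fun h3 => h1 (by rw [h3]), by rwa [ends_relabel hπ] at h2⟩
  · rintro ⟨h', h1, h2⟩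
    exact ⟨π h', fun h3 => h1 (π.injective h3), by rwa [ends_relabel hπ]⟩

theorem isSimple_relabel {π : Equiv.Perm (HalfEdge d)} (hπ : ∀ h, (π h).1 = h.1)
    (Γ : Configuration d) : (Γ.relabel π).IsSimple ↔ Γ.IsSimple := by
  constructor
  · intro h1 h
    rw [← isBad_relabel hπ]; exact h1 _
  · intro h1 h
    obtain ⟨h, rfl⟩ := π.surjective h
    rw [isBad_relabel hπ]; exact h1 _

theorem toGraph_adj (Γ : Configuration d) (i j : Fin n) :
    Γ.toGraph.Adj i j ↔ i ≠ j ∧ ∃ h, Γ.ends h = (i, j) := by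
  simp [toGraph, ends, Prod.ext_iff]

theorem toGraph_relabel {π : Equiv.Perm (HalfEdge d)} (hπ : ∀ h, (π h).1 = h.1)
    (Γ : Configuration d) : (Γ.relabel π).toGraph = Γ.toGraph := by
  ext i j
  rw [toGraph_adj, toGraph_adj]
  refine and_congr_right fun _ => ⟨?_, ?_⟩
  · rintro ⟨h, h1⟩
    obtain ⟨h, rfl⟩ := π.surjective h
    exact ⟨h, by rwa [ends_relabel hπ] at h1⟩
  · rintro ⟨h, h1⟩
    exact ⟨π h, by rwa [ends_relabel hπ]⟩

/-- Two distinct non-loop edges with the same endpoints are exchanged by a relabelling that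
preserves the vertices and the configuration. -/
theorem exists_relabel_of_ends_eq (Γ : Configuration d) {b b' : HalfEdge d}
    (hb : ¬ Γ.IsLoop b) (h : Γ.ends b' = Γ.ends b) :
    ∃ π : Equiv.Perm (HalfEdge d), (∀ h, (π h).1 = h.1) ∧ Γ.relabel π = Γ ∧ π b = b' := by
  have e1 : b'.1 = b.1 := congrArg Prod.fst h
  -- The relabelling swaps `b` with `b'` and their partners with each other. As `b` is not a loop,
  -- these two transpositions are disjoint when `b ≠ b'`.
  have e2 : (Γ.1 b').1 = (Γ.1 b).1 := congrArg Prod.snd h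
  have n1 : b ≠ Γ.1 b' := fun h => hb (by simp only [IsLoop]; rw [← e2, ← h])
  have n2 : b' ≠ Γ.1 b := fun h => n1 (Γ.partner_eq_comm.1 h.symm).symm
  by_cases hbb : b = b'
  · exact ⟨1, fun _ => rfl, by apply config_ext; intro h; simp [relabel], by simp [hbb]⟩
  have hfst : ∀ (x y z : HalfEdge d), x.1 = y.1 → (Equiv.swap x y z).1 = z.1 := by
    intro x y z hxy
    rw [Equiv.swap_apply_def]
    split_ifs with c1 c2
    · rw [c1, hxy]
    · rw [c2, hxy]
    · rfl
  refine ⟨Equiv.swap b b' * Equiv.swap (Γ.1 b) (Γ.1 b'), fun h => ?_, ?_, ?_⟩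
  · rw [Equiv.Perm.mul_apply, hfst _ _ _ e1.symm, hfst _ _ _ e2.symm]
  · apply config_ext
    intro x
    obtain ⟨x, rfl⟩ := (Equiv.swap b b' * Equiv.swap (Γ.1 b) (Γ.1 b')).surjective x
    rw [relabel_apply]
    simp only [Equiv.Perm.mul_apply]
    have m1 := Γ.partner_ne b
    have m2 := Γ.partner_ne b'
    by_cases c1 : x = b
    · subst c1
      rw [Equiv.swap_apply_left, Equiv.swap_apply_of_ne_of_ne n1.symm m2,
        Equiv.swap_apply_of_ne_of_ne m1.symm n1, Equiv.swap_apply_left]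
    by_cases c2 : x = b'
    · subst c2
      rw [Equiv.swap_apply_right, Equiv.swap_apply_of_ne_of_ne m1 n2.symm,
        Equiv.swap_apply_of_ne_of_ne n2 m2.symm, Equiv.swap_apply_right]
    by_cases c3 : x = Γ.1 b
    · subst c3
      rw [partner_partner, Equiv.swap_apply_of_ne_of_ne m1.symm n1, Equiv.swap_apply_left,
        Equiv.swap_apply_left, Equiv.swap_apply_of_ne_of_ne n1.symm m2, partner_partner]
    by_cases c4 : x = Γ.1 b'
    · subst c4
      rw [partner_partner, Equiv.swap_apply_of_ne_of_ne n2 m2.symm, Equiv.swap_apply_right,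
        Equiv.swap_apply_right, Equiv.swap_apply_of_ne_of_ne m1 n2.symm, partner_partner]
    have c5 : Γ.1 x ≠ b := fun h => c3 (Γ.partner_eq_comm.1 h).symm
    have c6 : Γ.1 x ≠ b' := fun h => c4 (Γ.partner_eq_comm.1 h).symm
    have c7 : Γ.1 x ≠ Γ.1 b := fun h => c1 (Γ.partner_inj.1 h)
    have c8 : Γ.1 x ≠ Γ.1 b' := fun h => c2 (Γ.partner_inj.1 h)
    rw [Equiv.swap_apply_of_ne_of_ne c7 c8, Equiv.swap_apply_of_ne_of_ne c5 c6,
      Equiv.swap_apply_of_ne_of_ne c3 c4, Equiv.swap_apply_of_ne_of_ne c1 c2]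
  · rw [Equiv.Perm.mul_apply, Equiv.swap_apply_of_ne_of_ne (Γ.partner_ne b).symm n1,
      Equiv.swap_apply_left]

end Configuration

end Switching

/-! ### The excess of a configuration and the effect of a generic switching on it -/

section Deficit

open scoped Classical

namespace Configuration

variable {n : ℕ} {d : Fin n → ℕ}

/-- The ordered pairs of distinct vertices joined by an edge. -/
noncomputable def adjSet (Γ : Configuration d) : Finset (Fin n × Fin n) :=
  (Finset.univ.image Γ.ends).filter fun p => p.1 ≠ p.2

theorem mem_adjSet (Γ : Configuration d) (p : Fin n × Fin n) :
    p ∈ Γ.adjSet ↔ p.1 ≠ p.2 ∧ ∃ h, Γ.ends h = p := by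
  simp [adjSet, and_comm]

/-- The number of half-edges minus the number of ordered adjacent pairs of vertices. -/
noncomputable def deficit (Γ : Configuration d) : ℕ := Fintype.card (HalfEdge d) - Γ.adjSet.card

/-- The number of edges that have to be removed to make the configuration simple. -/
noncomputable def excess (Γ : Configuration d) : ℕ := Γ.deficit / 2

theorem card_adjSet_le (Γ : Configuration d) : Γ.adjSet.card ≤ Fintype.card (HalfEdge d) :=
  (Finset.card_filter_le _ _).trans Finset.card_image_le

theorem deficit_add_card (Γ : Configuration d) :
    Γ.deficit + Γ.adjSet.card = Fintype.card (HalfEdge d) :=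
  Nat.sub_add_cancel Γ.card_adjSet_le

theorem even_card_of_involution {α : Type*} (s : Finset α) (f : α → α) (hf : ∀ a ∈ s, f a ∈ s)
    (hff : ∀ a ∈ s, f (f a) = a) (hne : ∀ a ∈ s, f a ≠ a) : Even s.card := by
  have h : (∑ _a ∈ s, (1 : ZMod 2)) = 0 :=
    Finset.sum_involution (fun a _ => f a) (fun _ _ => by decide) (fun a ha _ => hne a ha) hf hff
  rw [Finset.sum_const, nsmul_one] at h
  exact (ZMod.natCast_eq_zero_iff_even).1 h

/-- The partner map and the swap of coordinates are fixed-point-free involutions of the half-edges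
and of the adjacent pairs, so the halving in `excess` is exact. -/
theorem two_mul_excess (Γ : Configuration d) : 2 * Γ.excess = Γ.deficit := by
  have h1 : Even (Fintype.card (HalfEdge d)) :=
    even_card_of_involution Finset.univ Γ.1 (by simp) (by simp) (fun a _ => Γ.partner_ne a)
  have h2 : Even Γ.adjSet.card := by
    refine even_card_of_involution _ Prod.swap ?_ (by simp) ?_
    · intro p hp
      rw [mem_adjSet] at hp ⊢
      obtain ⟨hp1, h, hh⟩ := hp
      exact ⟨hp1.symm, Γ.1 h, by rw [ends_partner, hh]⟩
    · intro p hp h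
      rw [mem_adjSet] at hp
      exact hp.1 (congrArg Prod.snd h)
  have h3 := Γ.deficit_add_card
  have h4 : Even Γ.deficit := by
    rw [← h3, Nat.even_add] at h1
    exact h1.2 h2
  exact Nat.mul_div_cancel' h4.two_dvd

/-- The loops, as half-edges. -/
noncomputable def loopSet (Γ : Configuration d) : Finset (HalfEdge d) := Finset.univ.filter Γ.IsLoop

/-- The bad half-edges. -/
noncomputable def badSet (Γ : Configuration d) : Finset (HalfEdge d) := Finset.univ.filter Γ.IsBad

/-- The ordered pairs of distinct half-edges that orient two parallel non-loop edges in the same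
direction. -/
noncomputable def parSet (Γ : Configuration d) : Finset (HalfEdge d × HalfEdge d) :=
  Finset.univ.filter fun p => ¬ Γ.IsLoop p.1 ∧ p.1 ≠ p.2 ∧ Γ.ends p.2 = Γ.ends p.1

theorem mem_loopSet (Γ : Configuration d) (h : HalfEdge d) : h ∈ Γ.loopSet ↔ Γ.IsLoop h := by
  simp [loopSet]

theorem mem_badSet (Γ : Configuration d) (h : HalfEdge d) : h ∈ Γ.badSet ↔ Γ.IsBad h := by
  simp [badSet]

theorem mem_parSet (Γ : Configuration d) (p : HalfEdge d × HalfEdge d) :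
    p ∈ Γ.parSet ↔ ¬ Γ.IsLoop p.1 ∧ p.1 ≠ p.2 ∧ Γ.ends p.2 = Γ.ends p.1 := by
  simp [parSet]

/-- The oriented edges with given endpoints. -/
noncomputable def fiber (Γ : Configuration d) (p : Fin n × Fin n) : Finset (HalfEdge d) :=
  Finset.univ.filter fun h => Γ.ends h = p

theorem mem_fiber (Γ : Configuration d) (p : Fin n × Fin n) (h : HalfEdge d) :
    h ∈ Γ.fiber p ↔ Γ.ends h = p := by
  simp [fiber]

theorem isLoop_iff (Γ : Configuration d) (h : HalfEdge d) :
    Γ.IsLoop h ↔ (Γ.ends h).1 = (Γ.ends h).2 := by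
  simp [IsLoop, ends, eq_comm]

theorem fiber_pos (Γ : Configuration d) {p : Fin n × Fin n} (hp : p ∈ Γ.adjSet) :
    1 ≤ (Γ.fiber p).card := by
  rw [mem_adjSet] at hp
  obtain ⟨_, h, hh⟩ := hp
  exact Finset.card_pos.2 ⟨h, (Γ.mem_fiber p h).2 hh⟩

theorem card_halfEdge_eq (Γ : Configuration d) :
    Fintype.card (HalfEdge d) = Γ.loopSet.card + ∑ p ∈ Γ.adjSet, (Γ.fiber p).card := by
  have h1 : (Finset.univ.filter fun h => ¬ Γ.IsLoop h).card =
      ∑ p ∈ Γ.adjSet, (Γ.fiber p).card := by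
    rw [Finset.card_eq_sum_card_fiberwise (f := Γ.ends) (t := Γ.adjSet)]
    · refine Finset.sum_congr rfl fun p hp => ?_
      congr 1
      ext h
      rw [mem_adjSet] at hp
      simp only [Finset.mem_filter, Finset.mem_univ, true_and, mem_fiber, and_iff_right_iff_imp]
      intro hh
      rw [isLoop_iff, hh]; exact hp.1
    · intro h hh
      simp only [Finset.coe_filter, Finset.mem_univ, true_and, Set.mem_ofPred_eq] at hh
      rw [Finset.mem_coe, mem_adjSet]
      exact ⟨fun h2 => hh ((Γ.isLoop_iff h).2 h2), h, rfl⟩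
  rw [← h1, ← Finset.card_univ]
  exact (Finset.card_filter_add_card_filter_not (s := Finset.univ) Γ.IsLoop).symm

/-- Every loop half-edge is superfluous, and so are all but one of the oriented edges over each
ordered adjacent pair. -/
theorem deficit_eq (Γ : Configuration d) :
    Γ.deficit = Γ.loopSet.card + ∑ p ∈ Γ.adjSet, ((Γ.fiber p).card - 1) := by
  have h1 := Γ.deficit_add_card
  rw [Γ.card_halfEdge_eq] at h1
  have h2 : ∑ p ∈ Γ.adjSet, (Γ.fiber p).card =
      ∑ p ∈ Γ.adjSet, ((Γ.fiber p).card - 1) + Γ.adjSet.card := by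
    rw [Finset.card_eq_sum_ones, ← Finset.sum_add_distrib]
    exact Finset.sum_congr rfl fun p hp => (Nat.sub_add_cancel (Γ.fiber_pos hp)).symm
  omega

theorem card_parSet (Γ : Configuration d) :
    Γ.parSet.card = ∑ p ∈ Γ.adjSet, (Γ.fiber p).card * ((Γ.fiber p).card - 1) := by
  rw [Finset.card_eq_sum_card_fiberwise (f := fun q => Γ.ends q.1) (t := Γ.adjSet)]
  · refine Finset.sum_congr rfl fun p hp => ?_
    rw [Nat.mul_sub_one, ← Finset.offDiag_card]
    congr 1
    ext q
    rw [mem_adjSet] at hp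
    simp only [Finset.mem_filter, mem_parSet, Finset.mem_offDiag, mem_fiber]
    constructor
    · rintro ⟨⟨_, h2, h3⟩, h4⟩
      exact ⟨h4, h3.trans h4, h2⟩
    · rintro ⟨h1, h2, h3⟩
      refine ⟨⟨?_, h3, h2.trans h1.symm⟩, h1⟩
      rw [isLoop_iff, h1]; exact hp.1
  · intro q hq
    rw [Finset.mem_coe, mem_parSet] at hq
    rw [Finset.mem_coe, mem_adjSet]
    exact ⟨fun h => hq.1 ((Γ.isLoop_iff _).2 h), q.1, rfl⟩

/-- A fibre of size m contributes bad half-edges only if m ≥ 2, and then m ≤ 2(m − 1). -/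
theorem card_badSet_le (Γ : Configuration d) : Γ.badSet.card ≤ 2 * Γ.deficit := by
  have h1 : Γ.badSet ⊆ Γ.loopSet ∪
      (Γ.adjSet.filter fun p => 2 ≤ (Γ.fiber p).card).biUnion Γ.fiber := by
    intro h hh
    rw [mem_badSet, isBad_iff] at hh
    rw [Finset.mem_union, mem_loopSet]
    by_cases hl : Γ.IsLoop h
    · exact Or.inl hl
    right
    rcases hh with hh | ⟨h', h1, h2⟩
    · exact absurd hh hl
    rw [Finset.mem_biUnion]
    refine ⟨Γ.ends h, ?_, (Γ.mem_fiber _ _).2 rfl⟩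
    rw [Finset.mem_filter, mem_adjSet]
    refine ⟨⟨fun h3 => hl ((Γ.isLoop_iff h).2 h3), h, rfl⟩, ?_⟩
    exact Finset.one_lt_card.2 ⟨h', (Γ.mem_fiber _ _).2 h2, h, (Γ.mem_fiber _ _).2 rfl, h1⟩
  have h2 : ((Γ.adjSet.filter fun p => 2 ≤ (Γ.fiber p).card).biUnion Γ.fiber).card ≤
      ∑ p ∈ Γ.adjSet, 2 * ((Γ.fiber p).card - 1) := by
    refine Finset.card_biUnion_le.trans ?_
    rw [Finset.sum_filter]
    refine Finset.sum_le_sum fun p _ => ?_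
    split_ifs with h <;> omega
  rw [← Finset.mul_sum] at h2
  have h3 := Finset.card_le_card h1
  have h4 := Finset.card_union_le Γ.loopSet
    ((Γ.adjSet.filter fun p => 2 ≤ (Γ.fiber p).card).biUnion Γ.fiber)
  have h5 := Γ.deficit_eq
  omega

theorem card_loopSet_le (Γ : Configuration d) : Γ.loopSet.card ≤ Γ.deficit := by
  rw [deficit_eq]; omega

theorem card_parSet_le (Γ : Configuration d) : Γ.parSet.card ≤ 4 * Γ.deficit ^ 2 := by
  have h1 : Γ.parSet ⊆ Γ.badSet ×ˢ Γ.badSet := by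
    intro p hp
    rw [mem_parSet] at hp
    rw [Finset.mem_product, mem_badSet, mem_badSet, isBad_iff, isBad_iff]
    exact ⟨Or.inr ⟨p.2, hp.2.1.symm, hp.2.2⟩, Or.inr ⟨p.1, hp.2.1, hp.2.2.symm⟩⟩
  have h2 := Finset.card_le_card h1
  rw [Finset.card_product] at h2
  have h3 := Γ.card_badSet_le
  calc _ ≤ _ := h2
    _ ≤ (2 * Γ.deficit) * (2 * Γ.deficit) := Nat.mul_le_mul h3 h3
    _ = _ := by ring

/-- Some three edges are parallel to each other. -/
def HasTriple (Γ : Configuration d) : Prop := ∃ p ∈ Γ.adjSet, 3 ≤ (Γ.fiber p).card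

/-- Fibrewise this is 2(m − 1) ≤ m(m − 1). Equality fails only for m ≥ 3, which is why triples of
parallel edges are the sole obstruction to an exact count. -/
theorem two_mul_deficit_le (Γ : Configuration d) :
    2 * Γ.deficit ≤ 2 * Γ.loopSet.card + Γ.parSet.card := by
  rw [deficit_eq, card_parSet, mul_add, Finset.mul_sum]
  refine Nat.add_le_add_left (Finset.sum_le_sum fun p hp => ?_) _
  rcases Nat.lt_or_ge (Γ.fiber p).card 2 with h | h
  · have : (Γ.fiber p).card - 1 = 0 := by omega
    simp [this]
  · exact Nat.mul_le_mul_right _ h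

theorem two_mul_deficit_eq (Γ : Configuration d) (h : ¬ Γ.HasTriple) :
    2 * Γ.deficit = 2 * Γ.loopSet.card + Γ.parSet.card := by
  rw [deficit_eq, card_parSet, mul_add, Finset.mul_sum]
  congr 1
  refine Finset.sum_congr rfl fun p hp => ?_
  have h1 := Γ.fiber_pos hp
  have h2 : (Γ.fiber p).card < 3 := by
    by_contra h3
    exact h ⟨p, hp, not_lt.1 h3⟩
  have : (Γ.fiber p).card = 1 ∨ (Γ.fiber p).card = 2 := by omega
  rcases this with h3 | h3 <;> simp [h3]

theorem isSimple_iff (Γ : Configuration d) : Γ.IsSimple ↔ Γ.excess = 0 := by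
  have h0 := Γ.two_mul_excess
  constructor
  · intro h
    have h1 : Γ.loopSet = ∅ := by
      rw [Finset.eq_empty_iff_forall_notMem]
      intro x hx
      exact h x (Or.inl ((Γ.mem_loopSet x).1 hx))
    have h2 : Γ.parSet = ∅ := by
      rw [Finset.eq_empty_iff_forall_notMem]
      intro x hx
      rw [mem_parSet] at hx
      exact h x.1 ((Γ.isBad_iff _).2 (Or.inr ⟨x.2, hx.2.1.symm, hx.2.2⟩))
    have h3 := Γ.two_mul_deficit_le
    rw [h1, h2] at h3
    simp at h3
    omega
  · intro h x hx
    have h1 := Γ.card_badSet_le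
    have h2 : 0 < Γ.badSet.card := Finset.card_pos.2 ⟨x, (Γ.mem_badSet x).2 hx⟩
    omega

theorem badSet_nonempty (Γ : Configuration d) (h : Γ.excess ≠ 0) : Γ.badSet.Nonempty := by
  by_contra h1
  rw [Finset.not_nonempty_iff_eq_empty] at h1
  apply h
  rw [← isSimple_iff]
  intro x hx
  rw [← mem_badSet, h1] at hx
  simp at hx

/-! ### Generic switchings -/

/-- The switching of `b` with `e` destroys no edge that matters and creates no bad edge. -/
structure Generic (Γ : Configuration d) (b e : HalfEdge d) : Prop where
  ne : e ≠ b
  ne_partner : e ≠ Γ.1 b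
  good : ¬ Γ.IsBad e
  left : ∀ h, Γ.ends h ≠ (b.1, (Γ.1 e).1)
  left_ne : (Γ.1 e).1 ≠ b.1
  right : ∀ h, Γ.ends h ≠ (e.1, (Γ.1 b).1)
  right_ne : e.1 ≠ (Γ.1 b).1

theorem card_vertex (i : Fin n) :
    (Finset.univ.filter fun h : HalfEdge d => h.1 = i).card = d i := by
  have : (Finset.univ.filter fun h : HalfEdge d => h.1 = i) =
      (Finset.univ : Finset (Fin (d i))).map ⟨fun x => (⟨i, x⟩ : HalfEdge d),
        fun x y h => by simpa using h⟩ := by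
    ext ⟨j, x⟩
    simp only [Finset.mem_filter, Finset.mem_univ, true_and, Finset.mem_map]
    constructor
    · rintro rfl; exact ⟨x, rfl⟩
    · rintro ⟨a, ha⟩; exact (congrArg Sigma.fst ha).symm
  rw [this, Finset.card_map, Finset.card_univ, Fintype.card_fin]

theorem card_second_neighbours_le {D : ℕ} (hD : ∀ i, d i ≤ D) (Γ : Configuration d)
    (i : Fin n) :
    (Finset.univ.filter fun e : HalfEdge d => ∃ h, Γ.ends h = (i, e.1)).card ≤ D * D := by
  have h1 : (Finset.univ.filter fun e : HalfEdge d => ∃ h, Γ.ends h = (i, e.1)) ⊆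
      (Finset.univ.filter fun h : HalfEdge d => h.1 = i).biUnion fun h =>
        Finset.univ.filter fun e : HalfEdge d => e.1 = (Γ.1 h).1 := by
    intro e he
    simp only [Finset.mem_filter, Finset.mem_univ, true_and, Finset.mem_biUnion] at he ⊢
    obtain ⟨h, hh⟩ := he
    exact ⟨h, congrArg Prod.fst hh, (congrArg Prod.snd hh).symm⟩
  refine (Finset.card_le_card h1).trans ((Finset.card_biUnion_le_card_mul _ _ D ?_).trans ?_)
  · intro h _
    rw [card_vertex]; exact hD _
  · rw [card_vertex]; exact Nat.mul_le_mul_right _ (hD _)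

/-- An `e` fails because it lies on the edge of `b`, is bad, would produce a loop at an end of `b`
(at most D half-edges per end), or would produce a parallel edge there (at most D² per end, by
counting second neighbours). -/
theorem card_not_generic_le {D : ℕ} (hD : ∀ i, d i ≤ D) (Γ : Configuration d) (b : HalfEdge d) :
    (Finset.univ.filter fun e => ¬ Γ.Generic b e).card ≤
      2 + 2 * Γ.deficit + 2 * D + 2 * (D * D) := by
  set A1 := Finset.univ.filter fun e : HalfEdge d => ∃ h, Γ.ends h = ((Γ.1 b).1, e.1)
  set A2 := (Finset.univ.filter fun e : HalfEdge d => ∃ h, Γ.ends h = (b.1, e.1)).image Γ.1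
  set A3 := Finset.univ.filter fun e : HalfEdge d => e.1 = (Γ.1 b).1
  set A4 := (Finset.univ.filter fun e : HalfEdge d => e.1 = b.1).image Γ.1
  have h1 : (Finset.univ.filter fun e => ¬ Γ.Generic b e) ⊆
      ({b, Γ.1 b} : Finset _) ∪ (Γ.badSet ∪ (A3 ∪ (A4 ∪ (A1 ∪ A2)))) := by
    intro e he
    simp only [Finset.mem_filter, Finset.mem_univ, true_and] at he
    by_contra hc
    simp only [Finset.mem_union, Finset.mem_insert, Finset.mem_singleton, not_or] at hc
    obtain ⟨⟨c1, c2⟩, c3, c4, c5, c6, c7⟩ := hc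
    apply he
    refine ⟨c1, c2, fun h => c3 ((Γ.mem_badSet e).2 h), fun h hh => c7 ?_, fun h => c5 ?_,
      fun h hh => c6 ?_, fun h => c4 ?_⟩
    · exact Finset.mem_image.2 ⟨Γ.1 e, Finset.mem_filter.2 ⟨Finset.mem_univ _, h, hh⟩, by simp⟩
    · exact Finset.mem_image.2 ⟨Γ.1 e, by simpa using h, by simp⟩
    · refine Finset.mem_filter.2 ⟨Finset.mem_univ _, Γ.1 h, ?_⟩
      rw [ends_partner, hh]; rfl
    · exact Finset.mem_filter.2 ⟨Finset.mem_univ _, h⟩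
  have k1 : A1.card ≤ D * D := card_second_neighbours_le hD Γ _
  have k2 : A2.card ≤ D * D :=
    Finset.card_image_le.trans (card_second_neighbours_le hD Γ _)
  have k3 : A3.card ≤ D := by rw [card_vertex]; exact hD _
  have k4 : A4.card ≤ D := Finset.card_image_le.trans (by rw [card_vertex]; exact hD _)
  have k5 := Γ.card_badSet_le
  have k6 : ({b, Γ.1 b} : Finset (HalfEdge d)).card ≤ 2 := Finset.card_le_two
  have l1 := Finset.card_le_card h1
  have l2 := Finset.card_union_le ({b, Γ.1 b} : Finset _) (Γ.badSet ∪ (A3 ∪ (A4 ∪ (A1 ∪ A2))))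
  have l3 := Finset.card_union_le Γ.badSet (A3 ∪ (A4 ∪ (A1 ∪ A2)))
  have l4 := Finset.card_union_le A3 (A4 ∪ (A1 ∪ A2))
  have l5 := Finset.card_union_le A4 (A1 ∪ A2)
  have l6 := Finset.card_union_le A1 A2
  omega

theorem exists_ends_iff (Γ : Configuration d) (b e : HalfEdge d) (p : Fin n × Fin n) :
    (∃ h, Γ.ends h = p) ↔ (p = (b.1, (Γ.1 b).1) ∨ p = ((Γ.1 b).1, b.1) ∨ p = (e.1, (Γ.1 e).1) ∨
      p = ((Γ.1 e).1, e.1)) ∨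
      ∃ h, h ≠ b ∧ h ≠ Γ.1 b ∧ h ≠ e ∧ h ≠ Γ.1 e ∧ Γ.ends h = p := by
  constructor
  · rintro ⟨h, rfl⟩
    by_cases c1 : h = b
    · subst c1; exact Or.inl (Or.inl rfl)
    by_cases c2 : h = Γ.1 b
    · subst c2; left; right; left; rw [ends_partner]; rfl
    by_cases c3 : h = e
    · subst c3; left; right; right; left; rfl
    by_cases c4 : h = Γ.1 e
    · subst c4; left; right; right; right; rw [ends_partner]; rfl
    exact Or.inr ⟨h, c1, c2, c3, c4, rfl⟩
  · rintro ((rfl | rfl | rfl | rfl) | ⟨h, _, _, _, _, hh⟩)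
    · exact ⟨b, rfl⟩
    · exact ⟨Γ.1 b, by rw [ends_partner]; rfl⟩
    · exact ⟨e, rfl⟩
    · exact ⟨Γ.1 e, by rw [ends_partner]; rfl⟩
    · exact ⟨h, hh⟩

theorem exists_ends_switch_iff (Γ : Configuration d) {b e : HalfEdge d} (he : e ≠ Γ.1 b)
    (p : Fin n × Fin n) :
    (∃ h, (Γ.switch b e).ends h = p) ↔
      (p = (b.1, (Γ.1 e).1) ∨ p = ((Γ.1 e).1, b.1) ∨ p = (e.1, (Γ.1 b).1) ∨
      p = ((Γ.1 b).1, e.1)) ∨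
      ∃ h, h ≠ b ∧ h ≠ Γ.1 b ∧ h ≠ e ∧ h ≠ Γ.1 e ∧ Γ.ends h = p := by
  rw [exists_ends_iff (Γ.switch b e) b e, switch_apply_left Γ he, switch_apply_right Γ he]
  refine or_congr Iff.rfl (exists_congr fun h => ?_)
  constructor
  · rintro ⟨h1, h2, h3, h4, h5⟩
    refine ⟨h1, h4, h3, h2, ?_⟩
    rw [ends, switch_apply_of_ne Γ h1 h4 h3 h2] at h5
    exact h5
  · rintro ⟨h1, h2, h3, h4, h5⟩
    refine ⟨h1, h4, h3, h2, ?_⟩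
    rw [ends, switch_apply_of_ne Γ h1 h2 h3 h4]
    exact h5

theorem card_adjSet_switch_le (Γ : Configuration d) (b e : HalfEdge d) :
    (Γ.switch b e).adjSet.card ≤ Γ.adjSet.card + 4 := by
  by_cases he : e = Γ.1 b
  · subst he; rw [switch_partner_self]; omega
  have h1 : (Γ.switch b e).adjSet ⊆ Γ.adjSet ∪ ({(b.1, (Γ.1 e).1), ((Γ.1 e).1, b.1),
      (e.1, (Γ.1 b).1), ((Γ.1 b).1, e.1)} : Finset _) := by
    intro p hp
    rw [mem_adjSet, exists_ends_switch_iff Γ he] at hp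
    rw [Finset.mem_union, mem_adjSet, exists_ends_iff Γ b e]
    simp only [Finset.mem_insert, Finset.mem_singleton]
    obtain ⟨h1, h2 | h2⟩ := hp
    · exact Or.inr h2
    · exact Or.inl ⟨h1, Or.inr h2⟩
  refine (Finset.card_le_card h1).trans ((Finset.card_union_le _ _).trans ?_)
  exact Nat.add_le_add_left Finset.card_le_four _

/-- Two new edges create at most four ordered adjacent pairs. No genericity is needed here; the
bound confines the switchings that reach excess `k` to configurations of excess at most `k + 2`. -/
theorem excess_le_switch (Γ : Configuration d) (b e : HalfEdge d) :
    Γ.excess ≤ (Γ.switch b e).excess + 2 := by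
  have h1 := card_adjSet_switch_le Γ b e
  have h2 := Γ.deficit_add_card
  have h3 := (Γ.switch b e).deficit_add_card
  have h4 := Γ.two_mul_excess
  have h5 := (Γ.switch b e).two_mul_excess
  omega

/-- Removing the bad edge loses no adjacency, removing the good edge loses two ordered pairs, and
the two new edges gain four. The deficit therefore drops by exactly two. -/
theorem Generic.excess_switch {Γ : Configuration d} {b e : HalfEdge d} (hg : Γ.Generic b e)
    (hb : Γ.IsBad b) : (Γ.switch b e).excess + 1 = Γ.excess := by
  obtain ⟨g1, g2, g3, g4, g5, g6, g7⟩ := hg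
  rw [isBad_iff] at g3 hb
  push Not at g3
  obtain ⟨g3, g8⟩ := g3
  simp only [IsLoop] at g3
  have hbe : Γ.ends b ≠ Γ.ends e := g8 b g1.symm
  have hbe' : Γ.ends (Γ.1 b) ≠ Γ.ends e := g8 _ g2.symm
  -- The untouched edges are not parallel to `e`, which is good, and do not occupy the places of the
  -- new edges.
  have hS : ∀ p : Fin n × Fin n, (∃ h, h ≠ b ∧ h ≠ Γ.1 b ∧ h ≠ e ∧ h ≠ Γ.1 e ∧ Γ.ends h = p) →
      p ≠ (e.1, (Γ.1 e).1) ∧ p ≠ ((Γ.1 e).1, e.1) ∧ p ≠ (b.1, (Γ.1 e).1) ∧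
      p ≠ ((Γ.1 e).1, b.1) ∧ p ≠ (e.1, (Γ.1 b).1) ∧ p ≠ ((Γ.1 b).1, e.1) := by
    rintro p ⟨h, h1, h2, h3, h4, rfl⟩
    refine ⟨g8 h h3, fun hh => ?_, g4 h, fun hh => ?_, g6 h, fun hh => ?_⟩
    · refine g8 (Γ.1 h) (fun h5 => h4 ?_) ?_
      · rw [← h5]; simp
      · rw [ends_partner, hh]; rfl
    · refine g4 (Γ.1 h) ?_
      rw [ends_partner, hh]; rfl
    · refine g6 (Γ.1 h) ?_
      rw [ends_partner, hh]; rfl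
  -- Badness of `b` enters here: either it is a loop, which gives no adjacent pair, or an untouched
  -- edge keeps its ends adjacent.
  have hB : (b.1 = (Γ.1 b).1) ∨ ((∃ h, h ≠ b ∧ h ≠ Γ.1 b ∧ h ≠ e ∧ h ≠ Γ.1 e ∧
      Γ.ends h = (b.1, (Γ.1 b).1)) ∧ (∃ h, h ≠ b ∧ h ≠ Γ.1 b ∧ h ≠ e ∧ h ≠ Γ.1 e ∧
      Γ.ends h = ((Γ.1 b).1, b.1))) := by
    by_cases hl : b.1 = (Γ.1 b).1
    · exact Or.inl hl
    right
    rcases hb with hb | ⟨h, h1, h2⟩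
    · exact absurd hb.symm hl
    have a1 : h ≠ Γ.1 b := by
      rintro rfl
      rw [ends_partner] at h2
      exact hl (congrArg Prod.snd h2)
    have a2 : h ≠ e := by rintro rfl; exact hbe h2.symm
    have a3 : h ≠ Γ.1 e := by
      rintro rfl
      rw [ends_partner] at h2
      apply hbe'
      rw [ends_partner, ← h2, Prod.swap_swap]
    refine ⟨⟨h, h1, a1, a2, a3, h2⟩, Γ.1 h, ?_, ?_, ?_, ?_, ?_⟩
    · exact fun h3 => a1 (Γ.partner_eq_comm.1 h3).symm
    · exact fun h3 => h1 (Γ.partner_inj.1 h3)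
    · exact fun h3 => a3 (Γ.partner_eq_comm.1 h3).symm
    · exact fun h3 => a2 (Γ.partner_inj.1 h3)
    · rw [ends_partner, h2]; rfl
  have b1 : (Γ.switch b e).adjSet ∪ {(e.1, (Γ.1 e).1), ((Γ.1 e).1, e.1)} =
      Γ.adjSet ∪ {(b.1, (Γ.1 e).1), ((Γ.1 e).1, b.1), (e.1, (Γ.1 b).1), ((Γ.1 b).1, e.1)} := by
    ext p
    simp only [Finset.mem_union, mem_adjSet, exists_ends_switch_iff Γ g2,
      exists_ends_iff Γ b e, Finset.mem_insert, Finset.mem_singleton]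
    constructor
    · rintro (⟨h1, h2 | h2⟩ | h2)
      · exact Or.inr h2
      · exact Or.inl ⟨h1, Or.inr h2⟩
      · left
        refine ⟨?_, ?_⟩
        · rcases h2 with rfl | rfl
          exacts [fun h => g3 h.symm, g3]
        · tauto
    · rintro (⟨h1, (h2 | h2 | h2 | h2) | h2⟩ | h2)
      · subst h2
        rcases hB with hB | hB
        · exact absurd hB h1
        · exact Or.inl ⟨h1, Or.inr hB.1⟩
      · subst h2
        rcases hB with hB | hB
        · exact absurd hB.symm h1
        · exact Or.inl ⟨h1, Or.inr hB.2⟩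
      · exact Or.inr (Or.inl h2)
      · exact Or.inr (Or.inr h2)
      · exact Or.inl ⟨h1, Or.inr h2⟩
      · left
        refine ⟨?_, Or.inl h2⟩
        rcases h2 with rfl | rfl | rfl | rfl
        exacts [g5.symm, g5, g7, g7.symm]
  have b2 : Disjoint (Γ.switch b e).adjSet {(e.1, (Γ.1 e).1), ((Γ.1 e).1, e.1)} := by
    rw [Finset.disjoint_left]
    intro p hp hp'
    rw [mem_adjSet, exists_ends_switch_iff Γ g2] at hp
    simp only [Finset.mem_insert, Finset.mem_singleton] at hp'
    obtain ⟨h1, h2 | h2⟩ := hp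
    · simp only [Prod.ext_iff] at h2 hp'
      have q1 : b.1 ≠ e.1 := fun h => g4 e (by rw [ends, h])
      have q2 : (Γ.1 b).1 ≠ (Γ.1 e).1 := fun h => g6 e (by rw [ends, h])
      grind
    · have := hS p h2
      tauto
  have b3 : Disjoint Γ.adjSet
      {(b.1, (Γ.1 e).1), ((Γ.1 e).1, b.1), (e.1, (Γ.1 b).1), ((Γ.1 b).1, e.1)} := by
    rw [Finset.disjoint_left]
    intro p hp hp'
    rw [mem_adjSet] at hp
    simp only [Finset.mem_insert, Finset.mem_singleton] at hp'
    obtain ⟨h1, h, rfl⟩ := hp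
    rcases hp' with h2 | h2 | h2 | h2
    · exact g4 h h2
    · exact g4 (Γ.1 h) (by rw [ends_partner, h2]; rfl)
    · exact g6 h h2
    · exact g6 (Γ.1 h) (by rw [ends_partner, h2]; rfl)
  have b4 := congrArg Finset.card b1
  rw [Finset.card_union_of_disjoint b2, Finset.card_union_of_disjoint b3] at b4
  have b5 : ({(e.1, (Γ.1 e).1), ((Γ.1 e).1, e.1)} : Finset (Fin n × Fin n)).card = 2 := by
    rw [Finset.card_pair]
    exact fun h => g3 (congrArg Prod.snd h)
  have b6 : ({(b.1, (Γ.1 e).1), ((Γ.1 e).1, b.1), (e.1, (Γ.1 b).1), ((Γ.1 b).1, e.1)} :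
      Finset (Fin n × Fin n)).card = 4 := by
    have r1 : ¬ (b.1 = e.1 ∧ (Γ.1 e).1 = (Γ.1 b).1) := fun h => hbe (Prod.ext h.1 h.2.symm)
    have r2 : ¬ (b.1 = (Γ.1 b).1 ∧ (Γ.1 e).1 = e.1) := fun h => g3 h.2
    have g5' := g5.symm
    have g7' := g7.symm
    rw [Finset.card_insert_of_notMem, Finset.card_insert_of_notMem, Finset.card_pair]
    · simp only [ne_eq, Prod.mk.injEq]; tauto
    · simp only [Finset.mem_insert, Finset.mem_singleton, Prod.mk.injEq]
      grind
    · simp only [Finset.mem_insert, Finset.mem_singleton, Prod.mk.injEq]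
      grind
  rw [b5, b6] at b4
  have h2 := Γ.deficit_add_card
  have h3 := (Γ.switch b e).deficit_add_card
  have h4 := Γ.two_mul_excess
  have h5 := (Γ.switch b e).two_mul_excess
  omega

/-- A bad edge that is not parallel to `b` stays bad under a generic switching of `b`. -/
theorem Generic.isBad_switch {Γ : Configuration d} {b b' e : HalfEdge d} (hg : Γ.Generic b e)
    (hb' : Γ.IsBad b') (h1 : b' ≠ b) (h2 : b' ≠ Γ.1 b)
    (h3 : Γ.IsLoop b' ∨ (Γ.ends b' ≠ Γ.ends b ∧ Γ.ends b' ≠ Γ.ends (Γ.1 b))) :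
    (Γ.switch b e).IsBad b' := by
  have hne : ∀ h, Γ.IsBad h → h ≠ e ∧ h ≠ Γ.1 e := by
    refine fun h hh => ⟨?_, ?_⟩
    · rintro rfl; exact hg.good hh
    · rintro rfl; exact hg.good ((Γ.isBad_partner e).1 hh)
  have e1 : (Γ.switch b e).1 b' = Γ.1 b' :=
    switch_apply_of_ne Γ h1 h2 (hne b' hb').1 (hne b' hb').2
  rw [isBad_iff]
  by_cases hl : Γ.IsLoop b'
  · left
    rw [IsLoop, e1]; exact hl
  right
  obtain ⟨h3, h4⟩ := h3.resolve_left hl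
  obtain ⟨b'', h5, h6⟩ := ((Γ.isBad_iff b').1 hb').resolve_left hl
  -- The witness that `b'` is parallel is bad as well, hence not on the good edge of `e`, and so it
  -- survives the switching.
  have hb'' : Γ.IsBad b'' := (Γ.isBad_iff b'').2 (Or.inr ⟨b', h5.symm, h6.symm⟩)
  refine ⟨b'', h5, ?_⟩
  have e2 : (Γ.switch b e).1 b'' = Γ.1 b'' := by
    refine switch_apply_of_ne Γ ?_ ?_ (hne b'' hb'').1 (hne b'' hb'').2
    · rintro rfl; exact h3 h6.symm
    · rintro rfl; exact h4 h6.symm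
  simp only [ends, e1, e2]
  exact h6

end Configuration

end Deficit

/-! ### Near independence of the choice of the bad edge -/

section Value

open scoped Classical

theorem abs_sum_sub_sum_le {α : Type*} [Fintype α] (f g : α → ℝ) (P : α → Prop) {c M G : ℝ}
    (hc : 0 ≤ c) (hM : 0 ≤ M) (h1 : ∀ a, P a → |f a - g a| ≤ c) (h2 : ∀ a, |f a - g a| ≤ M)
    (hG : ((Finset.univ.filter fun a => ¬ P a).card : ℝ) ≤ G) :
    |∑ a, f a - ∑ a, g a| ≤ c * Fintype.card α + M * G := by
  rw [← Finset.sum_sub_distrib]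
  calc |∑ a, (f a - g a)| ≤ ∑ a, |f a - g a| := Finset.abs_sum_le_sum_abs _ _
    _ ≤ ∑ a, (c + if ¬ P a then M else 0) := by
        refine Finset.sum_le_sum fun a _ => ?_
        by_cases hP : P a
        · simpa [hP] using h1 a hP
        · simp only [hP, not_false_eq_true, if_true]
          linarith [h2 a]
    _ = c * Fintype.card α + (Finset.univ.filter fun a => ¬ P a).card * M := by
        rw [Finset.sum_add_distrib, ← Finset.sum_filter, Finset.sum_const, Finset.sum_const,
          Finset.card_univ, nsmul_eq_mul, nsmul_eq_mul, mul_comm]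
    _ ≤ _ := by nlinarith

theorem card_filter_not_notMem {α : Type*} [Fintype α] (s : Finset α)
    [DecidablePred fun a => ¬ a ∉ s] : (Finset.univ.filter fun a => ¬ a ∉ s).card = s.card := by
  congr 1; ext; simp

theorem abs_mean_sub_le {α : Type*} {s : Finset α} (hs : s.Nonempty) (f : α → ℝ) {x c : ℝ}
    (h : ∀ a ∈ s, |f a - x| ≤ c) : |(∑ a ∈ s, f a) / s.card - x| ≤ c := by
  have hs' : (0 : ℝ) < s.card := by exact_mod_cast hs.card_pos
  have h1 : (∑ a ∈ s, f a) / s.card - x = (∑ a ∈ s, (f a - x)) / s.card := by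
    rw [Finset.sum_sub_distrib, Finset.sum_const, nsmul_eq_mul]
    field_simp
  rw [h1, abs_div, abs_of_pos hs', div_le_iff₀ hs', mul_comm, ← nsmul_eq_mul]
  exact (Finset.abs_sum_le_sum_abs _ _).trans (Finset.sum_le_card_nsmul _ _ _ h)

namespace Configuration

variable {n : ℕ} {d : Fin n → ℕ}

/-- The average of `f` over the switchings of `b` with a uniformly random half-edge. -/
noncomputable def avgSwitch (f : Configuration d → ℝ) (Γ : Configuration d) (b : HalfEdge d) : ℝ :=
  (∑ e, f (Γ.switch b e)) / Fintype.card (HalfEdge d)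

/-- The expectation of `ψ` of the graph reached after `m` switchings, when the bad edges are chosen
uniformly at random. -/
noncomputable def value (ψ : SimpleGraph (Fin n) → ℝ) : ℕ → Configuration d → ℝ
  | 0, Γ => ψ Γ.toGraph
  | m + 1, Γ => if Γ.IsSimple then ψ Γ.toGraph else
      (∑ b ∈ Γ.badSet, avgSwitch (value ψ m) Γ b) / Γ.badSet.card

theorem value_of_isSimple (ψ : SimpleGraph (Fin n) → ℝ) (m : ℕ) {Γ : Configuration d}
    (h : Γ.IsSimple) : value ψ m Γ = ψ Γ.toGraph := by
  cases m with
  | zero => rfl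
  | succ m => simp [value, h]

theorem value_succ (ψ : SimpleGraph (Fin n) → ℝ) (m : ℕ) {Γ : Configuration d}
    (h : ¬ Γ.IsSimple) : value ψ (m + 1) Γ =
      (∑ b ∈ Γ.badSet, avgSwitch (value ψ m) Γ b) / Γ.badSet.card := by
  simp [value, h]

theorem mean_mem_Icc {α : Type*} (s : Finset α) (f : α → ℝ) {x y : ℝ} (hx : x ≤ 0) (hy : 0 ≤ y)
    (h : ∀ a ∈ s, f a ∈ Set.Icc x y) : (∑ a ∈ s, f a) / s.card ∈ Set.Icc x y := by
  rcases s.eq_empty_or_nonempty with rfl | hs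
  · simp [hx, hy]
  have hs' : (0 : ℝ) < s.card := by exact_mod_cast hs.card_pos
  constructor
  · rw [le_div_iff₀ hs', mul_comm, ← nsmul_eq_mul]
    exact Finset.card_nsmul_le_sum _ _ _ fun a ha => (h a ha).1
  · rw [div_le_iff₀ hs', mul_comm, ← nsmul_eq_mul]
    exact Finset.sum_le_card_nsmul _ _ _ fun a ha => (h a ha).2

theorem avgSwitch_mem_Icc {f : Configuration d → ℝ} {x y : ℝ} (hx : x ≤ 0) (hy : 0 ≤ y)
    (h : ∀ Γ, f Γ ∈ Set.Icc x y) (Γ : Configuration d) (b : HalfEdge d) :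
    avgSwitch f Γ b ∈ Set.Icc x y := by
  rw [avgSwitch, ← Finset.card_univ]
  exact mean_mem_Icc _ _ hx hy fun _ _ => h _

theorem value_mem_Icc {ψ : SimpleGraph (Fin n) → ℝ} {x y : ℝ} (hx : x ≤ 0) (hy : 0 ≤ y)
    (hψ : ∀ G, ψ G ∈ Set.Icc x y) (m : ℕ) (Γ : Configuration d) :
    value ψ m Γ ∈ Set.Icc x y := by
  induction m generalizing Γ with
  | zero => exact hψ _
  | succ m ih =>
    by_cases hs : Γ.IsSimple
    · rw [value_of_isSimple _ _ hs]; exact hψ _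
    · rw [value_succ _ _ hs]
      exact mean_mem_Icc _ _ hx hy fun b _ => avgSwitch_mem_Icc hx hy ih Γ b

theorem abs_value_le {ψ : SimpleGraph (Fin n) → ℝ} (hψ : ∀ G, |ψ G| ≤ 1) (m : ℕ)
    (Γ : Configuration d) : |value ψ m Γ| ≤ 1 := by
  rw [abs_le]
  exact value_mem_Icc (by norm_num) (by norm_num) (fun G => abs_le.1 (hψ G)) m Γ

/-- Needed to centre indicators. The averages have total weight one because a configuration that is
not simple has a bad half-edge, so no division by zero occurs. -/
theorem value_sub_const (ψ : SimpleGraph (Fin n) → ℝ) (a : ℝ) (m : ℕ) (Γ : Configuration d) :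
    value (fun G => ψ G - a) m Γ = value ψ m Γ - a := by
  induction m generalizing Γ with
  | zero => rfl
  | succ m ih =>
    by_cases hs : Γ.IsSimple
    · rw [value_of_isSimple _ _ hs, value_of_isSimple _ _ hs]
    · have h1 : Γ.badSet.Nonempty := Γ.badSet_nonempty fun h => hs (Γ.isSimple_iff.2 h)
      have h2 : (Γ.badSet.card : ℝ) ≠ 0 := by exact_mod_cast h1.card_pos.ne'
      have h3 : (Fintype.card (HalfEdge d) : ℝ) ≠ 0 := by
        obtain ⟨b, _⟩ := h1
        exact_mod_cast (Fintype.card_pos_iff.2 ⟨b⟩).ne'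
      rw [value_succ _ _ hs, value_succ _ _ hs]
      have h4 : ∀ b, avgSwitch (value (fun G => ψ G - a) m) Γ b =
          avgSwitch (value ψ m) Γ b - a := by
        intro b
        simp only [avgSwitch, ih, Finset.sum_sub_distrib, Finset.sum_const, Finset.card_univ,
          nsmul_eq_mul]
        field_simp
      simp only [h4, Finset.sum_sub_distrib, Finset.sum_const, nsmul_eq_mul]
      field_simp

theorem avgSwitch_relabel {f : Configuration d → ℝ} {π : Equiv.Perm (HalfEdge d)}
    (hf : ∀ Γ, f (Γ.relabel π) = f Γ) (Γ : Configuration d) (b : HalfEdge d) :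
    avgSwitch f (Γ.relabel π) (π b) = avgSwitch f Γ b := by
  rw [avgSwitch, avgSwitch, ← Equiv.sum_comp π]
  simp only [relabel_switch, hf]

/-- Bad edges are picked uniformly in `value`, so no labelling is preferred. An arbitrary rule would
break this symmetry. -/
theorem value_relabel (ψ : SimpleGraph (Fin n) → ℝ) (m : ℕ) {π : Equiv.Perm (HalfEdge d)}
    (hπ : ∀ h, (π h).1 = h.1) (Γ : Configuration d) :
    value ψ m (Γ.relabel π) = value ψ m Γ := by
  induction m generalizing Γ with
  | zero => simp [value, toGraph_relabel hπ]
  | succ m ih =>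
    have hb : (Γ.relabel π).badSet = Γ.badSet.map π.toEmbedding := by
      ext h
      obtain ⟨h, rfl⟩ := π.surjective h
      simp [mem_badSet, isBad_relabel hπ]
    simp only [value, isSimple_relabel hπ, toGraph_relabel hπ]
    rw [hb, Finset.sum_map, Finset.card_map]
    simp only [Equiv.coe_toEmbedding, avgSwitch_relabel ih]

theorem avgSwitch_partner (f : Configuration d → ℝ) (Γ : Configuration d) (b : HalfEdge d) :
    avgSwitch f Γ (Γ.1 b) = avgSwitch f Γ b := by
  simp only [avgSwitch, switch_partner]
  rw [Equiv.sum_comp Γ.1 fun e => f (Γ.switch b e)]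

/-- This covers the case where the commutation argument fails: switching one of two parallel edges
may make the other good. A symmetry of Γ exchanges them, so equality is exact. -/
theorem avgSwitch_value_of_ends_eq (ψ : SimpleGraph (Fin n) → ℝ) (m : ℕ) (Γ : Configuration d)
    {b b' : HalfEdge d} (hb : ¬ Γ.IsLoop b) (h : Γ.ends b' = Γ.ends b) :
    avgSwitch (value ψ m) Γ b' = avgSwitch (value ψ m) Γ b := by
  obtain ⟨π, h1, h2, h3⟩ := Γ.exists_relabel_of_ends_eq hb h
  rw [← avgSwitch_relabel (fun Γ => value_relabel ψ m h1 Γ) Γ b, h2, h3]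

/-- By `switch_comm` the terms agree unless `e` meets the edge of `b'` (two choices) or `e'` meets
the edge of `b` or of `e` (four choices for each `e`). Each exceptional term costs at most 2; the
constant 20 is generous. -/
theorem abs_sum_switch_switch_sub_le {f : Configuration d → ℝ} (hf : ∀ Γ, |f Γ| ≤ 1)
    (Γ : Configuration d) {b b' : HalfEdge d} (h1 : b' ≠ b) (h2 : b' ≠ Γ.1 b) :
    |∑ e, ∑ e', f ((Γ.switch b e).switch b' e') - ∑ e, ∑ e', f ((Γ.switch b' e').switch b e)| ≤
      20 * Fintype.card (HalfEdge d) := by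
  have h2' : ∀ x y : Configuration d, |f x - f y| ≤ 2 := fun x y => by
    have := abs_sub (f x) (f y)
    linarith [hf x, hf y]
  have key := abs_sum_sub_sum_le (fun e => ∑ e', f ((Γ.switch b e).switch b' e'))
    (fun e => ∑ e', f ((Γ.switch b' e').switch b e))
    (fun e => e ∉ ({b', Γ.1 b'} : Finset _)) (c := 12)
    (M := 2 * Fintype.card (HalfEdge d)) (G := 2) (by norm_num) (by positivity) ?_ ?_ ?_
  · calc _ ≤ _ := key
      _ ≤ _ := by
        have : (0 : ℝ) ≤ Fintype.card (HalfEdge d) := by positivity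
        linarith
  · intro e he
    simp only [Finset.mem_insert, Finset.mem_singleton, not_or] at he
    refine (abs_sum_sub_sum_le _ _ (fun e' => e' ∉ ({b, Γ.1 b, e, Γ.1 e} : Finset _))
      (c := 0) (M := 2) (G := 4) le_rfl (by norm_num) ?_ (fun _ => h2' _ _) ?_).trans
      (by norm_num)
    · intro e' he'
      simp only [Finset.mem_insert, Finset.mem_singleton, not_or] at he'
      rw [switch_comm Γ h1 h2 he.1 he.2 he'.1 he'.2.1 he'.2.2.1 he'.2.2.2]
      simp
    · rw [card_filter_not_notMem]
      exact_mod_cast Finset.card_le_four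
  · intro e
    refine (abs_sum_sub_sum_le _ _ (fun _ => True) (c := 2) (M := 2) (G := 0) (by norm_num)
      (by norm_num) (fun _ _ => h2' _ _) (fun _ => h2' _ _) (by simp)).trans (by norm_num)
  · rw [card_filter_not_notMem]
    exact_mod_cast Finset.card_le_two

/-- Up to a small error, the expected value after one switching does not depend on the bad edge
that is switched. -/
theorem abs_avgSwitch_value_sub_le {ψ : SimpleGraph (Fin n) → ℝ} (hψ : ∀ G, |ψ G| ≤ 1) {K : ℕ}
    {G : ℝ} (hG10 : 10 ≤ G) (hG : ∀ (Γ : Configuration d) b, Γ.excess ≤ K →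
      ((Finset.univ.filter fun e => ¬ Γ.Generic b e).card : ℝ) ≤ G) (k : ℕ) (hk : k < K)
    (Γ : Configuration d) (hΓ : Γ.excess = k + 1) {b b' : HalfEdge d} (hb : Γ.IsBad b)
    (hb' : Γ.IsBad b') :
    |avgSwitch (value ψ k) Γ b - avgSwitch (value ψ k) Γ b'| ≤
      6 * G * (2 ^ (k + 1) - 1) / Fintype.card (HalfEdge d) := by
  induction k using Nat.strong_induction_on generalizing Γ b b' with | _ k ih =>
  have hN : (0 : ℝ) < Fintype.card (HalfEdge d) := by
    exact_mod_cast Fintype.card_pos_iff.2 ⟨b⟩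
  have hG0 : 0 ≤ 6 * G * (2 ^ (k + 1) - 1) := by
    have : (1 : ℝ) ≤ 2 ^ (k + 1) := one_le_pow₀ (by norm_num)
    have h2 : 0 ≤ (2 : ℝ) ^ (k + 1) - 1 := by linarith
    positivity
  -- These are the cases of exact equality. Two loops at one vertex are left to the commutation
  -- argument, since a loop remains bad when the other one is switched.
  by_cases hcase : b' = b ∨ b' = Γ.1 b ∨ (¬ Γ.IsLoop b ∧
      (Γ.ends b' = Γ.ends b ∨ Γ.ends b' = Γ.ends (Γ.1 b)))
  · have : avgSwitch (value ψ k) Γ b' = avgSwitch (value ψ k) Γ b := by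
      rcases hcase with rfl | rfl | ⟨h1, h2 | h2⟩
      · rfl
      · exact avgSwitch_partner _ _ _
      · exact avgSwitch_value_of_ends_eq ψ k Γ h1 h2
      · rw [avgSwitch_value_of_ends_eq ψ k Γ (by rwa [isLoop_partner]) h2, avgSwitch_partner]
    rw [this, sub_self, abs_zero]
    positivity
  simp only [not_or, not_and] at hcase
  obtain ⟨h1, h2, h3⟩ := hcase
  have h2' : b ≠ Γ.1 b' := fun h => h2 (Γ.partner_eq_comm.1 h.symm).symm
  have hbad : ∀ e, Γ.Generic b e → (Γ.switch b e).IsBad b' := by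
    intro e he
    refine he.isBad_switch hb' h1 h2 ?_
    by_cases hl : Γ.IsLoop b'
    · exact Or.inl hl
    right
    by_contra hc
    have hlb : ¬ Γ.IsLoop b := by
      intro hlb
      apply hl
      rw [isLoop_iff]
      have h4 := (Γ.isLoop_iff b).1 hlb
      have h5 := (Γ.isLoop_iff _).1 ((Γ.isLoop_partner b).2 hlb)
      by_cases h6 : Γ.ends b' = Γ.ends b
      · rw [h6, h4]
      · have h7 : Γ.ends b' = Γ.ends (Γ.1 b) := by tauto
        rw [h7, h5]
    exact hc (h3 hlb)
  have hbad' : ∀ e, Γ.Generic b' e → (Γ.switch b' e).IsBad b := by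
    intro e he
    refine he.isBad_switch hb (Ne.symm h1) h2' ?_
    by_cases hl : Γ.IsLoop b
    · exact Or.inl hl
    right
    refine ⟨Ne.symm (h3 hl).1, fun h4 => (h3 hl).2 ?_⟩
    rw [ends_partner, h4, ends_partner, Prod.swap_swap]
  have hdist : ∀ x y : Configuration d, ∀ m, |value ψ m x - value ψ m y| ≤ 2 := fun x y m => by
    have := abs_sub (value ψ m x) (value ψ m y)
    linarith [abs_value_le hψ m x, abs_value_le hψ m y]
  have hGb : ∀ b, ((Finset.univ.filter fun e => ¬ Γ.Generic b e).card : ℝ) ≤ G :=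
    fun b => hG Γ b (by omega)
  -- At excess one no `e` is generic for `b`: a generic switching would make the configuration
  -- simple while `b'` stays bad. Every term is then counted in the exceptional bound 2G.
  rcases k with _ | k
  · rw [avgSwitch, avgSwitch, ← sub_div, abs_div, abs_of_pos hN]
    refine div_le_div_of_nonneg_right ?_ hN.le
    have hng : ∀ e, ¬ Γ.Generic b e := by
      intro e he
      have h4 := he.excess_switch hb
      exact (Γ.switch b e).isSimple_iff.2 (by omega) b' (hbad e he)
    refine (abs_sum_sub_sum_le _ _ (Γ.Generic b) (c := 0) (M := 2) le_rfl (by norm_num)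
      (fun e he => absurd he (hng e)) (fun _ => hdist _ _ _) (hGb b)).trans ?_
    norm_num
    linarith
  -- After a generic switching of `b`, the induction hypothesis allows `b'` to be the next edge
  -- switched in place of a uniformly random bad one.
  have hstep : ∀ b b', Γ.IsBad b → (∀ e, Γ.Generic b e → (Γ.switch b e).IsBad b') →
      |∑ e, value ψ (k + 1) (Γ.switch b e) -
        (∑ e, ∑ e', value ψ k ((Γ.switch b e).switch b' e')) / Fintype.card (HalfEdge d)| ≤
      6 * G * (2 ^ (k + 1) - 1) + 2 * G := by
    intro b b' hb hbad
    have hrw : (∑ e, ∑ e', value ψ k ((Γ.switch b e).switch b' e')) /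
        Fintype.card (HalfEdge d) = ∑ e, avgSwitch (value ψ k) (Γ.switch b e) b' := by
      rw [Finset.sum_div]; rfl
    have hpow : (1 : ℝ) ≤ 2 ^ (k + 1) := one_le_pow₀ (by norm_num)
    have h2pow : 0 ≤ (2 : ℝ) ^ (k + 1) - 1 := by linarith
    rw [hrw]
    refine (abs_sum_sub_sum_le _ _ (Γ.Generic b)
      (c := 6 * G * (2 ^ (k + 1) - 1) / Fintype.card (HalfEdge d)) (M := 2)
      (by positivity) (by norm_num) ?_ ?_ (hGb b)).trans ?_
    · intro e he
      have h4 := he.excess_switch hb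
      have h5 : ¬ (Γ.switch b e).IsSimple := fun h => h b' (hbad e he)
      rw [value_succ _ _ h5]
      refine abs_mean_sub_le ⟨b', (mem_badSet _ _).2 (hbad e he)⟩ _ fun b'' hb'' => ?_
      exact ih k (by omega) (by omega) _ (by omega) ((mem_badSet _ _).1 hb'') (hbad e he)
    · intro e
      have h4 := abs_sub (value ψ (k + 1) (Γ.switch b e))
        (avgSwitch (value ψ k) (Γ.switch b e) b')
      have h5 := abs_value_le hψ (k + 1) (Γ.switch b e)
      have h6 : |avgSwitch (value ψ k) (Γ.switch b e) b'| ≤ 1 :=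
        abs_le.2 (avgSwitch_mem_Icc (by norm_num) (by norm_num)
          (fun Δ => abs_le.1 (abs_value_le hψ k Δ)) _ _)
      linarith
    · rw [div_mul_cancel₀ _ hN.ne']
  have s1 := hstep b b' hb hbad
  have s2 := hstep b' b hb' hbad'
  have s3 := abs_sum_switch_switch_sub_le (f := value ψ k) (abs_value_le hψ k) Γ h1 h2
  rw [Finset.sum_comm (f := fun e e' => value ψ k ((Γ.switch b' e').switch b e))] at s3
  rw [avgSwitch, avgSwitch, ← sub_div, abs_div, abs_of_pos hN]
  refine div_le_div_of_nonneg_right ?_ hN.le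
  set A := ∑ e, value ψ (k + 1) (Γ.switch b e)
  set B := ∑ e, value ψ (k + 1) (Γ.switch b' e)
  set A' := ∑ e, ∑ e', value ψ k ((Γ.switch b e).switch b' e')
  set B' := ∑ e, ∑ e', value ψ k ((Γ.switch b' e).switch b e')
  have s4 : |A' / Fintype.card (HalfEdge d) - B' / Fintype.card (HalfEdge d)| ≤ 20 := by
    rw [← sub_div, abs_div, abs_of_pos hN, div_le_iff₀ hN]
    exact s3
  rw [abs_le] at s1 s2 s4 ⊢
  -- With c_k = 6G(2^(k+1) − 1), the total error is 2(c_k + 2G) + 20, and G ≥ 10 makes it at most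
  -- 2c_k + 6G = c_{k+1}.
  have hp : (2 : ℝ) ^ (k + 1 + 1) = 2 * 2 ^ (k + 1) := pow_succ' _ _
  rw [hp]
  constructor <;> nlinarith

/-- The value of a configuration is nearly the average value after switching any bad edge. -/
theorem abs_value_sub_avgSwitch_le {ψ : SimpleGraph (Fin n) → ℝ} (hψ : ∀ G, |ψ G| ≤ 1) {K : ℕ}
    {G : ℝ} (hG10 : 10 ≤ G) (hG : ∀ (Γ : Configuration d) b, Γ.excess ≤ K →
      ((Finset.univ.filter fun e => ¬ Γ.Generic b e).card : ℝ) ≤ G) (k : ℕ) (hk : k < K)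
    (Γ : Configuration d) (hΓ : Γ.excess = k + 1) {b : HalfEdge d} (hb : Γ.IsBad b) :
    |value ψ (k + 1) Γ - avgSwitch (value ψ k) Γ b| ≤
      6 * G * (2 ^ (k + 1) - 1) / Fintype.card (HalfEdge d) := by
  rw [value_succ _ _ fun h => h b hb]
  exact abs_mean_sub_le ⟨b, (mem_badSet _ _).2 hb⟩ _ fun b' hb' =>
    abs_avgSwitch_value_sub_le hψ hG10 hG k hk Γ hΓ ((mem_badSet _ _).1 hb') hb

end Configuration

end Value

/-! ### Double counting between configurations of consecutive excess -/

section Strata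

open scoped Classical

namespace Configuration

variable {n : ℕ} {d : Fin n → ℕ}

/-- The number of other half-edges at the vertex of `h`. -/
def freeDegree (h : HalfEdge d) : ℝ := d h.1 - 1

theorem freeDegree_nonneg (h : HalfEdge d) : 0 ≤ freeDegree h := by
  have : 1 ≤ d h.1 := (Nat.zero_le _).trans_lt h.2.2
  have : (1 : ℝ) ≤ d h.1 := by exact_mod_cast this
  simp only [freeDegree]; linarith

theorem freeDegree_le {D : ℕ} (hD : ∀ i, d i ≤ D) (h : HalfEdge d) : freeDegree h ≤ D := by
  have : (d h.1 : ℝ) ≤ D := by exact_mod_cast hD _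
  simp only [freeDegree]; linarith

theorem sum_ite_same_vertex (h : HalfEdge d) :
    (∑ g : HalfEdge d, if g.1 = h.1 ∧ g ≠ h then (1 : ℝ) else 0) = freeDegree h := by
  have h1 : ∀ g : HalfEdge d, (if g.1 = h.1 ∧ g ≠ h then (1 : ℝ) else 0) =
      (if g.1 = h.1 then 1 else 0) - if g = h then 1 else 0 := by
    intro g
    by_cases c : g = h
    · simp [c]
    · simp [c]
  simp only [h1, Finset.sum_sub_distrib, Finset.sum_ite_eq', Finset.mem_univ, if_true]
  rw [← Finset.sum_filter, Finset.sum_const, card_vertex]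
  simp [freeDegree]

/-- The number of ordered pairs of distinct half-edges at a common vertex. -/
noncomputable def pairCount (d : Fin n → ℕ) : ℝ := ∑ h : HalfEdge d, freeDegree h

/-- The number of ways of doubling an edge. -/
noncomputable def doublingCount (Γ : Configuration d) : ℝ :=
  ∑ h, freeDegree h * freeDegree (Γ.1 h)

/-- The weight of the oriented edge `b` in a count of the loops and the parallel pairs. -/
noncomputable def weight (Γ : Configuration d) (b : HalfEdge d) : ℝ :=
  (if Γ.IsLoop b then 2 else 0) + ∑ b', if (b, b') ∈ Γ.parSet then 1 else 0

/-- The weight of `b`, counting only what is disjoint from the edge of `e`. -/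
noncomputable def weightAvoiding (Γ : Configuration d) (b e : HalfEdge d) : ℝ :=
  (if Γ.IsLoop b ∧ e ≠ Γ.1 b then 2 else 0) +
    ∑ b', if (b, b') ∈ Γ.parSet ∧ e ≠ Γ.1 b ∧ e ≠ b' ∧ e ≠ Γ.1 b' then 1 else 0

theorem sum_weight (Γ : Configuration d) :
    ∑ b, Γ.weight b = 2 * Γ.loopSet.card + Γ.parSet.card := by
  simp only [weight, Finset.sum_add_distrib]
  rw [← Fintype.sum_prod_type' (f := fun b b' => if (b, b') ∈ Γ.parSet then (1 : ℝ) else 0)]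
  simp only [Prod.mk.eta, Finset.sum_ite_mem, Finset.univ_inter, Finset.sum_const, nsmul_eq_mul,
    mul_one]
  rw [← Finset.sum_filter, Finset.sum_const, nsmul_eq_mul, loopSet]
  ring

theorem weight_nonneg (Γ : Configuration d) (b : HalfEdge d) : 0 ≤ Γ.weight b := by
  unfold weight
  refine add_nonneg (by split_ifs <;> norm_num) (Finset.sum_nonneg fun _ _ => ?_)
  split_ifs <;> norm_num

theorem weightAvoiding_nonneg (Γ : Configuration d) (b e : HalfEdge d) :
    0 ≤ Γ.weightAvoiding b e := by
  unfold weightAvoiding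
  refine add_nonneg (by split_ifs <;> norm_num) (Finset.sum_nonneg fun _ _ => ?_)
  split_ifs <;> norm_num

theorem weightAvoiding_le (Γ : Configuration d) (b e : HalfEdge d) :
    Γ.weightAvoiding b e ≤ Γ.weight b := by
  unfold weightAvoiding weight
  refine add_le_add ?_ (Finset.sum_le_sum fun b' _ => ?_)
  · by_cases h : Γ.IsLoop b
    · simp only [h, true_and, if_true]; split_ifs <;> norm_num
    · simp [h]
  · by_cases h : (b, b') ∈ Γ.parSet
    · simp only [h, true_and, if_true]; split_ifs <;> norm_num
    · simp [h]

/-- Every edge contributing to the weight is bad and so disjoint from the good edge of `e`. The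
avoiding variant can thus replace the weight at small cost, and unlike the weight it can be summed
exactly after a switching. -/
theorem Generic.weightAvoiding_eq {Γ : Configuration d} {b e : HalfEdge d}
    (hg : Γ.Generic b e) : Γ.weightAvoiding b e = Γ.weight b := by
  unfold weightAvoiding weight
  congr 1
  · simp [hg.ne_partner]
  · refine Finset.sum_congr rfl fun b' _ => ?_
    by_cases h : (b, b') ∈ Γ.parSet
    · have h1 := (Γ.mem_parSet _).1 h
      have h2 : Γ.IsBad b' := (Γ.isBad_iff b').2 (Or.inr ⟨b, h1.2.1, h1.2.2.symm⟩)
      have h3 : e ≠ b' := by rintro rfl; exact hg.good h2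
      have h4 : e ≠ Γ.1 b' := by rintro rfl; exact hg.good ((Γ.isBad_partner _).2 h2)
      simp [h, hg.ne_partner, h3, h4]
    · simp [h]

theorem isBad_of_weight_ne_zero (Γ : Configuration d) {b : HalfEdge d} (h : Γ.weight b ≠ 0) :
    Γ.IsBad b := by
  rw [isBad_iff]
  by_contra hc
  push Not at hc
  apply h
  unfold weight
  rw [if_neg hc.1, zero_add]
  refine Finset.sum_eq_zero fun b' _ => if_neg fun hm => ?_
  have h1 := (Γ.mem_parSet _).1 hm
  exact hc.2 b' h1.2.1.symm h1.2.2

theorem sum_weight_le (Γ : Configuration d) {K : ℕ} (h : Γ.excess ≤ K) :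
    ∑ b, Γ.weight b ≤ 4 * K + 16 * K ^ 2 := by
  rw [sum_weight]
  have h1 := Γ.card_loopSet_le
  have h2 := Γ.card_parSet_le
  have h3 := Γ.two_mul_excess
  have h4 : Γ.deficit ≤ 2 * K := by omega
  have h5 : Γ.parSet.card ≤ 4 * (2 * K) ^ 2 := h2.trans (by gcongr)
  have h6 : 2 * Γ.loopSet.card + Γ.parSet.card ≤ 4 * K + 16 * K ^ 2 := by nlinarith
  exact_mod_cast h6

/-- The new edge at `b` is `{b, Γ e}`, so creating a loop means choosing `Γ e` among the other
half-edges at the vertex of `b`. -/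
theorem switch_isLoop_iff (Γ : Configuration d) (b e : HalfEdge d) :
    ((Γ.switch b e).IsLoop b ∧ e ≠ (Γ.switch b e).1 b) ↔ (Γ.1 e).1 = b.1 ∧ Γ.1 e ≠ b := by
  by_cases he : e = Γ.1 b
  · subst he
    simp [switch_partner_self]
  · have h1 : Γ.1 e ≠ b := fun h => he (Γ.partner_eq_comm.1 h).symm
    have h2 : e ≠ Γ.1 e := (Γ.partner_ne e).symm
    simp [IsLoop, switch_apply_left Γ he, h1, h2]

/-- The new edge `{b, Γ e}` doubles an untouched non-loop edge `b'` exactly when its two half-edges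
are siblings of the two half-edges of `b'`. The disjointness conditions turn this into an
equivalence that holds even for degenerate `e`. -/
theorem switch_mem_parSet_iff (Γ : Configuration d) (b b' e : HalfEdge d) :
    ((b, b') ∈ (Γ.switch b e).parSet ∧ e ≠ (Γ.switch b e).1 b ∧ e ≠ b' ∧
      e ≠ (Γ.switch b e).1 b') ↔
      (b.1 = b'.1 ∧ b ≠ b') ∧ ((Γ.1 e).1 = (Γ.1 b').1 ∧ Γ.1 e ≠ Γ.1 b') ∧ ¬ Γ.IsLoop b' := by
  rw [mem_parSet]
  simp only [ne_eq, Γ.partner_inj]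
  constructor
  · rintro ⟨⟨h1, h2, h3⟩, h4, h5, h6⟩
    have he : e ≠ Γ.1 b := by
      rintro rfl
      rw [switch_partner_self] at h4
      exact h4 rfl
    have e1 : b'.1 = b.1 := congrArg Prod.fst h3
    have e2 := congrArg Prod.snd h3
    simp only [ends, switch_apply_left Γ he] at e2
    rw [IsLoop, switch_apply_left Γ he] at h1
    have e3 : (Γ.switch b e).1 b' = Γ.1 b' := by
      refine switch_apply_of_ne Γ (Ne.symm h2) ?_ (Ne.symm h5) ?_
      · rintro rfl
        rw [switch_apply_left_partner Γ he] at h6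
        exact h6 rfl
      · rintro rfl
        exact h1 e1
    rw [e3] at e2
    refine ⟨⟨e1.symm, h2⟩, ⟨e2.symm, h5⟩, fun hl => h1 ?_⟩
    rw [← e2, ← e1]; exact hl
  · rintro ⟨⟨h1, h2⟩, ⟨h3, h4⟩, h5⟩
    simp only [IsLoop] at h5
    have he : e ≠ Γ.1 b := by
      rintro rfl
      rw [partner_partner] at h3
      exact h5 (h3.symm.trans h1)
    have n1 : b' ≠ Γ.1 e := by
      rintro rfl
      exact h5 h3.symm
    have e3 : (Γ.switch b e).1 b' = Γ.1 b' := by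
      refine switch_apply_of_ne Γ (Ne.symm h2) ?_ (Ne.symm h4) n1
      rintro rfl
      rw [partner_partner] at h5
      exact h5 h1
    refine ⟨⟨?_, h2, ?_⟩, ?_, h4, ?_⟩
    · rw [IsLoop, switch_apply_left Γ he, h3, h1]; exact h5
    · rw [ends, ends, e3, switch_apply_left Γ he, h3, h1]
    · rw [switch_apply_left Γ he]; exact (Γ.partner_ne e).symm
    · rw [e3]
      exact fun h => n1 (Γ.partner_eq_comm.1 h.symm).symm

/-- Put g = `Γ.1 e`. Loops are counted by sibling pairs (b, g), each with weight 2. Double edges are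
counted, for each non-loop `b'`, by a sibling of `b'` and a sibling of its partner. Only the second
part depends on Γ. -/
theorem sum_weightAvoiding_switch (Γ : Configuration d) :
    ∑ b, ∑ e, (Γ.switch b e).weightAvoiding b e =
      2 * pairCount d + ∑ h, if Γ.IsLoop h then 0 else freeDegree h * freeDegree (Γ.1 h) := by
  simp only [weightAvoiding, switch_isLoop_iff, switch_mem_parSet_iff, Finset.sum_add_distrib]
  congr 1
  · rw [pairCount, Finset.mul_sum]
    refine Finset.sum_congr rfl fun b _ => ?_
    rw [Equiv.sum_comp Γ.1 fun g => if g.1 = b.1 ∧ g ≠ b then (2 : ℝ) else 0,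
      ← sum_ite_same_vertex, Finset.mul_sum]
    exact Finset.sum_congr rfl fun g _ => by split_ifs <;> norm_num
  · have h1 : ∀ b e b' : HalfEdge d, (if (b.1 = b'.1 ∧ b ≠ b') ∧
        ((Γ.1 e).1 = (Γ.1 b').1 ∧ Γ.1 e ≠ Γ.1 b') ∧ ¬ Γ.IsLoop b' then (1 : ℝ) else 0) =
        (if b.1 = b'.1 ∧ b ≠ b' then 1 else 0) *
        ((if (Γ.1 e).1 = (Γ.1 b').1 ∧ Γ.1 e ≠ Γ.1 b' then 1 else 0) *
        if Γ.IsLoop b' then 0 else 1) := by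
      intro b e b'
      by_cases c1 : b.1 = b'.1 ∧ b ≠ b'
      · by_cases c2 : (Γ.1 e).1 = (Γ.1 b').1 ∧ Γ.1 e ≠ Γ.1 b'
        · rw [if_pos c1, if_pos c2]
          by_cases c3 : Γ.IsLoop b'
          · rw [if_pos c3, if_neg fun h => h.2.2 c3]; norm_num
          · rw [if_neg c3, if_pos ⟨c1, c2, c3⟩]; norm_num
        · rw [if_neg c2, if_neg fun h => c2 h.2.1]; norm_num
      · rw [if_neg c1, if_neg fun h => c1 h.1]; norm_num
    simp only [h1]
    have h2 : ∀ b : HalfEdge d, (∑ e, ∑ b' : HalfEdge d,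
        (if b.1 = b'.1 ∧ b ≠ b' then (1 : ℝ) else 0) *
        ((if (Γ.1 e).1 = (Γ.1 b').1 ∧ Γ.1 e ≠ Γ.1 b' then 1 else 0) *
        if Γ.IsLoop b' then 0 else 1)) = ∑ b' : HalfEdge d,
        (if b.1 = b'.1 ∧ b ≠ b' then (1 : ℝ) else 0) *
          (freeDegree (Γ.1 b') * if Γ.IsLoop b' then 0 else 1) := by
      intro b
      rw [Finset.sum_comm]
      refine Finset.sum_congr rfl fun b' _ => ?_
      rw [← Finset.mul_sum, ← Finset.sum_mul,
        Equiv.sum_comp Γ.1 fun g => if g.1 = (Γ.1 b').1 ∧ g ≠ Γ.1 b' then (1 : ℝ) else 0,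
        sum_ite_same_vertex]
    simp only [h2]
    rw [Finset.sum_comm]
    refine Finset.sum_congr rfl fun b' _ => ?_
    rw [← Finset.sum_mul, sum_ite_same_vertex]
    split_ifs <;> simp

theorem abs_sum_weightAvoiding_sub_le {D : ℕ} (hD : ∀ i, d i ≤ D) (Γ : Configuration d) {K : ℕ}
    (hK : Γ.excess ≤ K) (τ : ℝ) :
    |∑ b, ∑ e, (Γ.switch b e).weightAvoiding b e - (2 * pairCount d + τ)| ≤
      |Γ.doublingCount - τ| + 2 * K * (D : ℝ) ^ 2 := by
  rw [sum_weightAvoiding_switch]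
  have h1 : Γ.doublingCount - (∑ h, if Γ.IsLoop h then 0 else
      freeDegree h * freeDegree (Γ.1 h)) =
      ∑ h ∈ Γ.loopSet, freeDegree h * freeDegree (Γ.1 h) := by
    rw [doublingCount, ← Finset.sum_sub_distrib, loopSet, Finset.sum_filter]
    exact Finset.sum_congr rfl fun h _ => by split_ifs <;> simp
  have h2 : ∑ h ∈ Γ.loopSet, freeDegree h * freeDegree (Γ.1 h) ≤ 2 * K * (D : ℝ) ^ 2 := by
    have h3 : (Γ.loopSet.card : ℝ) ≤ 2 * K := by
      have h4 := Γ.card_loopSet_le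
      have h5 := Γ.two_mul_excess
      have h6 : Γ.loopSet.card ≤ 2 * K := by omega
      exact_mod_cast h6
    calc _ ≤ ∑ h ∈ Γ.loopSet, (D : ℝ) ^ 2 := Finset.sum_le_sum fun h _ => by
            rw [sq]
            exact mul_le_mul (freeDegree_le hD _) (freeDegree_le hD _) (freeDegree_nonneg _)
              (by positivity)
      _ = Γ.loopSet.card * (D : ℝ) ^ 2 := by rw [Finset.sum_const, nsmul_eq_mul]
      _ ≤ _ := by gcongr
  have h3 : 0 ≤ ∑ h ∈ Γ.loopSet, freeDegree h * freeDegree (Γ.1 h) :=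
    Finset.sum_nonneg fun h _ => mul_nonneg (freeDegree_nonneg _) (freeDegree_nonneg _)
  rw [← h1] at h2 h3
  have h4 := le_abs_self (Γ.doublingCount - τ)
  have h5 := neg_abs_le (Γ.doublingCount - τ)
  rw [abs_le]
  constructor <;> linarith

/-- The sum of the values over the configurations of excess `k`. -/
noncomputable def stratumSum (d : Fin n → ℕ) (ψ : SimpleGraph (Fin n) → ℝ) (k : ℕ) : ℝ :=
  ∑ Γ : Configuration d, if Γ.excess = k then value ψ k Γ else 0

theorem abs_sum_sub_sum_le_sum {α : Type*} (s : Finset α) (f g h : α → ℝ)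
    (hfg : ∀ a ∈ s, |f a - g a| ≤ h a) : |∑ a ∈ s, f a - ∑ a ∈ s, g a| ≤ ∑ a ∈ s, h a := by
  rw [← Finset.sum_sub_distrib]
  exact (Finset.abs_sum_le_sum_abs _ _).trans (Finset.sum_le_sum hfg)

/-- Without triples the total weight is twice the deficit, that is 4(k + 1). With a triple the
discrepancy is at most the total weight. -/
theorem abs_stratum_sub_weighted_le {ψ : SimpleGraph (Fin n) → ℝ} (hψ : ∀ G, |ψ G| ≤ 1) {K : ℕ}
    (k : ℕ) (hk : k + 1 ≤ K) :
    |4 * (k + 1) * stratumSum d ψ (k + 1) - ∑ Γ : Configuration d,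
      (if Γ.excess = k + 1 then (∑ b, Γ.weight b) * value ψ (k + 1) Γ else 0)| ≤
    (4 * K + 16 * K ^ 2) *
      (Finset.univ.filter fun Γ : Configuration d => Γ.HasTriple).card := by
  rw [stratumSum, Finset.mul_sum, mul_comm (4 * (K : ℝ) + 16 * (K : ℝ) ^ 2), ← nsmul_eq_mul,
    ← Finset.sum_const,
    Finset.sum_filter]
  refine abs_sum_sub_sum_le_sum _ _ _ _ fun Γ _ => ?_
  by_cases hx : Γ.excess = k + 1
  · rw [if_pos hx, if_pos hx, ← sub_mul, abs_mul]
    have h1 := Γ.two_mul_excess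
    have h2 := Γ.two_mul_deficit_le
    have h3 := Γ.sum_weight_le (K := K) (by omega)
    have h4 : (4 : ℝ) * (k + 1) = 2 * Γ.deficit := by
      have : 4 * (k + 1) = 2 * Γ.deficit := by omega
      exact_mod_cast this
    have h5 := abs_value_le hψ (k + 1) Γ
    have h6 : (2 : ℝ) * Γ.deficit ≤ 2 * Γ.loopSet.card + Γ.parSet.card := by exact_mod_cast h2
    rw [← sum_weight] at h6
    rw [h4]
    by_cases ht : Γ.HasTriple
    · rw [if_pos ht]
      refine (mul_le_of_le_one_right (abs_nonneg _) h5).trans ?_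
      rw [abs_le]
      have h7 : (0 : ℝ) ≤ 2 * Γ.deficit := by positivity
      constructor <;> linarith
    · rw [if_neg ht]
      have h7 : (2 : ℝ) * Γ.deficit = 2 * Γ.loopSet.card + Γ.parSet.card := by
        exact_mod_cast Γ.two_mul_deficit_eq ht
      rw [sum_weight, h7]
      simp
  · rw [if_neg hx, if_neg hx]
    split_ifs
    · simp; positivity
    · simp

/-- Independence of the bad edge is used here: the weights are not uniform on the bad edges, but any
half-edge of nonzero weight is bad and may be the one switched. -/
theorem abs_weighted_sub_avg_le {ψ : SimpleGraph (Fin n) → ℝ} (hψ : ∀ G, |ψ G| ≤ 1) {K : ℕ}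
    {G : ℝ} (hG10 : 10 ≤ G) (hG : ∀ (Γ : Configuration d) b, Γ.excess ≤ K →
      ((Finset.univ.filter fun e => ¬ Γ.Generic b e).card : ℝ) ≤ G) (k : ℕ) (hk : k < K) :
    |(∑ Γ : Configuration d,
      (if Γ.excess = k + 1 then (∑ b, Γ.weight b) * value ψ (k + 1) Γ else 0)) -
      ∑ Γ : Configuration d,
      (if Γ.excess = k + 1 then ∑ b, Γ.weight b * avgSwitch (value ψ k) Γ b else 0)| ≤
    Fintype.card (Configuration d) * ((4 * K + 16 * K ^ 2) *
      (6 * G * (2 ^ (k + 1) - 1) / Fintype.card (HalfEdge d))) := by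
  rw [← nsmul_eq_mul, ← Finset.card_univ, ← Finset.sum_const]
  have hp : (0 : ℝ) ≤ 2 ^ (k + 1) - 1 := by
    have : (1 : ℝ) ≤ 2 ^ (k + 1) := one_le_pow₀ (by norm_num)
    linarith
  refine abs_sum_sub_sum_le_sum _ _ _ _ fun Γ _ => ?_
  split_ifs with hx
  · rw [Finset.sum_mul]
    refine (abs_sum_sub_sum_le_sum _ _ _ (fun b => Γ.weight b *
      (6 * G * (2 ^ (k + 1) - 1) / Fintype.card (HalfEdge d))) fun b _ => ?_).trans ?_
    · rw [← mul_sub, abs_mul, abs_of_nonneg (Γ.weight_nonneg b)]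
      by_cases hw : Γ.weight b = 0
      · simp [hw]
      · exact mul_le_mul_of_nonneg_left (abs_value_sub_avgSwitch_le hψ hG10 hG k hk Γ hx
          (Γ.isBad_of_weight_ne_zero hw)) (Γ.weight_nonneg b)
    · rw [← Finset.sum_mul]
      exact mul_le_mul_of_nonneg_right (Γ.sum_weight_le (by omega)) (by positivity)
  · simp only [sub_self, abs_zero]
    positivity

/-- The condition on the excess is moved from the source to the target of the switching, and the
weight becomes its avoiding variant. For generic `e` neither changes anything; the other `e` number
at most G for each `b`. -/
theorem abs_avg_sub_switched_le {f : Configuration d → ℝ} (hf : ∀ Γ, |f Γ| ≤ 1) {K : ℕ}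
    {G : ℝ} (hG0 : 0 ≤ G) (hG : ∀ (Γ : Configuration d) b, Γ.excess ≤ K →
      ((Finset.univ.filter fun e => ¬ Γ.Generic b e).card : ℝ) ≤ G) (k : ℕ) (hk : k + 2 ≤ K) :
    |(∑ Γ : Configuration d,
      (if Γ.excess = k + 1 then ∑ b, Γ.weight b * avgSwitch f Γ b else 0)) -
      (∑ Γ : Configuration d, ∑ b, ∑ e, if (Γ.switch b e).excess = k then
        Γ.weightAvoiding b e * f (Γ.switch b e) else 0) / Fintype.card (HalfEdge d)| ≤
    Fintype.card (Configuration d) * ((4 * K + 16 * K ^ 2) *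
      (G / Fintype.card (HalfEdge d))) := by
  rw [← nsmul_eq_mul, ← Finset.card_univ (α := Configuration d), ← Finset.sum_const,
    Finset.sum_div]
  refine abs_sum_sub_sum_le_sum _ _ _ _ fun Γ _ => ?_
  have h1 : (if Γ.excess = k + 1 then ∑ b, Γ.weight b * avgSwitch f Γ b else 0) =
      (∑ b, ∑ e, if Γ.excess = k + 1 then Γ.weight b * f (Γ.switch b e) else 0) /
        Fintype.card (HalfEdge d) := by
    split_ifs
    · rw [Finset.sum_div]
      refine Finset.sum_congr rfl fun b _ => ?_
      rw [avgSwitch, ← Finset.mul_sum, mul_div_assoc]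
    · simp
  rw [h1, ← sub_div, abs_div, Nat.abs_cast, ← mul_div_assoc]
  refine div_le_div_of_nonneg_right ?_ (Nat.cast_nonneg _)
  by_cases hx : Γ.excess ≤ k + 2
  · refine (abs_sum_sub_sum_le_sum _ _ _ (fun b => Γ.weight b * G) fun b _ => ?_).trans ?_
    · refine (abs_sum_sub_sum_le_sum _ _ _ (fun e => if ¬ Γ.Generic b e then Γ.weight b else 0)
        fun e _ => ?_).trans ?_
      · by_cases hw : Γ.weight b = 0
        · have h2 := Γ.weightAvoiding_le b e
          have h3 := Γ.weightAvoiding_nonneg b e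
          have h4 : Γ.weightAvoiding b e = 0 := by linarith
          simp [hw, h4]
        by_cases hg : Γ.Generic b e
        · have h2 := hg.excess_switch (Γ.isBad_of_weight_ne_zero hw)
          have h3 : Γ.excess = k + 1 ↔ (Γ.switch b e).excess = k := by omega
          simp [h3, hg.weightAvoiding_eq, hg]
        · rw [if_pos hg]
          have h2 := Γ.weightAvoiding_le b e
          have h3 := Γ.weightAvoiding_nonneg b e
          have h4 := abs_le.1 (hf (Γ.switch b e))
          split_ifs <;> rw [abs_le] <;> constructor <;> nlinarith
      · rw [← Finset.sum_filter, Finset.sum_const, nsmul_eq_mul, mul_comm]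
        exact mul_le_mul_of_nonneg_left (hG Γ b (by omega)) (Γ.weight_nonneg b)
    · rw [← Finset.sum_mul]
      exact mul_le_mul_of_nonneg_right (Γ.sum_weight_le (by omega)) hG0
  · have h2 : Γ.excess ≠ k + 1 := by omega
    have h3 : ∀ b e, (Γ.switch b e).excess ≠ k := fun b e => by
      have := Γ.excess_le_switch b e
      omega
    simp only [h2, h3, if_false, Finset.sum_const_zero, sub_self, abs_zero]
    positivity

/-- The substitution Γ ↦ `Γ.switch b e`, for fixed `b` and `e`. The right side looks at the
configurations of excess `k` and at the switchings leading upwards from them. -/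
theorem sum_switched_eq (f : Configuration d → ℝ) (k : ℕ) :
    (∑ Γ : Configuration d, ∑ b, ∑ e, if (Γ.switch b e).excess = k then
        Γ.weightAvoiding b e * f (Γ.switch b e) else 0) =
    ∑ Γ : Configuration d, if Γ.excess = k then
      (∑ b, ∑ e, (Γ.switch b e).weightAvoiding b e) * f Γ else 0 := by
  have h1 : ∀ Γ : Configuration d, (if Γ.excess = k then
      (∑ b, ∑ e, (Γ.switch b e).weightAvoiding b e) * f Γ else 0) =
      ∑ b, ∑ e, if Γ.excess = k then (Γ.switch b e).weightAvoiding b e * f Γ else 0 := by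
    intro Γ
    split_ifs
    · simp only [Finset.sum_mul]
    · simp
  simp only [h1]
  rw [Finset.sum_comm, Finset.sum_comm (s := Finset.univ (α := Configuration d))]
  refine Finset.sum_congr rfl fun b _ => ?_
  rw [Finset.sum_comm, Finset.sum_comm (s := Finset.univ (α := Configuration d))]
  refine Finset.sum_congr rfl fun e _ => ?_
  rw [← Equiv.sum_comp (switchEquiv b e)]
  refine Finset.sum_congr rfl fun Γ _ => ?_
  simp only [switchEquiv, Equiv.coe_fn_mk, switch_switch]

/-- The sums of the values over consecutive strata are nearly proportional. -/
theorem abs_stratumSum_succ_sub_le {ψ : SimpleGraph (Fin n) → ℝ} (hψ : ∀ G, |ψ G| ≤ 1) {D : ℕ}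
    (hD : ∀ i, d i ≤ D) {K : ℕ}
    {G : ℝ} (hG10 : 10 ≤ G) (hG : ∀ (Γ : Configuration d) b, Γ.excess ≤ K →
      ((Finset.univ.filter fun e => ¬ Γ.Generic b e).card : ℝ) ≤ G) (k : ℕ) (hk : k + 2 ≤ K)
    (τ : ℝ) :
    |4 * (k + 1) * stratumSum d ψ (k + 1) -
      (2 * pairCount d + τ) / Fintype.card (HalfEdge d) * stratumSum d ψ k| ≤
    (4 * K + 16 * K ^ 2) *
      (Finset.univ.filter fun Γ : Configuration d => Γ.HasTriple).card +
    Fintype.card (Configuration d) * ((4 * K + 16 * K ^ 2) *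
      (6 * G * (2 ^ (k + 1) - 1) / Fintype.card (HalfEdge d))) +
    Fintype.card (Configuration d) * ((4 * K + 16 * K ^ 2) *
      (G / Fintype.card (HalfEdge d))) +
    (∑ Γ : Configuration d, |Γ.doublingCount - τ| +
      Fintype.card (Configuration d) * (2 * K * (D : ℝ) ^ 2)) / Fintype.card (HalfEdge d) := by
  have a1 := abs_stratum_sub_weighted_le (d := d) hψ (K := K) k (by omega)
  have a2 := abs_weighted_sub_avg_le hψ hG10 hG k (by omega)
  have a3 := abs_avg_sub_switched_le (abs_value_le hψ k) (by linarith) hG k hk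
  have a4 : |(∑ Γ : Configuration d, ∑ b, ∑ e, if (Γ.switch b e).excess = k then
        Γ.weightAvoiding b e * value ψ k (Γ.switch b e) else 0) / Fintype.card (HalfEdge d) -
      (2 * pairCount d + τ) / Fintype.card (HalfEdge d) * stratumSum d ψ k| ≤
      (∑ Γ : Configuration d, |Γ.doublingCount - τ| +
      Fintype.card (Configuration d) * (2 * K * (D : ℝ) ^ 2)) / Fintype.card (HalfEdge d) := by
    rw [sum_switched_eq, div_mul_eq_mul_div, ← sub_div, abs_div, Nat.abs_cast]
    refine div_le_div_of_nonneg_right ?_ (Nat.cast_nonneg _)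
    rw [stratumSum, Finset.mul_sum, ← nsmul_eq_mul, ← Finset.card_univ, ← Finset.sum_const,
      ← Finset.sum_add_distrib]
    refine abs_sum_sub_sum_le_sum _ _ _ _ fun Γ _ => ?_
    split_ifs with hx
    · rw [← sub_mul, abs_mul]
      exact (mul_le_of_le_one_right (abs_nonneg _) (abs_value_le hψ k Γ)).trans
        (Γ.abs_sum_weightAvoiding_sub_le hD (by omega) τ)
    · simp only [mul_zero, sub_self, abs_zero]
      positivity
  refine (abs_sub_le _ _ _).trans (add_le_add ?_ a4)
  refine (abs_sub_le _ _ _).trans (add_le_add ?_ a3)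
  exact (abs_sub_le _ _ _).trans (add_le_add a1 a2)

end Configuration

end Strata

/-! ### Moment estimates for a uniformly random configuration -/

section Moments

open scoped Classical

namespace Configuration

variable {n : ℕ} {d : Fin n → ℕ}

/-- Switching `h` with each `e ∈ A` spreads every configuration containing the edge `{h, g}` over
`A.card` others, injectively: afterwards `e` is the partner of `g`, and the switching can be undone.
This replaces explicit counts of matchings. -/
theorem card_filter_pair_mul_le (P : Configuration d → Prop) (h g : HalfEdge d)
    (A : Finset (HalfEdge d)) (hg : g ∉ A)
    (hA : ∀ Γ : Configuration d, P Γ → Γ.1 h = g → ∀ e ∈ A, P (Γ.switch h e)) :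
    (Finset.univ.filter fun Γ : Configuration d => P Γ ∧ Γ.1 h = g).card * A.card ≤
      (Finset.univ.filter P).card := by
  rw [← Finset.card_product]
  refine Finset.card_le_card_of_injOn (fun q => q.1.switch h q.2) ?_ ?_
  · rintro ⟨Γ, e⟩ hq
    simp only [Finset.coe_product, Finset.coe_filter, Finset.mem_univ, true_and, Set.mem_prod,
      Set.mem_ofPred_eq, Finset.mem_coe] at hq ⊢
    exact hA Γ hq.1.1 hq.1.2 e hq.2
  · rintro ⟨Γ, e⟩ hq ⟨Γ', e'⟩ hq' heq
    simp only [Finset.coe_product, Finset.coe_filter, Finset.mem_univ, true_and, Set.mem_prod,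
      Set.mem_ofPred_eq, Finset.mem_coe] at hq hq' heq
    have h1 : e ≠ Γ.1 h := by rw [hq.1.2]; rintro rfl; exact hg hq.2
    have h2 : e' ≠ Γ'.1 h := by rw [hq'.1.2]; rintro rfl; exact hg hq'.2
    have h3 := switch_apply_left_partner Γ h1
    have h4 := switch_apply_left_partner Γ' h2
    rw [heq, hq.1.2] at h3
    rw [hq'.1.2] at h4
    have h5 : e = e' := h3.symm.trans h4
    subst h5
    have h6 := congrArg (fun Δ => switch Δ h e) heq
    simp only [switch_switch] at h6
    rw [h6]

/-- At most five half-edges are forbidden, which suffices for prescribing three edges one after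
another. With N ≥ 10 at least N/2 remain, whence the factor 2/N per edge. -/
theorem card_pair_le (P : Configuration d → Prop) (h g : HalfEdge d) (F : Finset (HalfEdge d))
    (hF : F.card ≤ 5) (hN : 10 ≤ Fintype.card (HalfEdge d)) (hg : g ∈ F)
    (hA : ∀ Γ : Configuration d, P Γ → Γ.1 h = g → ∀ e ∉ F, P (Γ.switch h e)) :
    ((Finset.univ.filter fun Γ : Configuration d => P Γ ∧ Γ.1 h = g).card : ℝ) ≤
      2 / Fintype.card (HalfEdge d) * (Finset.univ.filter P).card := by
  have h1 := card_filter_pair_mul_le P h g Fᶜ (by simpa using hg)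
    (fun Γ hP hh e he => hA Γ hP hh e (by simpa using he))
  rw [Finset.card_compl] at h1
  have h2 : Fintype.card (HalfEdge d) ≤ 2 * (Fintype.card (HalfEdge d) - F.card) := by omega
  have hN' : (0 : ℝ) < Fintype.card (HalfEdge d) := by
    have : 0 < Fintype.card (HalfEdge d) := by omega
    exact_mod_cast this
  rw [div_mul_eq_mul_div, le_div_iff₀ hN']
  have h3 : (Finset.univ.filter fun Γ : Configuration d => P Γ ∧ Γ.1 h = g).card *
      Fintype.card (HalfEdge d) ≤ 2 * (Finset.univ.filter P).card := by
    calc _ ≤ (Finset.univ.filter fun Γ : Configuration d => P Γ ∧ Γ.1 h = g).card *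
          (2 * (Fintype.card (HalfEdge d) - F.card)) := Nat.mul_le_mul_left _ h2
      _ ≤ _ := by rw [mul_left_comm]; exact Nat.mul_le_mul_left _ h1
  exact_mod_cast h3

theorem card_one_edge_le (hN : 10 ≤ Fintype.card (HalfEdge d)) (h g : HalfEdge d) :
    ((Finset.univ.filter fun Γ : Configuration d => Γ.1 h = g).card : ℝ) ≤
      2 / Fintype.card (HalfEdge d) * Fintype.card (Configuration d) := by
  have := card_pair_le (d := d) (fun _ => True) h g {g} (by simp) hN (by simp)
    (fun _ _ _ _ _ => trivial)
  simpa using this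

theorem switch_apply_of_notMem {Γ : Configuration d} {h₁ g₁ h g e : HalfEdge d}
    (h1 : Γ.1 h₁ = g₁) (h2 : Γ.1 h = g) (n1 : h ≠ h₁) (n2 : g ≠ h₁) (n3 : e ≠ h₁)
    (n4 : e ≠ g₁) : (Γ.switch h e).1 h₁ = g₁ := by
  rw [switch_apply_of_ne Γ n1.symm (by rw [h2]; exact n2.symm) n3.symm, h1]
  rintro rfl
  rw [partner_partner] at h1
  exact n4 h1

theorem card_two_edges_le (hN : 10 ≤ Fintype.card (HalfEdge d)) (h₁ g₁ h₂ g₂ : HalfEdge d)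
    (n1 : h₂ ≠ h₁) (n2 : g₂ ≠ h₁) :
    ((Finset.univ.filter fun Γ : Configuration d => Γ.1 h₁ = g₁ ∧ Γ.1 h₂ = g₂).card : ℝ) ≤
      (2 / Fintype.card (HalfEdge d)) ^ 2 * Fintype.card (Configuration d) := by
  have := card_pair_le (d := d) (fun Γ => Γ.1 h₁ = g₁) h₂ g₂ {g₂, h₁, g₁}
    (Finset.card_le_three.trans (by norm_num)) hN (by simp) ?_
  · have hle : ((Finset.univ.filter fun Γ : Configuration d =>
        Γ.1 h₁ = g₁ ∧ Γ.1 h₂ = g₂).card : ℝ) ≤ 2 / Fintype.card (HalfEdge d) *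
        (Finset.univ.filter fun Γ : Configuration d => Γ.1 h₁ = g₁).card := by convert this
    refine hle.trans ?_
    rw [sq, mul_assoc]
    exact mul_le_mul_of_nonneg_left (card_one_edge_le hN h₁ g₁) (by positivity)
  · intro Γ hP hh e he
    simp only [Finset.mem_insert, Finset.mem_singleton, not_or] at he
    exact switch_apply_of_notMem hP hh n1 n2 he.2.1 he.2.2

theorem card_three_edges_le (hN : 10 ≤ Fintype.card (HalfEdge d))
    (h₁ g₁ h₂ g₂ h₃ g₃ : HalfEdge d) (n1 : h₂ ≠ h₁) (n2 : g₂ ≠ h₁) (n3 : h₃ ≠ h₁) (n4 : g₃ ≠ h₁)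
    (n5 : h₃ ≠ h₂) (n6 : g₃ ≠ h₂) :
    ((Finset.univ.filter fun Γ : Configuration d =>
      (Γ.1 h₁ = g₁ ∧ Γ.1 h₂ = g₂) ∧ Γ.1 h₃ = g₃).card : ℝ) ≤
      (2 / Fintype.card (HalfEdge d)) ^ 3 * Fintype.card (Configuration d) := by
  have := card_pair_le (d := d) (fun Γ => Γ.1 h₁ = g₁ ∧ Γ.1 h₂ = g₂) h₃ g₃ {g₃, h₁, g₁, h₂, g₂}
    Finset.card_le_five hN (by simp) ?_
  · have hle : ((Finset.univ.filter fun Γ : Configuration d =>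
        (Γ.1 h₁ = g₁ ∧ Γ.1 h₂ = g₂) ∧ Γ.1 h₃ = g₃).card : ℝ) ≤ 2 / Fintype.card (HalfEdge d) *
        (Finset.univ.filter fun Γ : Configuration d => Γ.1 h₁ = g₁ ∧ Γ.1 h₂ = g₂).card := by
      convert this
    refine hle.trans ?_
    rw [pow_succ', mul_assoc]
    exact mul_le_mul_of_nonneg_left (card_two_edges_le hN h₁ g₁ h₂ g₂ n1 n2) (by positivity)
  · intro Γ hP hh e he
    simp only [Finset.mem_insert, Finset.mem_singleton, not_or] at he
    exact ⟨switch_apply_of_notMem hP.1 hh n3 n4 he.2.1 he.2.2.1,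
      switch_apply_of_notMem hP.2 hh n5 n6 he.2.2.2.1 he.2.2.2.2⟩

/-- The set of ordered pairs of distinct half-edges at a common vertex. -/
def siblings (d : Fin n → ℕ) : Finset (HalfEdge d × HalfEdge d) :=
  Finset.univ.filter fun q => q.2.1 = q.1.1 ∧ q.2 ≠ q.1

theorem card_siblings : ((siblings d).card : ℝ) = pairCount d := by
  rw [siblings, Finset.card_filter, Nat.cast_sum, Fintype.sum_prod_type, pairCount]
  refine Finset.sum_congr rfl fun h _ => ?_
  rw [← sum_ite_same_vertex]
  simp

theorem sum_card_loopSet_le (hN : 10 ≤ Fintype.card (HalfEdge d)) :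
    ∑ Γ : Configuration d, (Γ.loopSet.card : ℝ) ≤
      pairCount d * (2 / Fintype.card (HalfEdge d)) * Fintype.card (Configuration d) := by
  have h1 : ∀ Γ : Configuration d, (Γ.loopSet.card : ℝ) ≤
      ∑ q ∈ siblings d, if Γ.1 q.1 = q.2 then 1 else 0 := by
    intro Γ
    rw [← Finset.sum_filter, Finset.sum_const, nsmul_eq_mul, mul_one]
    have : Γ.loopSet.card ≤ ((siblings d).filter fun q => Γ.1 q.1 = q.2).card := by
      refine Finset.card_le_card_of_injOn (fun h => (h, Γ.1 h)) ?_ ?_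
      · intro h hh
        have hh' : Γ.IsLoop h := (Γ.mem_loopSet h).1 hh
        simpa [siblings, Γ.partner_ne h, IsLoop] using hh'
      · intro x _ y _ hxy
        exact congrArg Prod.fst hxy
    exact_mod_cast this
  calc _ ≤ ∑ Γ : Configuration d, ∑ q ∈ siblings d, (if Γ.1 q.1 = q.2 then (1 : ℝ) else 0) :=
        Finset.sum_le_sum fun Γ _ => h1 Γ
    _ = ∑ q ∈ siblings d, ((Finset.univ.filter fun Γ : Configuration d =>
          Γ.1 q.1 = q.2).card : ℝ) := by
        rw [Finset.sum_comm]
        refine Finset.sum_congr rfl fun q _ => ?_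
        rw [← Finset.sum_filter, Finset.sum_const, nsmul_eq_mul, mul_one]
    _ ≤ (siblings d).card • (2 / Fintype.card (HalfEdge d) * Fintype.card (Configuration d) : ℝ) :=
        Finset.sum_le_card_nsmul _ _ _ fun q _ => card_one_edge_le hN _ _
    _ = _ := by rw [nsmul_eq_mul, card_siblings, mul_assoc]

theorem sum_card_parSet_le (hN : 10 ≤ Fintype.card (HalfEdge d)) :
    ∑ Γ : Configuration d, (Γ.parSet.card : ℝ) ≤
      (pairCount d * (2 / Fintype.card (HalfEdge d))) ^ 2 * Fintype.card (Configuration d) := by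
  set S := (siblings d ×ˢ siblings d).filter fun q => q.2.1.1 ≠ q.1.1.1
  have h1 : ∀ Γ : Configuration d, (Γ.parSet.card : ℝ) ≤
      ∑ q ∈ S, if Γ.1 q.1.1 = q.2.1 ∧ Γ.1 q.1.2 = q.2.2 then 1 else 0 := by
    intro Γ
    rw [← Finset.sum_filter, Finset.sum_const, nsmul_eq_mul, mul_one]
    have : Γ.parSet.card ≤
        (S.filter fun q => Γ.1 q.1.1 = q.2.1 ∧ Γ.1 q.1.2 = q.2.2).card := by
      refine Finset.card_le_card_of_injOn (fun q => (q, (Γ.1 q.1, Γ.1 q.2))) ?_ ?_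
      · intro q hq
        obtain ⟨h2, h3, h4⟩ := (Γ.mem_parSet q).1 hq
        have h5 : q.2.1 = q.1.1 := congrArg Prod.fst h4
        have h6 : (Γ.1 q.2).1 = (Γ.1 q.1).1 := congrArg Prod.snd h4
        have h7 : Γ.1 q.2 ≠ Γ.1 q.1 := fun h => h3 (Γ.partner_inj.1 h).symm
        simp only [S, siblings, Finset.coe_filter, Finset.mem_filter, Finset.mem_product,
          Finset.mem_univ, true_and, Set.mem_ofPred_eq]
        exact ⟨⟨⟨⟨h5, h3.symm⟩, h6, h7⟩, h2⟩, trivial⟩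
      · intro x _ y _ hxy
        exact congrArg Prod.fst hxy
    exact_mod_cast this
  calc _ ≤ ∑ Γ : Configuration d, ∑ q ∈ S,
        (if Γ.1 q.1.1 = q.2.1 ∧ Γ.1 q.1.2 = q.2.2 then (1 : ℝ) else 0) :=
        Finset.sum_le_sum fun Γ _ => h1 Γ
    _ = ∑ q ∈ S, ((Finset.univ.filter fun Γ : Configuration d =>
          Γ.1 q.1.1 = q.2.1 ∧ Γ.1 q.1.2 = q.2.2).card : ℝ) := by
        rw [Finset.sum_comm]
        refine Finset.sum_congr rfl fun q _ => ?_
        rw [← Finset.sum_filter, Finset.sum_const, nsmul_eq_mul, mul_one]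
    _ ≤ S.card • ((2 / Fintype.card (HalfEdge d)) ^ 2 * Fintype.card (Configuration d) : ℝ) := by
        refine Finset.sum_le_card_nsmul _ _ _ fun q hq => ?_
        simp only [S, siblings, Finset.mem_filter, Finset.mem_product, Finset.mem_univ,
          true_and] at hq
        refine card_two_edges_le hN _ _ _ _ hq.1.1.2 fun h => hq.2 ?_
        rw [← hq.1.2.1, h]
    _ ≤ ((siblings d).card * (siblings d).card : ℝ) *
          ((2 / Fintype.card (HalfEdge d)) ^ 2 * Fintype.card (Configuration d)) := by
        rw [nsmul_eq_mul]
        refine mul_le_mul_of_nonneg_right ?_ (by positivity)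
        have : S.card ≤ (siblings d).card * (siblings d).card := by
          rw [← Finset.card_product]; exact Finset.card_filter_le _ _
        exact_mod_cast this
    _ = _ := by rw [card_siblings]; ring

/-- The set of ordered triples of half-edges at a common vertex. -/
def triples (d : Fin n → ℕ) : Finset (HalfEdge d × HalfEdge d × HalfEdge d) :=
  Finset.univ.filter fun q => q.2.1.1 = q.1.1 ∧ q.2.2.1 = q.1.1

theorem card_triples : (triples d).card = ∑ i, d i ^ 3 := by
  rw [triples, Finset.card_filter, Fintype.sum_prod_type]
  simp only [Fintype.sum_prod_type, ite_and]
  have h1 : ∀ h : HalfEdge d, (∑ x : HalfEdge d, ∑ y : HalfEdge d,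
      if x.1 = h.1 then (if y.1 = h.1 then 1 else 0) else 0) = d h.1 * d h.1 := by
    intro h
    have : ∀ x : HalfEdge d, (∑ y : HalfEdge d,
      if x.1 = h.1 then (if y.1 = h.1 then 1 else 0) else 0) =
        if x.1 = h.1 then d h.1 else 0 := by
      intro x
      split_ifs
      · rw [← Finset.card_filter, card_vertex]
      · simp
    simp only [this]
    rw [← Finset.sum_filter, Finset.sum_const, card_vertex, smul_eq_mul]
  simp only [h1]
  rw [Fintype.sum_sigma]
  refine Finset.sum_congr rfl fun i _ => ?_
  simp
  ring

/-- A union bound over three half-edges at each of two vertices. With ∑ dᵢ² = O(N) the probability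
is O(D²/N), since ∑ dᵢ³ ≤ D ∑ dᵢ². -/
theorem card_hasTriple_le (hN : 10 ≤ Fintype.card (HalfEdge d)) :
    ((Finset.univ.filter fun Γ : Configuration d => Γ.HasTriple).card : ℝ) ≤
      (∑ i, (d i : ℝ) ^ 3) ^ 2 * (2 / Fintype.card (HalfEdge d)) ^ 3 *
        Fintype.card (Configuration d) := by
  set S := (triples d ×ˢ triples d).filter fun q => q.2.1.1 ≠ q.1.1.1 ∧ q.1.2.1 ≠ q.1.1 ∧
    q.1.2.2 ≠ q.1.1 ∧ q.1.2.2 ≠ q.1.2.1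
  have h1 : (Finset.univ.filter fun Γ : Configuration d => Γ.HasTriple) ⊆
      S.biUnion fun q => Finset.univ.filter fun Γ : Configuration d =>
        (Γ.1 q.1.1 = q.2.1 ∧ Γ.1 q.1.2.1 = q.2.2.1) ∧ Γ.1 q.1.2.2 = q.2.2.2 := by
    intro Γ hΓ
    simp only [Finset.mem_filter, Finset.mem_univ, true_and] at hΓ
    obtain ⟨p, hp, hc⟩ := hΓ
    obtain ⟨x, y, z, hx, hy, hz, hxy, hxz, hyz⟩ := Finset.two_lt_card_iff.1 hc
    rw [mem_fiber] at hx hy hz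
    rw [mem_adjSet, ← hx] at hp
    rw [← hx] at hy hz
    have y1 : y.1 = x.1 := congrArg Prod.fst hy
    have y2 : (Γ.1 y).1 = (Γ.1 x).1 := congrArg Prod.snd hy
    have z1 : z.1 = x.1 := congrArg Prod.fst hz
    have z2 : (Γ.1 z).1 = (Γ.1 x).1 := congrArg Prod.snd hz
    rw [Finset.mem_biUnion]
    refine ⟨((x, y, z), (Γ.1 x, Γ.1 y, Γ.1 z)), ?_, by simp⟩
    simp only [S, triples, Finset.mem_filter, Finset.mem_product, Finset.mem_univ, true_and]
    exact ⟨⟨⟨y1, z1⟩, y2, z2⟩, fun h => hp.1 h.symm, hxy.symm, hxz.symm, hyz.symm⟩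
  have h2 : (S.card : ℝ) ≤ (∑ i, (d i : ℝ) ^ 3) ^ 2 := by
    have : S.card ≤ (∑ i, d i ^ 3) ^ 2 := by
      rw [sq, ← card_triples, ← Finset.card_product]; exact Finset.card_filter_le _ _
    exact_mod_cast this
  calc _ ≤ ((S.biUnion fun q => Finset.univ.filter fun Γ : Configuration d =>
        (Γ.1 q.1.1 = q.2.1 ∧ Γ.1 q.1.2.1 = q.2.2.1) ∧ Γ.1 q.1.2.2 = q.2.2.2).card : ℝ) := by
        exact_mod_cast Finset.card_le_card h1
    _ ≤ ∑ q ∈ S, ((Finset.univ.filter fun Γ : Configuration d =>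
        (Γ.1 q.1.1 = q.2.1 ∧ Γ.1 q.1.2.1 = q.2.2.1) ∧ Γ.1 q.1.2.2 = q.2.2.2).card : ℝ) := by
        exact_mod_cast Finset.card_biUnion_le
    _ ≤ S.card • ((2 / Fintype.card (HalfEdge d)) ^ 3 * Fintype.card (Configuration d) : ℝ) := by
        refine Finset.sum_le_card_nsmul _ _ _ fun q hq => ?_
        simp only [S, triples, Finset.mem_filter, Finset.mem_product, Finset.mem_univ,
          true_and] at hq
        obtain ⟨⟨⟨y1, z1⟩, y2, z2⟩, h3, h4, h5, h6⟩ := hq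
        refine card_three_edges_le hN _ _ _ _ _ _ h4 (fun h => h3 ?_) h5 (fun h => h3 ?_) h6
          (fun h => h3 ?_)
        · rw [← y2, h]
        · rw [← z2, h]
        · rw [← z2, h, y1]
    _ ≤ _ := by
        rw [nsmul_eq_mul, mul_assoc]
        exact mul_le_mul_of_nonneg_right h2 (by positivity)

/-- The expected excess is bounded. -/
theorem sum_excess_le (hN : 10 ≤ Fintype.card (HalfEdge d)) :
    ∑ Γ : Configuration d, (Γ.excess : ℝ) ≤
      (pairCount d * (2 / Fintype.card (HalfEdge d)) +
      (pairCount d * (2 / Fintype.card (HalfEdge d))) ^ 2) * Fintype.card (Configuration d) := by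
  rw [add_mul]
  refine le_trans ?_ (add_le_add (sum_card_loopSet_le hN) (sum_card_parSet_le hN))
  rw [← Finset.sum_add_distrib]
  refine Finset.sum_le_sum fun Γ _ => ?_
  have h1 := Γ.two_mul_deficit_le
  have h2 := Γ.two_mul_excess
  have h3 : Γ.excess ≤ Γ.loopSet.card + Γ.parSet.card := by omega
  exact_mod_cast h3

theorem pairCount_nonneg : 0 ≤ pairCount d :=
  Finset.sum_nonneg fun h _ => freeDegree_nonneg h

theorem doublingCount_nonneg (Γ : Configuration d) : 0 ≤ Γ.doublingCount :=
  Finset.sum_nonneg fun h _ => mul_nonneg (freeDegree_nonneg h) (freeDegree_nonneg _)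

theorem doublingCount_le {D : ℕ} (hD : ∀ i, d i ≤ D) (Γ : Configuration d) :
    Γ.doublingCount ≤ pairCount d * D := by
  rw [doublingCount, pairCount, Finset.sum_mul]
  exact Finset.sum_le_sum fun h _ =>
    mul_le_mul_of_nonneg_left (freeDegree_le hD _) (freeDegree_nonneg h)

theorem abs_doublingCount_switch_sub_le {D : ℕ} (hD : ∀ i, d i ≤ D) (Γ : Configuration d)
    (b e : HalfEdge d) : |(Γ.switch b e).doublingCount - Γ.doublingCount| ≤ 4 * (D : ℝ) ^ 2 := by
  refine (abs_sum_sub_sum_le _ _ (fun x => x ∉ ({b, Γ.1 b, e, Γ.1 e} : Finset _)) (c := 0)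
    (M := (D : ℝ) ^ 2) (G := 4) le_rfl (by positivity) ?_ ?_ ?_).trans (by linarith)
  · intro x hx
    simp only [Finset.mem_insert, Finset.mem_singleton, not_or] at hx
    rw [switch_apply_of_ne Γ hx.1 hx.2.1 hx.2.2.1 hx.2.2.2]
    simp
  · intro x
    have h1 : ∀ y z : HalfEdge d, 0 ≤ freeDegree y * freeDegree z :=
      fun y z => mul_nonneg (freeDegree_nonneg y) (freeDegree_nonneg z)
    have h2 : ∀ y z : HalfEdge d, freeDegree y * freeDegree z ≤ (D : ℝ) ^ 2 := fun y z => by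
      rw [sq]
      exact mul_le_mul (freeDegree_le hD _) (freeDegree_le hD _) (freeDegree_nonneg _)
        (by positivity)
    rw [abs_le]
    constructor
    · linarith [h1 x ((Γ.switch b e).1 x), h2 x (Γ.1 x)]
    · linarith [h1 x (Γ.1 x), h2 x ((Γ.switch b e).1 x)]
  · rw [card_filter_not_notMem]
    exact_mod_cast Finset.card_le_four

/-- Write T for `doublingCount` and f for `freeDegree`. Randomly switching at `h` replaces f(Γ h) by
an almost independent f(Γ e) and changes T by at most 4D². Hence 𝔼[f(Γ h)(T − τ)] is bounded above
by (P/N) 𝔼[T − τ] plus a small error. Summing against f(h), with τ = P²/N, bounds 𝔼[T(T − τ)] − τ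
𝔼[T − τ] = 𝔼[(T − τ)²] without computing any moment. -/
theorem sum_doublingCount_deviation_sq_le {D : ℕ} (hD : ∀ i, d i ≤ D) {τ : ℝ}
    (hτ : τ = pairCount d ^ 2 / Fintype.card (HalfEdge d)) :
    ∑ Γ : Configuration d, (Γ.doublingCount - τ) ^ 2 ≤
      pairCount d * (5 * pairCount d * (D : ℝ) ^ 2 + D * τ) / Fintype.card (HalfEdge d) *
        Fintype.card (Configuration d) := by
  rcases Nat.eq_zero_or_pos (Fintype.card (HalfEdge d)) with h0 | h0
  · have : IsEmpty (HalfEdge d) := Fintype.card_eq_zero_iff.1 h0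
    simp [hτ, doublingCount]
  have hN : (0 : ℝ) < Fintype.card (HalfEdge d) := by exact_mod_cast h0
  have hP := pairCount_nonneg (d := d)
  have hτ0 : 0 ≤ τ := by rw [hτ]; positivity
  set N : ℝ := ((Fintype.card (HalfEdge d) : ℕ) : ℝ)
  have key : ∀ h : HalfEdge d,
      N * ∑ Γ : Configuration d, freeDegree (Γ.1 h) * (Γ.doublingCount - τ) ≤
      pairCount d * ∑ Γ : Configuration d, (Γ.doublingCount - τ) +
      Fintype.card (Configuration d) * (5 * pairCount d * (D : ℝ) ^ 2 + D * τ) := by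
    intro h
    have h1 : N * ∑ Γ : Configuration d, freeDegree (Γ.1 h) * (Γ.doublingCount - τ) =
        ∑ Γ : Configuration d, ∑ e, freeDegree ((Γ.switch h e).1 h) *
          ((Γ.switch h e).doublingCount - τ) := by
      rw [Finset.sum_comm]
      have : ∀ e : HalfEdge d, (∑ Γ : Configuration d, freeDegree ((Γ.switch h e).1 h) *
          ((Γ.switch h e).doublingCount - τ)) =
          ∑ Γ : Configuration d, freeDegree (Γ.1 h) * (Γ.doublingCount - τ) := fun e =>
        Equiv.sum_comp (switchEquiv h e) fun Γ => freeDegree (Γ.1 h) * (Γ.doublingCount - τ)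
      simp only [this, Finset.sum_const, Finset.card_univ, nsmul_eq_mul]
      rfl
    rw [h1, Finset.mul_sum, ← nsmul_eq_mul, ← Finset.card_univ, ← Finset.sum_const,
      ← Finset.sum_add_distrib]
    refine Finset.sum_le_sum fun Γ _ => ?_
    have hT0 := Γ.doublingCount_nonneg
    have hT1 := Γ.doublingCount_le hD
    have h2 : pairCount d = ∑ e, freeDegree (Γ.1 e) :=
      (Equiv.sum_comp Γ.1 fun e => freeDegree e).symm
    have h3 : ∀ e, freeDegree ((Γ.switch h e).1 h) * ((Γ.switch h e).doublingCount - τ) ≤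
        freeDegree (Γ.1 e) * (Γ.doublingCount - τ) + freeDegree (Γ.1 e) * (4 * (D : ℝ) ^ 2) +
        if e = Γ.1 h then D * (pairCount d * D + τ) else 0 := by
      intro e
      -- This switching is trivial, so `h` keeps its partner; the crude bound D(PD + τ) pays for the
      -- single exceptional term.
      by_cases he : e = Γ.1 h
      · subst he
        rw [switch_partner_self, partner_partner, if_pos rfl]
        have a1 := freeDegree_nonneg h
        have a2 := freeDegree_nonneg (Γ.1 h)
        have a3 := freeDegree_le hD h
        have a4 := freeDegree_le hD (Γ.1 h)
        have a5 : (freeDegree (Γ.1 h) - freeDegree h) * (Γ.doublingCount - τ) ≤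
            D * (pairCount d * D + τ) := by
          refine (le_abs_self _).trans ?_
          rw [abs_mul]
          refine mul_le_mul ?_ ?_ (abs_nonneg _) (Nat.cast_nonneg _)
          · rw [abs_le]; constructor <;> linarith
          · rw [abs_le]; constructor <;> linarith
        have a6 : 0 ≤ freeDegree h * (4 * (D : ℝ) ^ 2) := by positivity
        linarith
      · rw [switch_apply_left Γ he, if_neg he, add_zero, ← mul_add]
        refine mul_le_mul_of_nonneg_left ?_ (freeDegree_nonneg _)
        have := (abs_le.1 (abs_doublingCount_switch_sub_le hD Γ h e)).2
        linarith
    refine (Finset.sum_le_sum fun e _ => h3 e).trans ?_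
    rw [Finset.sum_add_distrib, Finset.sum_add_distrib, ← Finset.sum_mul, ← Finset.sum_mul, ← h2,
      Finset.sum_ite_eq' Finset.univ (Γ.1 h), if_pos (Finset.mem_univ _)]
    nlinarith
  have h4 : N * ∑ Γ : Configuration d, Γ.doublingCount * (Γ.doublingCount - τ) ≤
      pairCount d * (pairCount d * ∑ Γ : Configuration d, (Γ.doublingCount - τ) +
      Fintype.card (Configuration d) * (5 * pairCount d * (D : ℝ) ^ 2 + D * τ)) := by
    have : N * ∑ Γ : Configuration d, Γ.doublingCount * (Γ.doublingCount - τ) =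
        ∑ h, freeDegree h *
          (N * ∑ Γ : Configuration d, freeDegree (Γ.1 h) * (Γ.doublingCount - τ)) := by
      simp only [Finset.mul_sum]
      rw [Finset.sum_comm]
      refine Finset.sum_congr rfl fun Γ _ => ?_
      nth_rewrite 1 [doublingCount]
      rw [Finset.sum_mul, Finset.mul_sum]
      exact Finset.sum_congr rfl fun h _ => by ring
    rw [this]
    conv_rhs => rw [show pairCount d = ∑ h : HalfEdge d, freeDegree h from rfl]
    rw [Finset.sum_mul]
    exact Finset.sum_le_sum fun h _ => mul_le_mul_of_nonneg_left (key h) (freeDegree_nonneg h)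
  have h5 : ∑ Γ : Configuration d, (Γ.doublingCount - τ) ^ 2 =
      ∑ Γ : Configuration d, Γ.doublingCount * (Γ.doublingCount - τ) -
      τ * ∑ Γ : Configuration d, (Γ.doublingCount - τ) := by
    rw [Finset.mul_sum, ← Finset.sum_sub_distrib]
    exact Finset.sum_congr rfl fun Γ _ => by ring
  rw [h5, div_mul_eq_mul_div, le_div_iff₀ hN]
  have h6 : τ * N = pairCount d ^ 2 := by rw [hτ]; field_simp
  have h7 : τ * (∑ Γ : Configuration d, (Γ.doublingCount - τ)) * N =
      pairCount d ^ 2 * ∑ Γ : Configuration d, (Γ.doublingCount - τ) := by rw [← h6]; ring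
  rw [sub_mul, h7]
  linarith

theorem sum_abs_doublingCount_deviation_le {D : ℕ} (hD : ∀ i, d i ≤ D) {τ : ℝ}
    (hτ : τ = pairCount d ^ 2 / Fintype.card (HalfEdge d)) :
    ∑ Γ : Configuration d, |Γ.doublingCount - τ| ≤ Fintype.card (Configuration d) *
      √(pairCount d * (5 * pairCount d * (D : ℝ) ^ 2 + D * τ) / Fintype.card (HalfEdge d)) := by
  have h1 := sum_doublingCount_deviation_sq_le hD hτ
  set R := pairCount d * (5 * pairCount d * (D : ℝ) ^ 2 + D * τ) / Fintype.card (HalfEdge d)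
  have h2 : (∑ Γ : Configuration d, |Γ.doublingCount - τ|) ^ 2 ≤
      Fintype.card (Configuration d) * ∑ Γ : Configuration d, |Γ.doublingCount - τ| ^ 2 := by
    have := sq_sum_le_card_mul_sum_sq (s := Finset.univ)
      (f := fun Γ : Configuration d => |Γ.doublingCount - τ|)
    rwa [Finset.card_univ] at this
  simp only [sq_abs] at h2
  have h3 : (∑ Γ : Configuration d, |Γ.doublingCount - τ|) ^ 2 ≤
      (Fintype.card (Configuration d) : ℝ) ^ 2 * R := by
    refine h2.trans ?_
    rw [sq, mul_assoc]
    refine mul_le_mul_of_nonneg_left ?_ (Nat.cast_nonneg _)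
    linarith
  refine (Real.le_sqrt_of_sq_le h3).trans ?_
  rw [Real.sqrt_mul (by positivity), Real.sqrt_sq (Nat.cast_nonneg _)]

end Configuration

end Moments

/-! ### Comparing the actual process with the values -/

section Termination

open scoped Classical

theorem PMF.tsum_bind_mul {α β : Type*} (p : PMF α) (f : α → PMF β) (g : β → ℝ≥0∞) :
    ∑' b, p.bind f b * g b = ∑' a, p a * ∑' b, f a b * g b := by
  simp only [PMF.bind_apply, ← ENNReal.tsum_mul_right, ← ENNReal.tsum_mul_left]
  rw [ENNReal.tsum_comm]
  simp only [mul_assoc]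

theorem PMF.tsum_pure_mul {α : Type*} (a : α) (g : α → ℝ≥0∞) :
    ∑' b, PMF.pure a b * g b = g a := by
  rw [tsum_eq_single a]
  · simp
  · intro b hb; simp [hb]

theorem PMF.tsum_map_mul {α β : Type*} (p : PMF α) (f : α → β) (g : β → ℝ≥0∞) :
    ∑' b, p.map f b * g b = ∑' a, p a * g (f a) := by
  rw [← PMF.bind_pure_comp, PMF.tsum_bind_mul]
  simp only [Function.comp_apply, PMF.tsum_pure_mul]

theorem PMF.tsum_uniformOfFinset_mul {α : Type*} (s : Finset α) (hs : s.Nonempty)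
    (g : α → ℝ≥0∞) : ∑' a, PMF.uniformOfFinset s hs a * g a = (∑ a ∈ s, g a) / s.card := by
  rw [tsum_eq_sum (s := s)]
  · rw [ENNReal.div_eq_inv_mul, Finset.mul_sum]
    refine Finset.sum_congr rfl fun a ha => ?_
    rw [PMF.uniformOfFinset_apply_of_mem hs ha]
  · intro a ha
    rw [PMF.uniformOfFinset_apply_of_notMem hs ha, zero_mul]

variable {n : ℕ} {d : Fin n → ℕ}

namespace Configuration

/-- The value of a configuration whose excess is at most `j`. -/
noncomputable def cappedValue (ψ : SimpleGraph (Fin n) → ℝ) (j : ℕ) (Γ : Configuration d) :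
    ℝ≥0∞ :=
  if Γ.excess ≤ j then ENNReal.ofReal (value ψ Γ.excess Γ) else 0

/-- For ψ between 0 and 1, dropping the non-generic terms costs at most G/N, absorbed by the spare
−6G/N in the error of `abs_value_sub_avgSwitch_le`. -/
theorem value_le_mean_generic {ψ : SimpleGraph (Fin n) → ℝ} (hψ0 : ∀ G, 0 ≤ ψ G)
    (hψ1 : ∀ G, ψ G ≤ 1) {K : ℕ}
    {G : ℝ} (hG10 : 10 ≤ G) (hG : ∀ (Γ : Configuration d) b, Γ.excess ≤ K →
      ((Finset.univ.filter fun e => ¬ Γ.Generic b e).card : ℝ) ≤ G) (k : ℕ) (hk : k < K)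
    (Γ : Configuration d) (hΓ : Γ.excess = k + 1) {b : HalfEdge d} (hb : Γ.IsBad b) :
    value ψ (k + 1) Γ ≤ (∑ e ∈ Finset.univ.filter (Γ.Generic b), value ψ k (Γ.switch b e)) /
      Fintype.card (HalfEdge d) + 6 * G * 2 ^ K / Fintype.card (HalfEdge d) := by
  have hN : (0 : ℝ) < Fintype.card (HalfEdge d) := by
    exact_mod_cast Fintype.card_pos_iff.2 ⟨b⟩
  have h1 := (abs_le.1 (abs_value_sub_avgSwitch_le (fun G => abs_le.2
    ⟨by linarith [hψ0 G], hψ1 G⟩) hG10 hG k hk Γ hΓ hb)).2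
  have h2 : ∑ e, value ψ k (Γ.switch b e) ≤
      ∑ e ∈ Finset.univ.filter (Γ.Generic b), value ψ k (Γ.switch b e) + G := by
    rw [← Finset.sum_filter_add_sum_filter_not Finset.univ (Γ.Generic b)]
    gcongr
    refine le_trans ?_ (hG Γ b (by omega))
    rw [← nsmul_one]
    exact Finset.sum_le_card_nsmul _ _ _ fun e _ =>
      (value_mem_Icc le_rfl zero_le_one (fun G => ⟨hψ0 G, hψ1 G⟩) k _).2
  have h3 : (2 : ℝ) ^ (k + 1) ≤ 2 ^ K := pow_le_pow_right₀ (by norm_num) hk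
  rw [avgSwitch] at h1
  have h4 : value ψ (k + 1) Γ ≤ (∑ e, value ψ k (Γ.switch b e)) / Fintype.card (HalfEdge d) +
    6 * G * (2 ^ (k + 1) - 1) / Fintype.card (HalfEdge d) := by linarith
  refine h4.trans ?_
  rw [← add_div, ← add_div]
  refine div_le_div_of_nonneg_right ?_ hN.le
  nlinarith

end Configuration

open Configuration

/-- The capped value is almost a submartingale for every rule, by `value_le_mean_generic` at the bad
edge the rule picks. The cap drops with each step and discards histories whose excess is too large,
so nothing is needed about non-generic steps. -/
theorem cappedValue_le_step {ψ : SimpleGraph (Fin n) → ℝ} (hψ0 : ∀ G, 0 ≤ ψ G)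
    (hψ1 : ∀ G, ψ G ≤ 1) {K : ℕ}
    {G : ℝ} (hG10 : 10 ≤ G) (hG : ∀ (Γ : Configuration d) b, Γ.excess ≤ K →
      ((Finset.univ.filter fun e => ¬ Γ.Generic b e).card : ℝ) ≤ G)
    (hGN : G < Fintype.card (HalfEdge d)) (R : BadEdgeRule d) (j : ℕ) (hj : j < K)
    (H : History d) :
    cappedValue ψ (j + 1) H.current ≤ ∑' H', stepLaw R H H' * cappedValue ψ j H'.current +
      ENNReal.ofReal (6 * G * 2 ^ K / Fintype.card (HalfEdge d)) := by
  set η := ENNReal.ofReal (6 * G * 2 ^ K / Fintype.card (HalfEdge d))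
  by_cases hs : H.current.IsSimple
  · have h0 := H.current.isSimple_iff.1 hs
    rw [stepLaw, dif_pos hs, PMF.tsum_pure_mul]
    simp [cappedValue, h0]
  by_cases hx : H.current.excess ≤ j + 1
  swap
  · simp [cappedValue, hx]
  rw [stepLaw, dif_neg hs, PMF.tsum_bind_mul]
  have hmean : ∀ x : ℝ≥0∞, ∑' b, R H hs b * x = x := fun x => by
    rw [ENNReal.tsum_mul_right, PMF.tsum_coe, one_mul]
  rw [← hmean (cappedValue ψ (j + 1) H.current), ← hmean η, ← ENNReal.tsum_add]
  refine ENNReal.tsum_le_tsum fun b => ?_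
  rw [← mul_add]
  refine mul_le_mul_right ?_ _
  obtain ⟨k, hk⟩ : ∃ k, H.current.excess = k + 1 :=
    Nat.exists_eq_succ_of_ne_zero fun h => hs (H.current.isSimple_iff.2 h)
  have hsub : Finset.univ.filter (H.current.Generic b.1) ⊆ otherHalfEdges H.current b.1 := by
    intro e he
    have h1 : H.current.Generic b.1 e := (Finset.mem_filter.1 he).2
    simp [otherHalfEdges, h1.ne, h1.ne_partner]
  have hne : (otherHalfEdges H.current b.1).Nonempty := by
    refine Finset.Nonempty.mono hsub ?_
    by_contra hc
    rw [Finset.not_nonempty_iff_eq_empty, Finset.filter_eq_empty_iff] at hc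
    have h1 := hG H.current b.1 (by omega)
    rw [Finset.filter_true_of_mem fun e he => hc he, Finset.card_univ] at h1
    linarith
  rw [dif_pos hne, PMF.tsum_map_mul, PMF.tsum_uniformOfFinset_mul]
  have hNpos : (0 : ℝ) < Fintype.card (HalfEdge d) := by linarith
  have h2 := value_le_mean_generic hψ0 hψ1 hG10 hG k (by omega) H.current hk b.2
  have h3 : ∀ e, 0 ≤ value ψ k (H.current.switch b.1 e) := fun e =>
    (value_mem_Icc le_rfl zero_le_one (fun G => ⟨hψ0 G, hψ1 G⟩) k _).1
  have h4 : cappedValue ψ (j + 1) H.current ≤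
      (∑ e ∈ Finset.univ.filter (H.current.Generic b.1),
        ENNReal.ofReal (value ψ k (H.current.switch b.1 e))) / Fintype.card (HalfEdge d) + η := by
    rw [cappedValue, if_pos hx, hk]
    refine (ENNReal.ofReal_le_ofReal h2).trans (ENNReal.ofReal_add_le.trans ?_)
    rw [ENNReal.ofReal_div_of_pos hNpos, ENNReal.ofReal_natCast,
      ENNReal.ofReal_sum_of_nonneg fun e _ => h3 e]
  -- The process averages over the other half-edges only; this smaller denominator, together with
  -- the nonnegative non-generic terms, can only increase the mean.
  refine h4.trans (add_le_add_left (ENNReal.div_le_div ?_ ?_) _)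
  · refine (Finset.sum_le_sum fun e he => ?_).trans
      (Finset.sum_le_sum_of_subset hsub)
    have h5 := (Finset.mem_filter.1 he).2.excess_switch b.2
    have h6 : (H.current.switch b.1 e).excess = k := by omega
    change _ ≤ cappedValue ψ j (H.current.switch b.1 e)
    rw [cappedValue, if_pos (by omega), h6]
  · exact_mod_cast Finset.card_le_univ _

theorem cappedValue_le_process {ψ : SimpleGraph (Fin n) → ℝ} (hψ0 : ∀ G, 0 ≤ ψ G)
    (hψ1 : ∀ G, ψ G ≤ 1) {K : ℕ}
    {G : ℝ} (hG10 : 10 ≤ G) (hG : ∀ (Γ : Configuration d) b, Γ.excess ≤ K →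
      ((Finset.univ.filter fun e => ¬ Γ.Generic b e).card : ℝ) ≤ G)
    (hGN : G < Fintype.card (HalfEdge d)) (hd : Even (∑ i, d i)) (R : BadEdgeRule d) (i : ℕ)
    (hi : i ≤ K) :
    ∑' H, processLaw hd R 0 H * cappedValue ψ K H.current ≤
      ∑' H, processLaw hd R i H * cappedValue ψ (K - i) H.current +
      i * ENNReal.ofReal (6 * G * 2 ^ K / Fintype.card (HalfEdge d)) := by
  induction i with
  | zero => simp
  | succ i ih =>
    refine (ih (by omega)).trans ?_
    have h1 : K - i = (K - (i + 1)) + 1 := by omega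
    rw [show processLaw hd R (i + 1) = (processLaw hd R i).bind (stepLaw R) from rfl,
      PMF.tsum_bind_mul, h1]
    set η := ENNReal.ofReal (6 * G * 2 ^ K / Fintype.card (HalfEdge d))
    have h2 : ∑' H, processLaw hd R i H * cappedValue ψ (K - (i + 1) + 1) H.current ≤
        ∑' H, processLaw hd R i H *
          ∑' H', stepLaw R H H' * cappedValue ψ (K - (i + 1)) H'.current + η := by
      calc _ ≤ ∑' H, processLaw hd R i H *
          (∑' H', stepLaw R H H' * cappedValue ψ (K - (i + 1)) H'.current + η) :=
            ENNReal.tsum_le_tsum fun H => mul_le_mul_right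
              (cappedValue_le_step hψ0 hψ1 hG10 hG hGN R _ (by omega) H) _
        _ = _ := by
            simp only [mul_add]
            rw [ENNReal.tsum_add, ENNReal.tsum_mul_right, PMF.tsum_coe, one_mul]
    refine (add_le_add_left h2 _).trans (le_of_eq ?_)
    push_cast
    ring

/-- At cap 0 only simple configurations count, and their value is the indicator of `A` at the final
graph. -/
theorem sum_toOuterMeasure_le_sum_terminalProb (hd : Even (∑ i, d i)) (R : BadEdgeRule d)
    (A : Set (SimpleGraph (Fin n))) (K : ℕ) :
    ∑' H, processLaw hd R K H * cappedValue (A.indicator 1) 0 H.current ≤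
      ∑ G, A.indicator (terminalProb hd R) G := by
  have h1 : ∀ G, A.indicator (fun G => ∑' H, processLaw hd R K H *
      if H.current.IsSimple ∧ H.current.toGraph = G then 1 else 0) G ≤
      A.indicator (terminalProb hd R) G := by
    intro G
    refine Set.indicator_le_indicator ?_
    refine le_trans (le_of_eq ?_) (le_iSup _ K)
    rw [PMF.toOuterMeasure_apply]
    refine tsum_congr fun H => ?_
    simp [Set.indicator_apply]
  refine le_trans ?_ (Finset.sum_le_sum fun G _ => h1 G)
  have h2 : ∀ G, A.indicator (fun G => ∑' H, processLaw hd R K H *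
      if H.current.IsSimple ∧ H.current.toGraph = G then 1 else 0) G =
      ∑' H, processLaw hd R K H *
      if G ∈ A ∧ H.current.IsSimple ∧ H.current.toGraph = G then 1 else 0 := by
    intro G
    by_cases hG : G ∈ A
    · simp [hG]
    · simp [hG]
  simp only [h2]
  rw [← Summable.tsum_finsetSum fun _ _ => ENNReal.summable]
  refine ENNReal.tsum_le_tsum fun H => ?_
  rw [← Finset.mul_sum]
  refine mul_le_mul_right ?_ _
  by_cases hs : H.current.IsSimple
  · have h0 := H.current.isSimple_iff.1 hs
    by_cases hA : H.current.toGraph ∈ A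
    · refine le_trans ?_ (Finset.single_le_sum (fun _ _ => zero_le) (Finset.mem_univ
        H.current.toGraph))
      simp [cappedValue, h0, hs, hA, value]
    · simp [cappedValue, h0, hA, value]
  · have h0 : ¬ H.current.excess = 0 := fun h => hs (H.current.isSimple_iff.2 h)
    simp [cappedValue, h0]

/-- A lower bound for the probability that the process terminates in `A`. -/
theorem mean_value_le_sum_terminalProb {K : ℕ}
    {G : ℝ} (hG10 : 10 ≤ G) (hG : ∀ (Γ : Configuration d) b, Γ.excess ≤ K →
      ((Finset.univ.filter fun e => ¬ Γ.Generic b e).card : ℝ) ≤ G)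
    (hGN : G < Fintype.card (HalfEdge d)) (hd : Even (∑ i, d i)) (R : BadEdgeRule d)
    (A : Set (SimpleGraph (Fin n))) :
    ENNReal.ofReal ((∑ Γ : Configuration d, if Γ.excess ≤ K then
        value (A.indicator 1) Γ.excess Γ else 0) / Fintype.card (Configuration d)) ≤
      ∑ G, A.indicator (terminalProb hd R) G +
      ENNReal.ofReal (K * (6 * G * 2 ^ K / Fintype.card (HalfEdge d))) := by
  have hψ0 : ∀ G, 0 ≤ A.indicator (1 : SimpleGraph (Fin n) → ℝ) G :=
    fun G => Set.indicator_nonneg (fun _ _ => zero_le_one) G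
  have hψ1 : ∀ G, A.indicator (1 : SimpleGraph (Fin n) → ℝ) G ≤ 1 :=
    fun G => Set.indicator_le_self' (fun _ _ => zero_le_one) G
  have := Configuration.nonempty_of_even hd
  have h1 := cappedValue_le_process hψ0 hψ1 hG10 hG hGN hd R K le_rfl
  rw [Nat.sub_self] at h1
  have h2 := h1.trans (add_le_add_left (sum_toOuterMeasure_le_sum_terminalProb hd R A K) _)
  have hC : (0 : ℝ) < Fintype.card (Configuration d) := by
    exact_mod_cast Fintype.card_pos
  rw [ENNReal.ofReal_mul (Nat.cast_nonneg _), ENNReal.ofReal_natCast]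
  refine le_trans (le_of_eq ?_) h2
  rw [show processLaw hd R 0 = (PMF.uniformOfFintype (Configuration d)).map History.start from
    rfl, PMF.tsum_map_mul, tsum_fintype, ENNReal.ofReal_div_of_pos hC, ENNReal.ofReal_natCast,
    ENNReal.ofReal_sum_of_nonneg, ENNReal.div_eq_inv_mul, Finset.mul_sum]
  · refine Finset.sum_congr rfl fun Γ _ => ?_
    rw [PMF.uniformOfFintype_apply]
    change _ = _ * cappedValue _ _ Γ
    rw [cappedValue]
    split_ifs <;> simp
  · intro Γ _
    split_ifs
    · exact (value_mem_Icc le_rfl zero_le_one (fun G => ⟨hψ0 G, hψ1 G⟩) _ _).1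
    · exact le_rfl

end Termination

/-! ### Total variation and maximal couplings on a finite space -/

section Coupling

open scoped Classical

instance SimpleGraph.measurableSingletonClass {V : Type*} [Countable V] :
    MeasurableSingletonClass (SimpleGraph V) where
  measurableSet_singleton G := by
    have h : ({G} : Set (SimpleGraph V)) = ⋂ u, ⋂ v, {H | H.Adj u v ↔ G.Adj u v} := by
      ext H
      simp only [Set.mem_singleton_iff, Set.mem_iInter, Set.mem_ofPred_eq]
      exact ⟨fun h u v => by rw [h], fun h => SimpleGraph.ext (by ext u v; exact h u v)⟩
    rw [h]
    refine MeasurableSet.iInter fun u => MeasurableSet.iInter fun v => ?_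
    have hm : Measurable fun H : SimpleGraph V => H.Adj u v :=
      (SimpleGraph.measurable_iff_adj.1 measurable_id) u v
    exact measurableSet_setOfPred.2 (hm.iff measurable_const)

variable {α : Type*} [Fintype α] [MeasurableSpace α] [MeasurableSingletonClass α]

theorem sum_smul_dirac_apply (w : α → ℝ≥0∞) (A : Set α) :
    (Measure.sum fun x => w x • Measure.dirac x) A = ∑ x, A.indicator w x := by
  have hA : MeasurableSet A := A.toFinite.measurableSet
  rw [Measure.sum_apply _ hA, tsum_fintype]
  refine Finset.sum_congr rfl fun x _ => ?_
  rw [Measure.smul_apply, Measure.dirac_apply' _ hA]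
  by_cases hx : x ∈ A <;> simp [hx]

theorem sum_smul_dirac_singleton (w : α → ℝ≥0∞) (a : α) :
    (Measure.sum fun x => w x • Measure.dirac x) {a} = w a := by
  rw [sum_smul_dirac_apply]
  simp [Set.indicator_apply]

/-- The maximal coupling of two measures of the same mass on a finite set. -/
theorem exists_coupling (μ ν : Measure α) [IsFiniteMeasure μ] [IsFiniteMeasure ν]
    (h : μ Set.univ = ν Set.univ) :
    ∃ π : Measure (α × α), π.map Prod.fst = μ ∧ π.map Prod.snd = ν ∧
      ∀ η, (∀ A, ν A ≤ μ A + η) → π {p | p.1 ≠ p.2} ≤ η := by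
  set M := Measure.sum fun x => min (μ {x}) (ν {x}) • Measure.dirac x with hM
  set P := Measure.sum fun x => (μ {x} - ν {x}) • Measure.dirac x with hP
  set Q := Measure.sum fun x => (ν {x} - μ {x}) • Measure.dirac x with hQ
  have hMP : M + P = μ := Measure.ext_of_singleton fun a => by
    rw [Measure.add_apply, hM, hP, sum_smul_dirac_singleton, sum_smul_dirac_singleton]
    rcases le_total (μ {a}) (ν {a}) with h1 | h1
    · rw [min_eq_left h1, tsub_eq_zero_of_le h1, add_zero]
    · rw [min_eq_right h1, add_tsub_cancel_of_le h1]
  have hMQ : M + Q = ν := Measure.ext_of_singleton fun a => by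
    rw [Measure.add_apply, hM, hQ, sum_smul_dirac_singleton, sum_smul_dirac_singleton]
    rcases le_total (μ {a}) (ν {a}) with h1 | h1
    · rw [min_eq_left h1, add_tsub_cancel_of_le h1]
    · rw [min_eq_right h1, tsub_eq_zero_of_le h1, add_zero]
  have : IsFiniteMeasure M :=
    isFiniteMeasure_of_le μ (by rw [← hMP]; exact Measure.le_add_right le_rfl)
  have : IsFiniteMeasure P :=
    isFiniteMeasure_of_le μ (by rw [← hMP]; exact Measure.le_add_left le_rfl)
  have : IsFiniteMeasure Q :=
    isFiniteMeasure_of_le ν (by rw [← hMQ]; exact Measure.le_add_left le_rfl)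
  have hPQ : P Set.univ = Q Set.univ := by
    rw [← hMP, ← hMQ, Measure.add_apply, Measure.add_apply] at h
    exact (ENNReal.add_right_inj (measure_ne_top _ _)).1 h
  -- If the mass is zero its inverse is `⊤`, which is harmless as the measure itself vanishes.
  have hscale : ∀ μ' : Measure α, μ' Set.univ = P Set.univ →
      (P Set.univ)⁻¹ • (P Set.univ) • μ' = μ' := by
    intro μ' hμ'
    rw [smul_smul]
    by_cases h0 : P Set.univ = 0
    · rw [h0] at hμ'
      rw [Measure.measure_univ_eq_zero.1 hμ', smul_zero]
    · rw [ENNReal.inv_mul_cancel h0 (measure_ne_top _ _), one_smul]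
  have hdiag : Measurable fun x : α => (x, x) := measurable_id.prodMk measurable_id
  -- The common part of the two measures sits on the diagonal, and the normalised product of the two
  -- excess parts supplies the remaining mass.
  refine ⟨M.map (fun x => (x, x)) + (P Set.univ)⁻¹ • P.prod Q, ?_, ?_, fun η hη => ?_⟩
  · rw [Measure.map_add _ _ measurable_fst, Measure.map_map measurable_fst hdiag,
      Measure.map_smul, Measure.map_fst_prod, ← hPQ, hscale P rfl]
    exact (congrArg (· + P) Measure.map_id).trans hMP
  · rw [Measure.map_add _ _ measurable_snd, Measure.map_map measurable_snd hdiag,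
      Measure.map_smul, Measure.map_snd_prod, hscale Q hPQ.symm]
    exact (congrArg (· + Q) Measure.map_id).trans hMQ
  · have hmeas : MeasurableSet {p : α × α | p.1 ≠ p.2} := Set.Finite.measurableSet (Set.toFinite _)
    have h1 : (M.map fun x => (x, x)) {p : α × α | p.1 ≠ p.2} = 0 := by
      rw [Measure.map_apply hdiag hmeas]
      simp
    have h2 : (P Set.univ)⁻¹ • P.prod Q Set.univ = Q Set.univ := by
      rw [← Set.univ_prod_univ, Measure.prod_prod, smul_eq_mul, ← mul_assoc]
      by_cases h0 : P Set.univ = 0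
      · rw [← hPQ, h0, mul_zero]
      · rw [ENNReal.inv_mul_cancel h0 (measure_ne_top _ _), one_mul]
    rw [Measure.add_apply, h1, zero_add, Measure.smul_apply]
    have h3 : (P Set.univ)⁻¹ • (P.prod Q) {p : α × α | p.1 ≠ p.2} ≤ Q Set.univ := by
      rw [← h2, smul_eq_mul, smul_eq_mul]
      exact mul_le_mul_right (measure_mono (Set.subset_univ _)) _
    refine h3.trans ?_
    -- This set carries all of Q and nothing of P, so the hypothesis at `A` is precisely the bound
    -- on the mass of Q.
    set A : Set α := {x | μ {x} < ν {x}}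
    have h4 : Q Set.univ = Q A := by
      rw [hQ, sum_smul_dirac_apply, sum_smul_dirac_apply, Set.indicator_univ]
      refine Finset.sum_congr rfl fun x _ => ?_
      by_cases hx : x ∈ A
      · rw [Set.indicator_of_mem hx]
      · rw [Set.indicator_of_notMem hx]
        exact tsub_eq_zero_of_le (not_lt.1 hx)
    have h5 : P A = 0 := by
      rw [hP, sum_smul_dirac_apply]
      refine Finset.sum_eq_zero fun x _ => ?_
      by_cases hx : x ∈ A
      · rw [Set.indicator_of_mem hx]
        exact tsub_eq_zero_of_le (le_of_lt hx)
      · rw [Set.indicator_of_notMem hx]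
    have h6 := hη A
    rw [← hMQ, ← hMP, Measure.add_apply, Measure.add_apply, h5, add_zero] at h6
    rw [h4]
    exact (ENNReal.add_le_add_iff_left (measure_ne_top M A)).1 h6

theorem tvDist_nonneg {β : Type*} [MeasurableSpace β] (μ ν : Measure β) : 0 ≤ tvDist μ ν :=
  Real.iSup_nonneg fun _ => abs_nonneg _

/-- For probability measures the one-sided bound at the complement is the opposite bound at the set.
-/
theorem tvDist_le_of_forall_le {β : Type*} [MeasurableSpace β] (μ ν : Measure β)
    [IsProbabilityMeasure μ] [IsProbabilityMeasure ν] {η : ℝ} (hη : 0 ≤ η)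
    (h : ∀ A, ν A ≤ μ A + ENNReal.ofReal η) : tvDist μ ν ≤ η := by
  have key : ∀ A, ν.real A ≤ μ.real A + η := fun A => by
    have := ENNReal.toReal_mono (ENNReal.add_ne_top.2 ⟨measure_ne_top μ A, ENNReal.ofReal_ne_top⟩)
      (h A)
    rwa [ENNReal.toReal_add (measure_ne_top μ A) ENNReal.ofReal_ne_top,
      ENNReal.toReal_ofReal hη] at this
  refine Real.iSup_le (fun A => ?_) hη
  have h1 := key A.1
  have h2 := key A.1ᶜ
  rw [probReal_compl_eq_one_sub A.2, probReal_compl_eq_one_sub A.2] at h2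
  rw [abs_le]
  constructor <;> linarith

end Coupling

/-! ### Configurations projecting to a given simple graph -/

section Fibres

open scoped Classical

namespace Configuration

variable {n : ℕ} {d : Fin n → ℕ}

/-- A simple configuration matches the half-edges at a vertex with its neighbours. -/
noncomputable def neighborEquiv (Γ : Configuration d) (hs : Γ.IsSimple) (i : Fin n) :
    Fin (d i) ≃ Γ.toGraph.neighborSet i :=
  Equiv.ofBijective (fun a => ⟨(Γ.1 ⟨i, a⟩).1, by
    rw [SimpleGraph.mem_neighborSet, toGraph_adj]
    exact ⟨fun h => hs ⟨i, a⟩ (Or.inl h.symm), ⟨i, a⟩, rfl⟩⟩) (by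
    constructor
    · intro a b hab
      have hab' : (Γ.1 ⟨i, a⟩).1 = (Γ.1 ⟨i, b⟩).1 := congrArg Subtype.val hab
      by_contra hne
      refine hs ⟨i, b⟩ ((Γ.isBad_iff _).2 (Or.inr ⟨⟨i, a⟩, fun h => hne ?_, ?_⟩))
      · simpa using h
      · simp [ends, hab']
    · rintro ⟨j, hj⟩
      rw [SimpleGraph.mem_neighborSet, toGraph_adj] at hj
      obtain ⟨_, ⟨i', a⟩, hh⟩ := hj
      have h1 : i' = i := congrArg Prod.fst hh
      subst h1
      exact ⟨a, Subtype.ext (congrArg Prod.snd hh)⟩)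

theorem degree_toGraph (Γ : Configuration d) (hs : Γ.IsSimple) (i : Fin n) :
    Γ.toGraph.degree i = d i := by
  rw [← SimpleGraph.card_neighborSet_eq_degree, ← Fintype.card_congr (Γ.neighborEquiv hs i),
    Fintype.card_fin]

theorem eq_of_forall_neighbor_eq {Γ Δ : Configuration d} (hs : Γ.IsSimple)
    (h : ∀ x, (Γ.1 x).1 = (Δ.1 x).1) : Γ = Δ := by
  apply config_ext
  intro x
  by_contra hne
  refine hs (Γ.1 x) ((Γ.isBad_iff _).2 (Or.inr ⟨Δ.1 x, fun h1 => hne h1.symm, ?_⟩))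
  refine Prod.ext (h x).symm ?_
  change (Γ.1 (Δ.1 x)).1 = (Γ.1 (Γ.1 x)).1
  rw [h (Δ.1 x), partner_partner, partner_partner]

theorem exists_of_neighborEquiv (G : SimpleGraph (Fin n))
    (φ : ∀ i, Fin (d i) ≃ G.neighborSet i) :
    ∃ Γ : Configuration d, Γ.IsSimple ∧ Γ.toGraph = G ∧ ∀ x, (Γ.1 x).1 = φ x.1 x.2 := by
  have hadj : ∀ x : HalfEdge d, G.Adj x.1 (φ x.1 x.2) := fun x => (φ x.1 x.2).2
  set p : HalfEdge d → HalfEdge d := fun x =>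
    ⟨φ x.1 x.2, (φ (φ x.1 x.2)).symm ⟨x.1, (hadj x).symm⟩⟩ with hp
  have hp1 : ∀ x, (p x).1 = φ x.1 x.2 := fun x => rfl
  have hp2 : ∀ x, ((φ (p x).1 (p x).2 : G.neighborSet (p x).1) : Fin n) = x.1 := fun x => by
    change ((φ _ ((φ (φ x.1 x.2)).symm ⟨x.1, (hadj x).symm⟩) : G.neighborSet _) : Fin n) = x.1
    rw [Equiv.apply_symm_apply]
  have heq : ∀ x y : HalfEdge d, x.1 = y.1 →
      ((φ x.1 x.2 : G.neighborSet x.1) : Fin n) = φ y.1 y.2 → x = y := by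
    rintro ⟨i, a⟩ ⟨j, b⟩ hij hab
    obtain rfl : i = j := hij
    have hab' : a = b := (φ i).injective (Subtype.ext hab)
    rw [hab']
  have hpp : ∀ x, p (p x) = x := fun x => heq _ _ (by rw [hp1, hp2]) (by rw [hp2, hp1])
  have hne : ∀ x, p x ≠ x := fun x h => (hadj x).ne (by rw [← hp1, h])
  set Γ : Configuration d := ⟨⟨p, p, hpp, hpp⟩, fun x => ⟨hpp x, hne x⟩⟩
  have hΓ : ∀ x, Γ.1 x = p x := fun x => rfl
  refine ⟨Γ, fun x hx => ?_, ?_, fun x => rfl⟩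
  · rcases (Γ.isBad_iff x).1 hx with h | ⟨y, h1, h2⟩
    · exact (hadj x).ne h.symm
    · exact h1 (heq y x (congrArg Prod.fst h2) (congrArg Prod.snd h2))
  · ext i j
    rw [toGraph_adj]
    constructor
    · rintro ⟨_, x, hx⟩
      have h1 : x.1 = i := congrArg Prod.fst hx
      have h2 : ((φ x.1 x.2 : G.neighborSet x.1) : Fin n) = j := congrArg Prod.snd hx
      rw [← h1, ← h2]
      exact hadj x
    · intro hij
      refine ⟨hij.ne, ⟨i, (φ i).symm ⟨j, hij⟩⟩, ?_⟩
      simp [ends, hΓ, hp]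

/-- Such a configuration amounts to a bijection, at each vertex, from its half-edges to its
neighbours; these can be chosen freely. The count does not depend on the graph, so a uniform simple
configuration projects to a uniform graph. -/
theorem card_fibre (G : SimpleGraph (Fin n)) (hG : ∀ i, G.degree i = d i) :
    (Finset.univ.filter fun Γ : Configuration d => Γ.IsSimple ∧ Γ.toGraph = G).card =
      ∏ i, (d i).factorial := by
  have h1 : Fintype.card (∀ i, Fin (d i) ≃ G.neighborSet i) = ∏ i, (d i).factorial := by
    rw [Fintype.card_pi]
    refine Finset.prod_congr rfl fun i _ => ?_
    rw [Fintype.card_equiv (Fintype.equivOfCardEq (by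
      rw [SimpleGraph.card_neighborSet_eq_degree, hG, Fintype.card_fin])), Fintype.card_fin]
  rw [← h1, ← Finset.card_univ]
  choose F hF1 hF2 hF3 using fun φ : ∀ i, Fin (d i) ≃ G.neighborSet i =>
    exists_of_neighborEquiv G φ
  symm
  refine Finset.card_bij (fun φ _ => F φ) (fun φ _ => by simp [hF1, hF2]) ?_ ?_
  · intro φ _ φ' _ hφ
    funext i
    ext a
    have e1 := hF3 φ ⟨i, a⟩
    have e2 := hF3 φ' ⟨i, a⟩
    rw [hφ, e2] at e1
    exact congrArg Fin.val e1.symm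
  · intro Γ hΓ
    obtain ⟨hs, rfl⟩ := (Finset.mem_filter.1 hΓ).2
    refine ⟨fun i => Γ.neighborEquiv hs i, Finset.mem_univ _, ?_⟩
    refine eq_of_forall_neighbor_eq (hF1 _) fun x => ?_
    rw [hF3]
    rfl

/-- The simple graphs with degree sequence `d`. -/
noncomputable def graphs (d : Fin n → ℕ) : Finset (SimpleGraph (Fin n)) :=
  Finset.univ.filter fun G => ∀ i, G.degree i = d i

theorem sum_isSimple_eq (ψ : SimpleGraph (Fin n) → ℝ) :
    (∑ Γ : Configuration d, if Γ.IsSimple then ψ Γ.toGraph else 0) =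
      (∏ i, (d i).factorial : ℕ) * ∑ G ∈ graphs d, ψ G := by
  rw [← Finset.sum_filter, Finset.mul_sum,
    ← Finset.sum_fiberwise_of_maps_to (t := graphs d) (g := fun Γ => Γ.toGraph)]
  · refine Finset.sum_congr rfl fun G hG => ?_
    rw [Finset.filter_filter, ← card_fibre G (Finset.mem_filter.1 hG).2, ← nsmul_eq_mul,
      ← Finset.sum_const]
    exact Finset.sum_congr rfl fun Γ hΓ => by rw [(Finset.mem_filter.1 hΓ).2.2]
  · intro Γ hΓ
    exact Finset.mem_filter.2 ⟨Finset.mem_univ _, Γ.degree_toGraph (Finset.mem_filter.1 hΓ).2⟩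

theorem graphs_nonempty_iff :
    (graphs d).Nonempty ↔ ∃ Γ : Configuration d, Γ.IsSimple := by
  constructor
  · rintro ⟨G, hG⟩
    have h1 := card_fibre (d := d) G (Finset.mem_filter.1 hG).2
    have h2 : 0 < ∏ i, (d i).factorial := Finset.prod_pos fun i _ => Nat.factorial_pos _
    rw [← h1, Finset.card_pos] at h2
    obtain ⟨Γ, hΓ⟩ := h2
    exact ⟨Γ, (Finset.mem_filter.1 hΓ).2.1⟩
  · rintro ⟨Γ, hΓ⟩
    exact ⟨Γ.toGraph, Finset.mem_filter.2 ⟨Finset.mem_univ _, Γ.degree_toGraph hΓ⟩⟩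

end Configuration

end Fibres

/-! ### The two laws and their total masses -/

section Laws

open scoped Classical

variable {n : ℕ} {d : Fin n → ℕ}

open Configuration

theorem uniformLaw_eq (d : Fin n → ℕ) : uniformLaw d = uniformOn (graphs d : Set _) := by
  rw [uniformLaw]
  congr 1
  ext G
  simp [graphs]

theorem uniformLaw_apply (A : Set (SimpleGraph (Fin n))) :
    uniformLaw d A = ENNReal.ofReal ((∑ G ∈ graphs d, A.indicator 1 G) / (graphs d).card) := by
  have h1 : A = (A.toFinset : Set _) := by simp
  rw [uniformLaw_eq]
  conv_lhs => rw [h1]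
  rw [uniformOn_apply_finset]
  have h2 : ∑ G ∈ graphs d, A.indicator (1 : SimpleGraph (Fin n) → ℝ) G =
      ((graphs d ∩ A.toFinset).card : ℝ) := by
    rw [← Finset.filter_mem_eq_inter, Finset.card_filter, Nat.cast_sum]
    simp [Set.indicator_apply]
  rw [h2]
  rcases Nat.eq_zero_or_pos (graphs d).card with h0 | h0
  · rw [Finset.card_eq_zero] at h0
    simp [h0]
  · rw [ENNReal.ofReal_div_of_pos (by exact_mod_cast h0), ENNReal.ofReal_natCast,
      ENNReal.ofReal_natCast]

theorem terminalSet_disjoint_sum_le (hd : Even (∑ i, d i)) (R : BadEdgeRule d) (k : ℕ) :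
    ∑ G : SimpleGraph (Fin n), (processLaw hd R k).toOuterMeasure
      {H | H.current.IsSimple ∧ H.current.toGraph = G} ≤ 1 := by
  simp only [PMF.toOuterMeasure_apply]
  rw [← Summable.tsum_finsetSum fun _ _ => ENNReal.summable, ← PMF.tsum_coe (processLaw hd R k)]
  refine ENNReal.tsum_le_tsum fun H => ?_
  by_cases hs : H.current.IsSimple
  · simp [Set.indicator_apply, hs]
  · simp [hs]

/-- The process stops at simple configurations. Monotonicity lets the supremum over time be
exchanged with the finite sum over graphs. -/
theorem monotone_process_terminal (hd : Even (∑ i, d i)) (R : BadEdgeRule d)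
    (G : SimpleGraph (Fin n)) : Monotone fun k => (processLaw hd R k).toOuterMeasure
      {H | H.current.IsSimple ∧ H.current.toGraph = G} := by
  refine monotone_nat_of_le_succ fun k => ?_
  have h1 : ∀ p : PMF (History d), p.toOuterMeasure
      {H | H.current.IsSimple ∧ H.current.toGraph = G} =
      ∑' H, p H * if H.current.IsSimple ∧ H.current.toGraph = G then 1 else 0 := by
    intro p
    rw [PMF.toOuterMeasure_apply]
    exact tsum_congr fun H => by simp [Set.indicator_apply]
  rw [h1, h1, show processLaw hd R (k + 1) = (processLaw hd R k).bind (stepLaw R) from rfl,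
    PMF.tsum_bind_mul]
  refine ENNReal.tsum_le_tsum fun H => mul_le_mul_right ?_ _
  by_cases hs : H.current.IsSimple
  · rw [stepLaw, dif_pos hs, PMF.tsum_pure_mul]
  · simp [hs]

theorem sum_terminalProb_le_one (hd : Even (∑ i, d i)) (R : BadEdgeRule d) :
    ∑ G, terminalProb hd R G ≤ 1 := by
  unfold terminalProb
  rw [ENNReal.finsetSum_iSup_of_monotone fun G => monotone_process_terminal hd R G]
  exact iSup_le fun k => terminalSet_disjoint_sum_le hd R k

theorem terminalProb_pos (hd : Even (∑ i, d i)) (R : BadEdgeRule d) {Γ : Configuration d}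
    (hΓ : Γ.IsSimple) : terminalProb hd R Γ.toGraph ≠ 0 := by
  have := Configuration.nonempty_of_even hd
  refine ne_of_gt (lt_of_lt_of_le ?_ (le_iSup _ 0))
  rw [pos_iff_ne_zero, ne_eq, PMF.toOuterMeasure_apply_eq_zero_iff, Set.not_disjoint_iff]
  refine ⟨History.start Γ, ?_, hΓ, rfl⟩
  rw [show processLaw hd R 0 = (PMF.uniformOfFintype (Configuration d)).map History.start from
    rfl, PMF.mem_support_map_iff]
  exact ⟨Γ, by simp, rfl⟩

theorem terminalProb_eq_zero (hd : Even (∑ i, d i)) (R : BadEdgeRule d)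
    (h : ¬ ∃ Γ : Configuration d, Γ.IsSimple) (G : SimpleGraph (Fin n)) :
    terminalProb hd R G = 0 := by
  unfold terminalProb
  rw [ENNReal.iSup_eq_zero]
  intro k
  rw [PMF.toOuterMeasure_apply_eq_zero_iff, Set.disjoint_right]
  exact fun H hH => absurd ⟨_, hH.1⟩ h

/-- The first attempt is the term `j = 0` of the series; restarts only add mass, so a lower bound
can ignore them. -/
theorem sum_terminalProb_le_switchedLaw (hd : Even (∑ i, d i)) (R : BadEdgeRule d)
    (A : Set (SimpleGraph (Fin n))) :
    ∑ G, A.indicator (terminalProb hd R) G ≤ switchedLaw hd R A := by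
  rw [switchedLaw, sum_smul_dirac_apply]
  refine Finset.sum_le_sum fun G _ => Set.indicator_le_indicator ?_
  refine le_trans (le_of_eq ?_) (ENNReal.le_tsum 0)
  simp

/-- Summing the geometric series gives mass one as soon as an attempt can succeed, and it can if a
simple configuration exists, since the initial one may be simple. Otherwise both laws are zero.
Equal masses in all cases allow a coupling for every `n`. -/
theorem switchedLaw_univ (hd : Even (∑ i, d i)) (R : BadEdgeRule d) :
    switchedLaw hd R Set.univ = uniformLaw d Set.univ ∧
      ((∃ Γ : Configuration d, Γ.IsSimple) → switchedLaw hd R Set.univ = 1) ∧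
      switchedLaw hd R Set.univ ≤ 1 := by
  have h0 : switchedLaw hd R Set.univ =
      (1 - failureProb hd R)⁻¹ * ∑ G, terminalProb hd R G := by
    rw [switchedLaw, sum_smul_dirac_apply, Set.indicator_univ]
    simp only [ENNReal.tsum_mul_right, ENNReal.tsum_geometric, Finset.mul_sum]
  have hT := sum_terminalProb_le_one hd R
  have h1 : 1 - failureProb hd R = ∑ G, terminalProb hd R G :=
    ENNReal.sub_sub_cancel ENNReal.one_ne_top hT
  rw [h1] at h0
  by_cases h : ∃ Γ : Configuration d, Γ.IsSimple
  · have h2 : ∑ G, terminalProb hd R G ≠ 0 := by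
      obtain ⟨Γ, hΓ⟩ := h
      intro h3
      rw [Finset.sum_eq_zero_iff] at h3
      exact terminalProb_pos hd R hΓ (h3 _ (Finset.mem_univ _))
    rw [ENNReal.inv_mul_cancel h2 (ne_top_of_le_ne_top ENNReal.one_ne_top hT)] at h0
    have h3 : uniformLaw d Set.univ = 1 := by
      rw [uniformLaw_eq]
      exact uniformOn_of_univ (Finset.finite_toSet _)
        (Finset.coe_nonempty.2 (graphs_nonempty_iff.2 h))
    exact ⟨h0.trans h3.symm, fun _ => h0, h0.le⟩
  · have h2 : ∑ G, terminalProb hd R G = 0 :=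
      Finset.sum_eq_zero fun G _ => terminalProb_eq_zero hd R h G
    rw [h2, mul_zero] at h0
    have h3 : uniformLaw d Set.univ = 0 := by
      have : graphs d = ∅ := by
        rw [← Finset.not_nonempty_iff_eq_empty, graphs_nonempty_iff]; exact h
      rw [uniformLaw_eq, this]
      simp
    exact ⟨h0.trans h3.symm, fun h4 => absurd h4 h, by rw [h0]; exact zero_le_one⟩

end Laws

/-! ### Quantitative comparison of the two laws -/

section Comparison

open scoped Classical

theorem abs_le_of_recursion {S : ℕ → ℝ} {l E : ℝ} {J : ℕ} (hl : 0 ≤ l) (hE : 0 ≤ E)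
    (h0 : S 0 = 0) (h : ∀ k < J, |4 * (k + 1) * S (k + 1) - l * S k| ≤ E) (k : ℕ) (hk : k ≤ J) :
    |S k| ≤ k * ((1 + l) ^ k * E) := by
  induction k with
  | zero => simp [h0]
  | succ k ih =>
    have h1 := ih (by omega)
    have h2 := abs_le.1 (h k (by omega))
    have h3 : |4 * (k + 1) * S (k + 1)| ≤ l * |S k| + E := by
      have h4 : |l * S k| = l * |S k| := by rw [abs_mul, abs_of_nonneg hl]
      have h5 := abs_le.1 h4.le
      rw [abs_le]; constructor <;> linarith
    rw [abs_mul, abs_of_nonneg (by positivity : (0 : ℝ) ≤ 4 * (k + 1))] at h3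
    have h4 : |S (k + 1)| ≤ 4 * (k + 1) * |S (k + 1)| := by
      have : (0 : ℝ) ≤ k * |S (k + 1)| := by positivity
      nlinarith [abs_nonneg (S (k + 1))]
    have h5 : 1 ≤ (1 + l) ^ (k + 1) := one_le_pow₀ (by linarith)
    have h6 : l * (k * ((1 + l) ^ k * E)) ≤ k * ((1 + l) ^ (k + 1) * E) := by
      rw [pow_succ]
      have : (0 : ℝ) ≤ k * ((1 + l) ^ k * E) := by positivity
      nlinarith
    push_cast
    nlinarith [mul_le_mul_of_nonneg_left h1 hl]

variable {n : ℕ} {d : Fin n → ℕ}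

namespace Configuration

theorem sum_capped_eq_sum_stratumSum (ψ : SimpleGraph (Fin n) → ℝ) (J : ℕ) :
    (∑ Γ : Configuration d, if Γ.excess ≤ J then value ψ Γ.excess Γ else 0) =
      ∑ k ∈ Finset.range (J + 1), stratumSum d ψ k := by
  simp only [stratumSum]
  rw [Finset.sum_comm]
  refine Finset.sum_congr rfl fun Γ _ => ?_
  rw [Finset.sum_ite_eq (Finset.range (J + 1)) Γ.excess fun k => value ψ k Γ]
  simp only [Finset.mem_range, Nat.lt_succ_iff]

theorem stratumSum_zero (ψ : SimpleGraph (Fin n) → ℝ) :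
    stratumSum d ψ 0 = (∏ i, (d i).factorial : ℕ) * ∑ G ∈ graphs d, ψ G := by
  rw [← sum_isSimple_eq, stratumSum]
  simp only [isSimple_iff, value]

theorem card_halfEdge (d : Fin n → ℕ) : Fintype.card (HalfEdge d) = ∑ i, d i := by
  simp [HalfEdge, Fintype.card_sigma]

theorem pairCount_le (d : Fin n → ℕ) : pairCount d ≤ ∑ i, (d i : ℝ) ^ 2 := by
  rw [pairCount, Fintype.sum_sigma]
  refine Finset.sum_le_sum fun i _ => ?_
  simp only [freeDegree, Finset.sum_const, Finset.card_univ, Fintype.card_fin, nsmul_eq_mul]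
  nlinarith [(Nat.cast_nonneg (d i) : (0 : ℝ) ≤ d i)]

theorem sum_cube_le {D : ℕ} (hD : ∀ i, d i ≤ D) :
    ∑ i, (d i : ℝ) ^ 3 ≤ D * ∑ i, (d i : ℝ) ^ 2 := by
  rw [Finset.mul_sum]
  refine Finset.sum_le_sum fun i _ => ?_
  have : (d i : ℝ) ≤ D := by exact_mod_cast hD i
  rw [pow_succ']
  exact mul_le_mul_of_nonneg_right this (by positivity)

theorem card_excess_gt_le (J : ℕ) :
    (∑ Γ : Configuration d, if Γ.excess ≤ J then (0 : ℝ) else 1) ≤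
      (∑ Γ : Configuration d, (Γ.excess : ℝ)) / (J + 1) := by
  rw [Finset.sum_div]
  refine Finset.sum_le_sum fun Γ _ => ?_
  split_ifs with h
  · positivity
  · rw [le_div_iff₀ (by positivity)]
    have : J + 1 ≤ Γ.excess := by omega
    rw [one_mul]
    exact_mod_cast this

end Configuration

open Configuration

/-- A bound for the distance of the two laws, where `x` stands for the ratio of the squared maximum
degree to the number of half-edges, and `y` for the inverse of the latter. -/
noncomputable def errorBound (κ : ℝ) (J : ℕ) (x y : ℝ) : ℝ :=
  (2 * κ + 4 * κ ^ 2) / (J + 1) +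
  (J + 1) * (J * ((1 + (2 * κ + κ ^ 2)) ^ J *
    ((4 * ↑(J + 1) + 16 * ↑(J + 1) ^ 2) * (8 * κ ^ 2 * x) +
    (4 * ↑(J + 1) + 16 * ↑(J + 1) ^ 2) * (6 * ((10 + 4 * ↑(J + 1)) * y + 4 * x) * 2 ^ (J + 1)) +
    (4 * ↑(J + 1) + 16 * ↑(J + 1) ^ 2) * ((10 + 4 * ↑(J + 1)) * y + 4 * x) +
    (√((5 * κ ^ 2 + κ ^ 3) * x) + 2 * ↑(J + 1) * x)))) +
  J * (6 * ((10 + 4 * ↑(J + 1)) * y + 4 * x) * 2 ^ J)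

theorem card_not_generic_le_of_excess {D : ℕ} (hD : ∀ i, d i ≤ D) (K : ℕ)
    (Γ : Configuration d) (b : HalfEdge d) (h : Γ.excess ≤ K) :
    ((Finset.univ.filter fun e => ¬ Γ.Generic b e).card : ℝ) ≤ 10 + 4 * K + 4 * (D : ℝ) ^ 2 := by
  have h1 := card_not_generic_le hD Γ b
  have h2 := Γ.two_mul_excess
  have h3 : D ≤ D * D := Nat.le_mul_self D
  have h4 : (Finset.univ.filter fun e => ¬ Γ.Generic b e).card ≤ 10 + 4 * K + 4 * D ^ 2 := by
    rw [sq]; omega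
  exact_mod_cast h4

theorem abs_stratumSum_succ_sub_le_of_bounds {D : ℕ} (hD : ∀ i, d i ≤ D)
    (hN : 10 ≤ Fintype.card (HalfEdge d)) {κ : ℝ}
    (hκ : ∑ i, (d i : ℝ) ^ 2 ≤ κ * Fintype.card (HalfEdge d)) (J : ℕ) {x y g : ℝ}
    (hx : x = (D : ℝ) ^ 2 / Fintype.card (HalfEdge d)) (hy : y = 1 / Fintype.card (HalfEdge d))
    (hg : g = (10 + 4 * ↑(J + 1)) * y + 4 * x)
    {ψ : SimpleGraph (Fin n) → ℝ} (hψ : ∀ G, |ψ G| ≤ 1) {τ : ℝ}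
    (hτ : τ = pairCount d ^ 2 / Fintype.card (HalfEdge d)) (k : ℕ) (hk : k < J) :
    |4 * (k + 1) * stratumSum d ψ (k + 1) -
      (2 * pairCount d + τ) / Fintype.card (HalfEdge d) * stratumSum d ψ k| ≤
    ((4 * ↑(J + 1) + 16 * ↑(J + 1) ^ 2) * (8 * κ ^ 2 * x) +
    (4 * ↑(J + 1) + 16 * ↑(J + 1) ^ 2) * (6 * g * 2 ^ (J + 1)) +
    (4 * ↑(J + 1) + 16 * ↑(J + 1) ^ 2) * g +
    (√((5 * κ ^ 2 + κ ^ 3) * x) + 2 * ↑(J + 1) * x)) * Fintype.card (Configuration d) := by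
  have hN' : (0 : ℝ) < Fintype.card (HalfEdge d) := by
    have : 0 < Fintype.card (HalfEdge d) := by omega
    exact_mod_cast this
  have hG := card_not_generic_le_of_excess hD (J + 1)
  have hG10 : (10 : ℝ) ≤ 10 + 4 * ↑(J + 1) + 4 * (D : ℝ) ^ 2 := by
    have : (0 : ℝ) ≤ 4 * ↑(J + 1) + 4 * (D : ℝ) ^ 2 := by positivity
    linarith
  have hgN : (10 + 4 * ↑(J + 1) + 4 * (D : ℝ) ^ 2) / Fintype.card (HalfEdge d) = g := by
    rw [hg, hx, hy]; field_simp
  have hg0 : 0 ≤ g := by rw [← hgN]; positivity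
  refine (abs_stratumSum_succ_sub_le hψ hD hG10 hG k (by omega) τ).trans ?_
  have hP0 := pairCount_nonneg (d := d)
  have hP := (pairCount_le d).trans hκ
  set N : ℝ := ((Fintype.card (HalfEdge d) : ℕ) : ℝ)
  set C : ℝ := ((Fintype.card (Configuration d) : ℕ) : ℝ)
  have hC0 : 0 ≤ C := Nat.cast_nonneg _
  set W : ℝ := 4 * ↑(J + 1) + 16 * ↑(J + 1) ^ 2
  have hW : 0 ≤ W := by positivity
  have hκ0 : 0 ≤ κ := by
    have h1 : 0 ≤ κ * N := le_trans (by positivity) hκ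
    exact nonneg_of_mul_nonneg_left h1 hN'
  have hDD : (D : ℝ) ≤ (D : ℝ) ^ 2 := by exact_mod_cast Nat.le_self_pow (by norm_num) D
  have t1 : ((Finset.univ.filter fun Γ : Configuration d => Γ.HasTriple).card : ℝ) ≤
      8 * κ ^ 2 * x * C := by
    refine (card_hasTriple_le hN).trans ?_
    have h1 : ∑ i, (d i : ℝ) ^ 3 ≤ D * (κ * N) :=
      (sum_cube_le hD).trans (mul_le_mul_of_nonneg_left hκ (Nat.cast_nonneg _))
    have h2 : (∑ i, (d i : ℝ) ^ 3) ^ 2 ≤ (D * (κ * N)) ^ 2 :=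
      pow_le_pow_left₀ (Finset.sum_nonneg fun _ _ => by positivity) h1 2
    refine mul_le_mul_of_nonneg_right ?_ hC0
    calc _ ≤ (D * (κ * N)) ^ 2 * (2 / N) ^ 3 := mul_le_mul_of_nonneg_right h2 (by positivity)
      _ = _ := by rw [hx]; field_simp; ring
  -- Here K = J + 1, so that the recursion is available for all k < J; g bounds the proportion of
  -- non-generic half-edges.
  have t2 : 6 * (10 + 4 * ↑(J + 1) + 4 * (D : ℝ) ^ 2) * (2 ^ (k + 1) - 1) / N ≤
      6 * g * 2 ^ (J + 1) := by
    rw [← hgN]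
    have h1 : (2 : ℝ) ^ (k + 1) ≤ 2 ^ (J + 1) := pow_le_pow_right₀ (by norm_num) (by omega)
    have h2 : (2 : ℝ) ^ (k + 1) - 1 ≤ 2 ^ (J + 1) := by linarith
    calc _ = 6 * ((10 + 4 * ↑(J + 1) + 4 * (D : ℝ) ^ 2) / N) * (2 ^ (k + 1) - 1) := by ring
      _ ≤ _ := mul_le_mul_of_nonneg_left h2 (by positivity)
  have t4 : ∑ Γ : Configuration d, |Γ.doublingCount - τ| ≤
      C * (√((5 * κ ^ 2 + κ ^ 3) * x) * N) := by
    refine (sum_abs_doublingCount_deviation_le hD hτ).trans (mul_le_mul_of_nonneg_left ?_ hC0)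
    have h1 : τ ≤ κ ^ 2 * N := by
      rw [hτ, div_le_iff₀ hN']
      calc pairCount d ^ 2 ≤ (κ * N) ^ 2 := pow_le_pow_left₀ hP0 hP 2
        _ = _ := by ring
    have h2 : pairCount d * (5 * pairCount d * (D : ℝ) ^ 2 + D * τ) / N ≤
        (5 * κ ^ 2 + κ ^ 3) * x * N ^ 2 := by
      rw [div_le_iff₀ hN']
      have h3 : 5 * pairCount d * (D : ℝ) ^ 2 ≤ 5 * (κ * N) * (D : ℝ) ^ 2 := by gcongr
      have h4 : D * τ ≤ (D : ℝ) ^ 2 * (κ ^ 2 * N) :=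
        (mul_le_mul_of_nonneg_left h1 (Nat.cast_nonneg _)).trans
          (mul_le_mul_of_nonneg_right hDD (by positivity))
      calc pairCount d * (5 * pairCount d * (D : ℝ) ^ 2 + D * τ) ≤
            pairCount d * (5 * (κ * N) * (D : ℝ) ^ 2 + (D : ℝ) ^ 2 * (κ ^ 2 * N)) :=
            mul_le_mul_of_nonneg_left (add_le_add h3 h4) hP0
        _ ≤ κ * N * (5 * (κ * N) * (D : ℝ) ^ 2 + (D : ℝ) ^ 2 * (κ ^ 2 * N)) :=
            mul_le_mul_of_nonneg_right hP (by positivity)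
        _ = _ := by rw [hx]; field_simp
    refine (Real.sqrt_le_sqrt h2).trans (le_of_eq ?_)
    rw [Real.sqrt_mul' _ (by positivity), Real.sqrt_sq hN'.le]
  have t5 : (∑ Γ : Configuration d, |Γ.doublingCount - τ| + C * (2 * ↑(J + 1) * (D : ℝ) ^ 2)) / N ≤
      C * (√((5 * κ ^ 2 + κ ^ 3) * x) + 2 * ↑(J + 1) * x) := by
    rw [div_le_iff₀ hN']
    have : x * N = (D : ℝ) ^ 2 := by rw [hx]; field_simp
    rw [← this]
    linarith
  rw [hgN]
  have u1 := mul_le_mul_of_nonneg_left t1 hW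
  have u2 := mul_le_mul_of_nonneg_left (mul_le_mul_of_nonneg_left t2 hW) hC0
  refine (add_le_add (add_le_add (add_le_add u1 u2) le_rfl) t5).trans (le_of_eq ?_)
  ring

/-- For centred ψ the recursion starts at zero, so each of the J + 1 strata sums is only an
accumulated error. The ratio λ is at most 2κ + κ². -/
theorem neg_le_sum_capped_value {D : ℕ} (hD : ∀ i, d i ≤ D)
    (hN : 10 ≤ Fintype.card (HalfEdge d)) {κ : ℝ}
    (hκ : ∑ i, (d i : ℝ) ^ 2 ≤ κ * Fintype.card (HalfEdge d)) (J : ℕ) {x y g E : ℝ}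
    (hx : x = (D : ℝ) ^ 2 / Fintype.card (HalfEdge d)) (hy : y = 1 / Fintype.card (HalfEdge d))
    (hg : g = (10 + 4 * ↑(J + 1)) * y + 4 * x)
    (hE : E = (4 * ↑(J + 1) + 16 * ↑(J + 1) ^ 2) * (8 * κ ^ 2 * x) +
    (4 * ↑(J + 1) + 16 * ↑(J + 1) ^ 2) * (6 * g * 2 ^ (J + 1)) +
    (4 * ↑(J + 1) + 16 * ↑(J + 1) ^ 2) * g +
    (√((5 * κ ^ 2 + κ ^ 3) * x) + 2 * ↑(J + 1) * x))
    (hE0 : 0 ≤ E) {ψ : SimpleGraph (Fin n) → ℝ} (hψ : ∀ G, |ψ G| ≤ 1)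
    (hS0 : ∑ G ∈ graphs d, ψ G = 0) :
    -((J + 1) * (J * ((1 + (2 * κ + κ ^ 2)) ^ J * (E * Fintype.card (Configuration d))))) ≤
      ∑ Γ : Configuration d, if Γ.excess ≤ J then value ψ Γ.excess Γ else 0 := by
  have hN' : (0 : ℝ) < Fintype.card (HalfEdge d) := by
    have : 0 < Fintype.card (HalfEdge d) := by omega
    exact_mod_cast this
  have hP0 := pairCount_nonneg (d := d)
  have hP := (pairCount_le d).trans hκ
  have hκ0 : 0 ≤ κ := nonneg_of_mul_nonneg_left (le_trans (by positivity) hκ) hN'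
  set τ : ℝ := pairCount d ^ 2 / Fintype.card (HalfEdge d) with hτ
  set l : ℝ := (2 * pairCount d + τ) / Fintype.card (HalfEdge d) with hl
  have hl0 : 0 ≤ l := by positivity
  have hl1 : l ≤ 2 * κ + κ ^ 2 := by
    rw [hl, div_le_iff₀ hN', hτ]
    have h1 : pairCount d ^ 2 / Fintype.card (HalfEdge d) ≤
        κ ^ 2 * Fintype.card (HalfEdge d) := by
      rw [div_le_iff₀ hN']
      calc pairCount d ^ 2 ≤ (κ * Fintype.card (HalfEdge d)) ^ 2 := pow_le_pow_left₀ hP0 hP 2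
        _ = _ := by ring
    linarith
  have hS : ∀ k ∈ Finset.range (J + 1), -(J * ((1 + (2 * κ + κ ^ 2)) ^ J *
      (E * Fintype.card (Configuration d)))) ≤ stratumSum d ψ k := by
    intro k hk
    have hk' : k ≤ J := Nat.lt_succ_iff.1 (Finset.mem_range.1 hk)
    have h5 : 0 ≤ E * Fintype.card (Configuration d) := mul_nonneg hE0 (Nat.cast_nonneg _)
    have h1 := abs_le_of_recursion (S := stratumSum d ψ) hl0 h5
      (by rw [stratumSum_zero, hS0, mul_zero])
      (fun k hk => (abs_stratumSum_succ_sub_le_of_bounds hD hN hκ J hx hy hg hψ hτ k hk).trans_eq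
        (by rw [hE])) k hk'
    generalize E * (Fintype.card (Configuration d) : ℝ) = B at *
    have h3 : (1 + l) ^ k ≤ (1 + (2 * κ + κ ^ 2)) ^ J :=
      (pow_le_pow_left₀ (by positivity) (by linarith) k).trans
        (pow_le_pow_right₀ (by linarith [hl0.trans hl1]) hk')
    have h4 : (k : ℝ) ≤ J := by exact_mod_cast hk'
    have h2 : (k : ℝ) * ((1 + l) ^ k * B) ≤ J * ((1 + (2 * κ + κ ^ 2)) ^ J * B) :=
      mul_le_mul h4 (mul_le_mul_of_nonneg_right h3 h5) (by positivity) (by positivity)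
    linarith [(abs_le.1 (h1.trans h2)).1]
  have hSsum := Finset.card_nsmul_le_sum _ _ _ hS
  rw [← sum_capped_eq_sum_stratumSum, Finset.card_range, nsmul_eq_mul] at hSsum
  push_cast at hSsum
  linarith

theorem card_excess_gt_le_of_bounds (hN : 10 ≤ Fintype.card (HalfEdge d)) {κ : ℝ}
    (hκ : ∑ i, (d i : ℝ) ^ 2 ≤ κ * Fintype.card (HalfEdge d)) (J : ℕ) :
    (∑ Γ : Configuration d, if Γ.excess ≤ J then (0 : ℝ) else 1) ≤
      (2 * κ + 4 * κ ^ 2) / (J + 1) * Fintype.card (Configuration d) := by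
  have hN' : (0 : ℝ) < Fintype.card (HalfEdge d) := by
    have : 0 < Fintype.card (HalfEdge d) := by omega
    exact_mod_cast this
  have hP0 := pairCount_nonneg (d := d)
  have hP := (pairCount_le d).trans hκ
  have hm : pairCount d * (2 / Fintype.card (HalfEdge d)) +
      (pairCount d * (2 / Fintype.card (HalfEdge d))) ^ 2 ≤ 2 * κ + 4 * κ ^ 2 := by
    have h1 : pairCount d * (2 / Fintype.card (HalfEdge d)) ≤ 2 * κ := by
      rw [← mul_div_assoc, div_le_iff₀ hN']; linarith
    have h2 : (pairCount d * (2 / Fintype.card (HalfEdge d))) ^ 2 ≤ (2 * κ) ^ 2 :=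
      pow_le_pow_left₀ (by positivity) h1 2
    rw [mul_pow 2 κ] at h2
    linarith
  refine (card_excess_gt_le (d := d) J).trans
    ((div_le_div_of_nonneg_right (sum_excess_le hN) (by positivity)).trans ?_)
  rw [div_mul_eq_mul_div]
  exact div_le_div_of_nonneg_right (mul_le_mul_of_nonneg_right hm (Nat.cast_nonneg _))
    (by positivity)

/-- Apply the centred bound to 1_A − a; the configurations of excess above J, missing from the sum,
cost at most their proportion. The number `a` is given by an equation, not as a quotient, so that an
empty set of graphs is allowed. -/
theorem le_mean_capped_value {D : ℕ} (hD : ∀ i, d i ≤ D)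
    (hN : 10 ≤ Fintype.card (HalfEdge d)) {κ : ℝ}
    (hκ : ∑ i, (d i : ℝ) ^ 2 ≤ κ * Fintype.card (HalfEdge d)) (J : ℕ) {x y g E : ℝ}
    (hx : x = (D : ℝ) ^ 2 / Fintype.card (HalfEdge d)) (hy : y = 1 / Fintype.card (HalfEdge d))
    (hg : g = (10 + 4 * ↑(J + 1)) * y + 4 * x)
    (hE : E = (4 * ↑(J + 1) + 16 * ↑(J + 1) ^ 2) * (8 * κ ^ 2 * x) +
    (4 * ↑(J + 1) + 16 * ↑(J + 1) ^ 2) * (6 * g * 2 ^ (J + 1)) +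
    (4 * ↑(J + 1) + 16 * ↑(J + 1) ^ 2) * g +
    (√((5 * κ ^ 2 + κ ^ 3) * x) + 2 * ↑(J + 1) * x))
    (hE0 : 0 ≤ E) (hd : Even (∑ i, d i)) (A : Set (SimpleGraph (Fin n))) {a : ℝ} (ha0 : 0 ≤ a)
    (ha1 : a ≤ 1)
    (ha : ∑ G ∈ graphs d, A.indicator (1 : SimpleGraph (Fin n) → ℝ) G = a * (graphs d).card) :
    a ≤ (∑ Γ : Configuration d, if Γ.excess ≤ J then
        value (A.indicator 1) Γ.excess Γ else 0) / Fintype.card (Configuration d) +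
      ((2 * κ + 4 * κ ^ 2) / (J + 1) +
        (J + 1) * (J * ((1 + (2 * κ + κ ^ 2)) ^ J * E))) := by
  have hNe := Configuration.nonempty_of_even hd
  have hC : (0 : ℝ) < Fintype.card (Configuration d) := by exact_mod_cast Fintype.card_pos
  set ψ : SimpleGraph (Fin n) → ℝ := fun G => A.indicator (1 : SimpleGraph (Fin n) → ℝ) G - a
  have hψ : ∀ G, |ψ G| ≤ 1 := by
    intro G
    rw [abs_le]
    by_cases hGA : G ∈ A
    · simp only [ψ, Set.indicator_of_mem hGA, Pi.one_apply]
      constructor <;> linarith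
    · simp only [ψ, Set.indicator_of_notMem hGA]
      constructor <;> linarith
  have hS0 : ∑ G ∈ graphs d, ψ G = 0 := by
    rw [Finset.sum_sub_distrib, ha, Finset.sum_const, nsmul_eq_mul]
    ring
  have hSsum := neg_le_sum_capped_value hD hN hκ J hx hy hg hE hE0 hψ hS0
  clear hE
  have htail := card_excess_gt_le_of_bounds hN hκ J
  set C : ℝ := ((Fintype.card (Configuration d) : ℕ) : ℝ)
  have hval : (∑ Γ : Configuration d, if Γ.excess ≤ J then value ψ Γ.excess Γ else 0) =
      (∑ Γ : Configuration d, if Γ.excess ≤ J then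
        value (A.indicator 1) Γ.excess Γ else 0) - a * C +
      a * ∑ Γ : Configuration d, if Γ.excess ≤ J then (0 : ℝ) else 1 := by
    have h1 : a * C = ∑ _Γ : Configuration d, a := by
      rw [Finset.sum_const, Finset.card_univ, nsmul_eq_mul, mul_comm]
    rw [h1, Finset.mul_sum, ← Finset.sum_sub_distrib, ← Finset.sum_add_distrib]
    refine Finset.sum_congr rfl fun Γ _ => ?_
    split_ifs
    · rw [value_sub_const]; ring
    · ring
  rw [hval] at hSsum
  have htail0 : 0 ≤ ∑ Γ : Configuration d, if Γ.excess ≤ J then (0 : ℝ) else 1 :=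
    Finset.sum_nonneg fun Γ _ => by split_ifs <;> norm_num
  generalize (∑ Γ : Configuration d, if Γ.excess ≤ J then
    value (A.indicator 1) Γ.excess Γ else 0) = V at *
  generalize (∑ Γ : Configuration d, if Γ.excess ≤ J then (0 : ℝ) else 1) = U at *
  rw [← sub_le_iff_le_add, le_div_iff₀ hC, sub_mul, add_mul]
  have h1 : a * U ≤ U := mul_le_of_le_one_left htail0 ha1
  have h2 : ((J : ℝ) + 1) * (J * ((1 + (2 * κ + κ ^ 2)) ^ J * E)) * C =
      (J + 1) * (J * ((1 + (2 * κ + κ ^ 2)) ^ J * (E * C))) := by ring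
  rw [h2]
  linarith

theorem ofReal_le_switchedLaw_add {D : ℕ} (hD : ∀ i, d i ≤ D)
    (hN : 10 ≤ Fintype.card (HalfEdge d)) {κ : ℝ}
    (hκ : ∑ i, (d i : ℝ) ^ 2 ≤ κ * Fintype.card (HalfEdge d)) (J : ℕ) {x y : ℝ}
    (hx : x = (D : ℝ) ^ 2 / Fintype.card (HalfEdge d)) (hy : y = 1 / Fintype.card (HalfEdge d))
    (hg1 : (10 + 4 * ↑(J + 1)) * y + 4 * x < 1) (hd : Even (∑ i, d i)) (R : BadEdgeRule d)
    (A : Set (SimpleGraph (Fin n))) {a : ℝ} (ha0 : 0 ≤ a) (ha1 : a ≤ 1)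
    (ha : ∑ G ∈ graphs d, A.indicator (1 : SimpleGraph (Fin n) → ℝ) G = a * (graphs d).card) :
    ENNReal.ofReal a ≤ switchedLaw hd R A + ENNReal.ofReal (errorBound κ J x y) := by
  have hN' : (0 : ℝ) < Fintype.card (HalfEdge d) := by
    have : 0 < Fintype.card (HalfEdge d) := by omega
    exact_mod_cast this
  have hG := card_not_generic_le_of_excess hD (J + 1)
  have hG10 : (10 : ℝ) ≤ 10 + 4 * ↑(J + 1) + 4 * (D : ℝ) ^ 2 := by
    have : (0 : ℝ) ≤ 4 * ↑(J + 1) + 4 * (D : ℝ) ^ 2 := by positivity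
    linarith
  obtain ⟨g, hg⟩ : ∃ g, g = (10 + 4 * ↑(J + 1)) * y + 4 * x := ⟨_, rfl⟩
  have hgN : (10 + 4 * ↑(J + 1) + 4 * (D : ℝ) ^ 2) / Fintype.card (HalfEdge d) = g := by
    rw [hg, hx, hy]; field_simp
  have hGN : 10 + 4 * ↑(J + 1) + 4 * (D : ℝ) ^ 2 < Fintype.card (HalfEdge d) := by
    rw [← hg, ← hgN, div_lt_one hN'] at hg1
    exact hg1
  have hκ0 : 0 ≤ κ := nonneg_of_mul_nonneg_left (le_trans (by positivity) hκ) hN'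
  have hmean := mean_value_le_sum_terminalProb (K := J) hG10
    (fun Γ b h => hG Γ b (h.trans (Nat.le_succ J))) hGN hd R A
  have hx0 : 0 ≤ x := by rw [hx]; positivity
  have hg0 : 0 ≤ g := by rw [← hgN]; positivity
  obtain ⟨E, hE⟩ : ∃ E, E = (4 * ↑(J + 1) + 16 * ↑(J + 1) ^ 2) * (8 * κ ^ 2 * x) +
    (4 * ↑(J + 1) + 16 * ↑(J + 1) ^ 2) * (6 * g * 2 ^ (J + 1)) +
    (4 * ↑(J + 1) + 16 * ↑(J + 1) ^ 2) * g +
    (√((5 * κ ^ 2 + κ ^ 3) * x) + 2 * ↑(J + 1) * x) := ⟨_, rfl⟩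
  have hE0 : 0 ≤ E := by rw [hE]; positivity
  have hV := le_mean_capped_value hD hN hκ J hx hy hg hE hE0 hd A ha0 ha1 ha
  obtain ⟨F, hF⟩ : ∃ F, F = (2 * κ + 4 * κ ^ 2) / (J + 1) +
    (J + 1) * (J * ((1 + (2 * κ + κ ^ 2)) ^ J * E)) := ⟨_, rfl⟩
  have hF0 : 0 ≤ F := by rw [hF]; positivity
  have hη : errorBound κ J x y = F + J * (6 * g * 2 ^ J) := by rw [hF, hE, hg]; rfl
  rw [← hF] at hV
  have hgN' : (J : ℝ) * (6 * (10 + 4 * ↑(J + 1) + 4 * (D : ℝ) ^ 2) * 2 ^ J /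
      Fintype.card (HalfEdge d)) = J * (6 * g * 2 ^ J) := by
    rw [← hgN]; ring
  rw [hgN'] at hmean
  calc ENNReal.ofReal a ≤ _ := (ENNReal.ofReal_le_ofReal hV).trans ENNReal.ofReal_add_le
    _ ≤ (switchedLaw hd R A + ENNReal.ofReal (J * (6 * g * 2 ^ J))) + ENNReal.ofReal F :=
        add_le_add_left (hmean.trans
          (add_le_add_left (sum_terminalProb_le_switchedLaw hd R A) _)) _
    _ = _ := by
        rw [hη, add_assoc, ← ENNReal.ofReal_add (by positivity) hF0, add_comm F]

theorem tendsto_errorBound (κ : ℝ) (J : ℕ) {x y : ℕ → ℝ} (hx : Tendsto x atTop (𝓝 0))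
    (hy : Tendsto y atTop (𝓝 0)) : Tendsto (fun n => errorBound κ J (x n) (y n)) atTop
      (𝓝 ((2 * κ + 4 * κ ^ 2) / (J + 1))) := by
  have hc : Continuous fun p : ℝ × ℝ => errorBound κ J p.1 p.2 := by
    unfold errorBound; fun_prop
  have h := (hc.tendsto (0, 0)).comp (hx.prodMk_nhds hy)
  have h0 : errorBound κ J 0 0 = (2 * κ + 4 * κ ^ 2) / (J + 1) := by simp [errorBound]
  rw [← h0]
  exact h

end Comparison

/-! ### Passage to the limit -/

section Limit

open scoped Classical

open Configuration

variable {n : ℕ} {d : Fin n → ℕ}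

theorem exists_coupling_laws (hd : Even (∑ i, d i)) (R : BadEdgeRule d) :
    ∃ π : Measure (SimpleGraph (Fin n) × SimpleGraph (Fin n)),
      π.map Prod.fst = switchedLaw hd R ∧ π.map Prod.snd = uniformLaw d ∧
      ∀ η, (∀ A, uniformLaw d A ≤ switchedLaw hd R A + η) → π {p | p.1 ≠ p.2} ≤ η := by
  obtain ⟨h1, _, h2⟩ := switchedLaw_univ hd R
  have : IsFiniteMeasure (switchedLaw hd R) := ⟨h2.trans_lt ENNReal.one_lt_top⟩
  have : IsFiniteMeasure (uniformLaw d) := ⟨(h1 ▸ h2).trans_lt ENNReal.one_lt_top⟩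
  exact exists_coupling _ _ h1

theorem exists_isSimple_and_uniformLaw_le {D : ℕ} (hD : ∀ i, d i ≤ D)
    (hN : 10 ≤ ∑ i, d i) {κ : ℝ}
    (hκ : ∑ i, (d i : ℝ) ^ 2 ≤ κ * (∑ i, d i : ℕ)) (J : ℕ) {x y ε : ℝ}
    (hx : x = (D : ℝ) ^ 2 / (∑ i, d i : ℕ)) (hy : y = 1 / (∑ i, d i : ℕ))
    (hg : (10 + 4 * ↑(J + 1)) * y + 4 * x < 1) (h1 : errorBound κ J x y < 1)
    (hε : errorBound κ J x y ≤ ε) (hd : Even (∑ i, d i)) (R : BadEdgeRule d) :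
    (∃ Γ : Configuration d, Γ.IsSimple) ∧
      ∀ A, uniformLaw d A ≤ switchedLaw hd R A + ENNReal.ofReal ε := by
  rw [← card_halfEdge] at hN hκ hx hy
  have hne : (graphs d).Nonempty := by
    by_contra hc
    rw [Finset.not_nonempty_iff_eq_empty] at hc
    -- If no graph had these degrees, the centring condition would hold trivially with a = 1, and
    -- the bound would read 1 ≤ 0 + error with error below 1.
    have h2 := ofReal_le_switchedLaw_add hD hN hκ J hx hy hg hd R Set.univ zero_le_one le_rfl
      (by simp)
    rw [(switchedLaw_univ hd R).1, uniformLaw_eq, hc] at h2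
    simp only [Finset.coe_empty, uniformOn_empty_meas, Measure.coe_zero, Pi.zero_apply,
      zero_add] at h2
    rw [ENNReal.ofReal_le_ofReal_iff'] at h2
    rcases h2 with h2 | h2 <;> linarith
  refine ⟨graphs_nonempty_iff.1 hne, fun A => ?_⟩
  have hpos : (0 : ℝ) < (graphs d).card := by exact_mod_cast hne.card_pos
  rw [uniformLaw_apply]
  refine (ofReal_le_switchedLaw_add hD hN hκ J hx hy hg hd R A ?_ ?_ ?_).trans
    (add_le_add_right (ENNReal.ofReal_le_ofReal hε) _)
  · exact div_nonneg (Finset.sum_nonneg fun G _ => Set.indicator_nonneg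
      (fun _ _ => zero_le_one) G) hpos.le
  · rw [div_le_one hpos, ← nsmul_one]
    exact Finset.sum_le_card_nsmul _ _ _ fun G _ =>
      Set.indicator_le_self' (fun _ _ => zero_le_one) G
  · rw [div_mul_cancel₀ _ hpos.ne']

theorem eventually_uniformLaw_le
    (d : ∀ n : ℕ, Fin n → ℕ)
    (heven : ∀ n, Even (∑ i, d n i))
    (hsum : (fun n : ℕ => ((∑ i, d n i : ℕ) : ℝ)) =Θ[atTop] fun n : ℕ => (n : ℝ))
    (hsq : (fun n : ℕ => ((∑ i, d n i ^ 2 : ℕ) : ℝ)) =O[atTop] fun n : ℕ => (n : ℝ))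
    (hmax : (fun n : ℕ => ((Finset.univ.sup (d n) : ℕ) : ℝ)) =o[atTop] fun n : ℕ => √(n : ℝ))
    (R : ∀ n, BadEdgeRule (d n)) {ε : ℝ} (hε : 0 < ε) :
    ∀ᶠ n in atTop, (∃ Γ : Configuration (d n), Γ.IsSimple) ∧
      ∀ A, uniformLaw (d n) A ≤ switchedLaw (heven n) (R n) A + ENNReal.ofReal ε := by
  obtain ⟨κ, hκ⟩ := (hsq.trans hsum.2).bound
  set x : ℕ → ℝ := fun n => ((Finset.univ.sup (d n) : ℕ) : ℝ) ^ 2 / (∑ i, d n i : ℕ)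
  set y : ℕ → ℝ := fun n => 1 / (∑ i, d n i : ℕ)
  have hx : Tendsto x atTop (𝓝 0) := by
    have h1 : (fun n : ℕ => ((Finset.univ.sup (d n) : ℕ) : ℝ) ^ 2) =o[atTop]
        fun n : ℕ => (n : ℝ) :=
      (hmax.pow (by norm_num : 0 < 2)).congr_right fun n => Real.sq_sqrt (Nat.cast_nonneg n)
    exact (h1.trans_isBigO hsum.2).tendsto_div_nhds_zero
  have hNtop : Tendsto (fun n : ℕ => ((∑ i, d n i : ℕ) : ℝ)) atTop atTop := by
    have h1 := hsum.tendsto_norm_atTop_iff.2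
      (tendsto_norm_atTop_atTop.comp (tendsto_natCast_atTop_atTop (R := ℝ)))
    exact h1.congr fun n => Real.norm_natCast _
  have hy : Tendsto y atTop (𝓝 0) :=
    (tendsto_inv_atTop_zero.comp hNtop).congr fun n => (one_div _).symm
  have hm : 0 < min ε 1 := lt_min hε one_pos
  -- J is fixed first, to make the Markov tail small. The other errors then vanish as `n` grows,
  -- since D²/N and 1/N tend to zero; the minimum with 1 serves the existence argument.
  obtain ⟨J, hJ⟩ : ∃ J : ℕ, (2 * κ + 4 * κ ^ 2) / (J + 1) < min ε 1 := by
    obtain ⟨J, hJ⟩ := exists_nat_gt ((2 * κ + 4 * κ ^ 2) / min ε 1)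
    refine ⟨J, ?_⟩
    rw [div_lt_iff₀ hm] at hJ
    rw [div_lt_iff₀ (by positivity)]
    nlinarith
  have hg : Tendsto (fun n => (10 + 4 * ↑(J + 1)) * y n + 4 * x n) atTop (𝓝 0) := by
    have := (hy.const_mul (10 + 4 * ((J + 1 : ℕ) : ℝ))).add (hx.const_mul 4)
    simpa using this
  filter_upwards [hκ, (tendsto_errorBound κ J hx hy).eventually_lt_const hJ,
    hg.eventually_lt_const one_pos, hNtop.eventually_ge_atTop 10] with n h1 h2 h3 h4
  refine exists_isSimple_and_uniformLaw_le (D := Finset.univ.sup (d n))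
    (fun i => Finset.le_sup (Finset.mem_univ i)) (by exact_mod_cast h4) ?_ J rfl rfl h3
    (h2.trans_le (min_le_right _ _)) (h2.le.trans (min_le_left _ _)) _ _
  rw [Real.norm_natCast, Real.norm_natCast] at h1
  exact_mod_cast h1

end Limit

theorem theorem1
    (d : ∀ n : ℕ, Fin n → ℕ)
    (heven : ∀ n, Even (∑ i, d n i))
    (hsum : (fun n : ℕ => ((∑ i, d n i : ℕ) : ℝ)) =Θ[atTop] fun n : ℕ => (n : ℝ))
    (hsq : (fun n : ℕ => ((∑ i, d n i ^ 2 : ℕ) : ℝ)) =O[atTop] fun n : ℕ => (n : ℝ))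
    (hmax : (fun n : ℕ => ((Finset.univ.sup (d n) : ℕ) : ℝ)) =o[atTop] fun n : ℕ => √(n : ℝ))
    (R : ∀ n, BadEdgeRule (d n)) :
    (∀ᶠ n in atTop, IsProbabilityMeasure (switchedLaw (heven n) (R n)) ∧
      IsProbabilityMeasure (uniformLaw (d n))) ∧
    Tendsto (fun n => tvDist (switchedLaw (heven n) (R n)) (uniformLaw (d n))) atTop (𝓝 0) ∧
    ∃ π : ∀ n : ℕ, Measure (SimpleGraph (Fin n) × SimpleGraph (Fin n)),
      (∀ n, (π n).map Prod.fst = switchedLaw (heven n) (R n) ∧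
        (π n).map Prod.snd = uniformLaw (d n)) ∧
      Tendsto (fun n => π n {p | p.1 ≠ p.2}) atTop (𝓝 0) := by
  have key := fun ε hε => eventually_uniformLaw_le d heven hsum hsq hmax R (ε := ε) hε
  have hprob : ∀ n, (∃ Γ : Configuration (d n), Γ.IsSimple) →
      IsProbabilityMeasure (switchedLaw (heven n) (R n)) ∧
      IsProbabilityMeasure (uniformLaw (d n)) := by
    intro n hn
    obtain ⟨h1, h2, _⟩ := switchedLaw_univ (heven n) (R n)
    exact ⟨⟨h2 hn⟩, ⟨h1 ▸ h2 hn⟩⟩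
  choose π hπ1 hπ2 hπ3 using fun n => exists_coupling_laws (heven n) (R n)
  refine ⟨(key 1 one_pos).mono fun n hn => hprob n hn.1, ?_, π, fun n => ⟨hπ1 n, hπ2 n⟩, ?_⟩
  · rw [Metric.tendsto_nhds]
    intro ε hε
    filter_upwards [key (ε / 2) (by positivity)] with n hn
    obtain ⟨h1, h2⟩ := hprob n hn.1
    rw [Real.dist_eq, sub_zero, abs_of_nonneg (tvDist_nonneg _ _)]
    have := tvDist_le_of_forall_le _ _ (by positivity : (0 : ℝ) ≤ ε / 2) hn.2
    linarith
  · rw [ENNReal.tendsto_nhds_zero]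
    intro ε hε
    by_cases htop : ε = ⊤
    · exact Eventually.of_forall fun n => htop ▸ le_top
    · filter_upwards [key ε.toReal (ENNReal.toReal_pos hε.ne' htop)] with n hn
      have := hπ3 n _ hn.2
      rwa [ENNReal.ofReal_toReal htop] at this
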